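/- In the ordered $k$-median problem we are given a finite metric space on points $\mathcal D=\{1,\dots,n\}$ with distances $(c_{ij})$ (distinct points may be at distance zero), an integer $k$ with $1\le k\le n$, and real weights $w_1\ge w_2\ge\dots\ge w_n\ge 0$. A solution consists of a set $F\subseteq\mathcal D$ with $|F|=k$ and an assignment of every $j\in\mathcal D$ to a center $i(j)\in F$. Its cost is $\sum_{j=1}^n w_j\,\vec c^{\,\downarrow}_j$, where $\vec c^{\,\downarrow}$ is the vector $(c_{i(j)j})_{j\in\mathcal D}$ sorted in non-increasing order. Theorem. There are a single algorithm (a program for a random access machine which performs each arithmetic operation or comparison of real numbers, and each addition, subtraction or comparison of natural numbers, in one step, with rational program constants and no rounding operation), a constant $C$ and a polynomial $p$ such that the following holds. Given any such instance and any real $0<\varepsilon<1$ as input, the algorithm halts after at most $p\bigl((n/\varepsilon)^{1/\varepsilon}\bigr)$ steps and outputs a solution whose cost is at most $(18+C\varepsilon)$ times the minimum cost of a solution. That is, ordered $k$-median with general non-increasing weights has an $(18+O(\varepsilon))$-approximation algorithm that runs in time $\operatorname{poly}\bigl((n/\varepsilon)^{1/\varepsilon}\bigr)$. -/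

import Mathlib

/-! ### Real random access machines

A program works on finitely many named arrays (memory banks) of natural numbers, and finitely many
named arrays of real numbers.  Cells are addressed by computed natural numbers (indirect addressing).
Natural numbers can be added, subtracted and compared; real numbers can be added,
subtracted, multiplied, divided and compared.  There is no rounding from reals to naturals, no
multiplication of naturals, and all constants of a program are rational. Every elementary operation
takes one step. -/

namespace RealRAM

/-- Contents of the memory: `nat a i` and `real a i` are the `i`-th cells of the `a`-th array of
naturals and of reals. -/
@[ext]
structure State where
  nat : ℕ → ℕ → ℕ
  real : ℕ → ℕ → ℝ

/-- Expressions with natural values. -/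
inductive NatExp where
  | const (m : ℕ)
  | load (a : ℕ) (idx : NatExp)
  | add (x y : NatExp)
  | sub (x y : NatExp)

/-- Expressions with real values. -/
inductive RealExp where
  | const (q : ℚ)
  | load (a : ℕ) (idx : NatExp)
  | cast (x : NatExp)
  | add (x y : RealExp)
  | sub (x y : RealExp)
  | mul (x y : RealExp)
  | div (x y : RealExp)

/-- Tests. -/
inductive Test where
  | natLe (x y : NatExp)
  | realLe (x y : RealExp)
  | not (b : Test)
  | and (b c : Test)

/-- Programs. -/
inductive Program where
  | skip
  | setNat (a : ℕ) (idx : NatExp) (x : NatExp)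
  | setReal (a : ℕ) (idx : NatExp) (x : RealExp)
  | seq (p q : Program)
  | ite (b : Test) (p q : Program)
  | whileDo (b : Test) (p : Program)

/-- Value of an expression; subtraction of naturals is truncated at zero. -/
def NatExp.eval (s : State) : NatExp → ℕ
  | const m => m
  | load a idx => s.nat a (idx.eval s)
  | add x y => x.eval s + y.eval s
  | sub x y => x.eval s - y.eval s

/-- Number of elementary operations used to evaluate an expression. -/
def NatExp.steps : NatExp → ℕ
  | const _ => 1
  | load _ idx => idx.steps + 1
  | add x y => x.steps + y.steps + 1
  | sub x y => x.steps + y.steps + 1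

/-- Value of an expression; a quotient with denominator zero has the value zero. -/
noncomputable def RealExp.eval (s : State) : RealExp → ℝ
  | const q => (q : ℝ)
  | load a idx => s.real a (idx.eval s)
  | cast x => (x.eval s : ℝ)
  | add x y => x.eval s + y.eval s
  | sub x y => x.eval s - y.eval s
  | mul x y => x.eval s * y.eval s
  | div x y => x.eval s / y.eval s

/-- Number of elementary operations used to evaluate an expression. -/
def RealExp.steps : RealExp → ℕ
  | const _ => 1
  | load _ idx => idx.steps + 1
  | cast x => x.steps + 1
  | add x y => x.steps + y.steps + 1
  | sub x y => x.steps + y.steps + 1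
  | mul x y => x.steps + y.steps + 1
  | div x y => x.steps + y.steps + 1

/-- Truth of a test. -/
def Test.Holds (s : State) : Test → Prop
  | natLe x y => x.eval s ≤ y.eval s
  | realLe x y => x.eval s ≤ y.eval s
  | not b => ¬ b.Holds s
  | and b c => b.Holds s ∧ c.Holds s

/-- Number of elementary operations used to evaluate a test. -/
def Test.steps : Test → ℕ
  | natLe x y => x.steps + y.steps + 1
  | realLe x y => x.steps + y.steps + 1
  | not b => b.steps + 1
  | and b c => b.steps + c.steps + 1

/-- Overwrite cell `i` of the natural array `a`. -/
def State.writeNat (s : State) (a i m : ℕ) : State :=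
  { s with nat := Function.update s.nat a (Function.update (s.nat a) i m) }

/-- Overwrite cell `i` of the real array `a`. -/
def State.writeReal (s : State) (a i : ℕ) (x : ℝ) : State :=
  { s with real := Function.update s.real a (Function.update (s.real a) i x) }

/-- `Runs p s s' t`: program `p`, started in the state `s`, halts in the state `s'` after exactly
`t` steps. -/
inductive Runs : Program → State → State → ℕ → Prop
  | skip (s : State) : Runs .skip s s 1
  | setNat (s : State) (a : ℕ) (idx x : NatExp) :
      Runs (.setNat a idx x) s (s.writeNat a (idx.eval s) (x.eval s)) (idx.steps + x.steps + 1)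
  | setReal (s : State) (a : ℕ) (idx : NatExp) (x : RealExp) :
      Runs (.setReal a idx x) s (s.writeReal a (idx.eval s) (x.eval s)) (idx.steps + x.steps + 1)
  | seq {p q : Program} {s s₁ s₂ : State} {t₁ t₂ : ℕ} :
      Runs p s s₁ t₁ → Runs q s₁ s₂ t₂ → Runs (.seq p q) s s₂ (t₁ + t₂)
  | ite_true {b : Test} {p q : Program} {s s₁ : State} {t : ℕ} :
      b.Holds s → Runs p s s₁ t → Runs (.ite b p q) s s₁ (b.steps + 1 + t)
  | ite_false {b : Test} {p q : Program} {s s₁ : State} {t : ℕ} :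
      ¬ b.Holds s → Runs q s s₁ t → Runs (.ite b p q) s s₁ (b.steps + 1 + t)
  | while_false {b : Test} {p : Program} {s : State} :
      ¬ b.Holds s → Runs (.whileDo b p) s s (b.steps + 1)
  | while_true {b : Test} {p : Program} {s s₁ s₂ : State} {t₁ t₂ : ℕ} :
      b.Holds s → Runs p s s₁ t₁ → Runs (.whileDo b p) s₁ s₂ t₂ →
        Runs (.whileDo b p) s s₂ (b.steps + 1 + t₁ + t₂)

/-- Programs are deterministic: the final state and the number of steps are determined by the
initial state. -/
theorem Runs.unique {p : Program} {s s₁ s₂ : State} {t₁ t₂ : ℕ}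
    (h₁ : Runs p s s₁ t₁) (h₂ : Runs p s s₂ t₂) : s₁ = s₂ ∧ t₁ = t₂ := by
  induction h₁ generalizing s₂ t₂ with
  | skip s => cases h₂; exact ⟨rfl, rfl⟩
  | setNat s a idx x => cases h₂; exact ⟨rfl, rfl⟩
  | setReal s a idx x => cases h₂; exact ⟨rfl, rfl⟩
  | seq _ _ ih₁ ih₂ =>
    cases h₂ with
    | seq g₁ g₂ =>
      obtain ⟨rfl, rfl⟩ := ih₁ g₁
      obtain ⟨rfl, rfl⟩ := ih₂ g₂
      exact ⟨rfl, rfl⟩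
  | ite_true hb _ ih =>
    cases h₂ with
    | ite_true _ g => obtain ⟨rfl, rfl⟩ := ih g; exact ⟨rfl, rfl⟩
    | ite_false hb' _ => exact absurd hb hb'
  | ite_false hb _ ih =>
    cases h₂ with
    | ite_true hb' _ => exact absurd hb' hb
    | ite_false _ g => obtain ⟨rfl, rfl⟩ := ih g; exact ⟨rfl, rfl⟩
  | while_false hb =>
    cases h₂ with
    | while_false _ => exact ⟨rfl, rfl⟩
    | while_true hb' _ _ => exact absurd hb' hb
  | while_true hb _ _ ih₁ ih₂ =>
    cases h₂ with
    | while_false hb' => exact absurd hb hb'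
    | while_true _ g₁ g₂ =>
      obtain ⟨rfl, rfl⟩ := ih₁ g₁
      obtain ⟨rfl, rfl⟩ := ih₂ g₂
      exact ⟨rfl, rfl⟩

end RealRAM

/-! ### The ordered `k`-median problem -/

namespace OrderedKMedian

/-- The vector `v` with its coordinates sorted in non-increasing order. -/
noncomputable def sortDesc {n : ℕ} (v : Fin n → ℝ) : Fin n → ℝ :=
  fun i => v (Tuple.sort v (Fin.rev i))

/-- The ordered cost: the `j`-th largest coordinate of `v` is multiplied by `w j`. -/
noncomputable def orderedCost {n : ℕ} (w v : Fin n → ℝ) : ℝ :=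
  ∑ j, w j * sortDesc v j

/-- An instance: a finite (pseudo)metric space on `n` points, numbered `0, …, n - 1`, a number
`k` of centers, and non-increasing nonnegative weights. -/
structure Instance where
  n : ℕ
  k : ℕ
  one_le_k : 1 ≤ k
  k_le_n : k ≤ n
  metric : PseudoMetricSpace (Fin n)
  w : Fin n → ℝ
  w_antitone : Antitone w
  w_nonneg : ∀ j, 0 ≤ w j

/-- The distance between two points of an instance. -/
def Instance.c (I : Instance) (i j : Fin I.n) : ℝ := I.metric.dist i j

/-- A solution: a set of `k` centers together with an assignment of every point to a center. -/
structure Solution (I : Instance) where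
  centers : Finset (Fin I.n)
  card_centers : centers.card = I.k
  assign : Fin I.n → Fin I.n
  assign_mem : ∀ j, assign j ∈ centers

/-- The objective value of a solution. -/
noncomputable def Solution.cost {I : Instance} (S : Solution I) : ℝ :=
  orderedCost I.w (fun j => I.c (S.assign j) j)

/-- The initial state for the instance `I` and the accuracy `ε`: natural array `0` holds `n, k`;
real array `0` holds `ε`, real array `1` holds the weights and real array `2` the distance matrix,
row by row.  All other cells are zero. -/
noncomputable def input (I : Instance) (ε : ℝ) : RealRAM.State where
  nat a i := if a = 0 then (if i = 0 then I.n else if i = 1 then I.k else 0) else 0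
  real a i :=
    if a = 0 then (if i = 0 then ε else 0)
    else if a = 1 then (if h : i < I.n then I.w ⟨i, h⟩ else 0)
    else if a = 2 then
      (if h : i / I.n < I.n ∧ i % I.n < I.n then I.c ⟨i / I.n, h.1⟩ ⟨i % I.n, h.2⟩ else 0)
    else 0

/-- The final state `s` describes the solution `S`: natural array `1` is the indicator of the set
of centers and natural array `2` lists the assignment. -/
def IsOutput {I : Instance} (s : RealRAM.State) (S : Solution I) : Prop :=
  (∀ i : Fin I.n, s.nat 1 i = if i ∈ S.centers then 1 else 0) ∧
    ∀ j : Fin I.n, s.nat 2 j = S.assign j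

end OrderedKMedian

/-! Extend the weights by `w n = 0`. By Abel summation the ordered cost of a vector is a nonnegative
combination, with coefficients `w l - w (l + 1)`, of the sums of its `l + 1` largest entries. For
every threshold `t` such a sum is at most `(l + 1) * t` plus the sum of all excesses `max (v j - t)
0`. With thresholds `b * T l` this gives `proxy`, an upper bound (`sum_mul_le_proxy`) that consists
of a constant and of a sum over clients of the function `hinge` of the connection distance. For
fixed thresholds one is thus left with `k`-median for the connection cost `hinge`, which obeys a
three-leg triangle inequality if `b` is tripled (`hinge_add_add`).

This problem is treated by Lagrangian relaxation and the primal-dual method. Client budgets grow in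
steps of `δ`, a facility is paid once the excesses of the budgets over the connection costs reach
the price `lam`, and a maximal set `S` of paid facilities without common contributors is opened.
Then the cost of `S` at `b = 3` plus `3 * lam * |S|` is at most three times the sum of the budgets
(`IsGrowthSet.lmp`). By weak duality the budgets sum to at most the cost of any `k` centers at `b =
1`, plus `k * lam`, plus an error of order `δ` (`DualGrowth.sum_le`). Two consecutive prices, at
which at most `k` and more than `k` facilities are opened, yield two candidates: the small set,
padded to `k` points, or `k` points which include the neighbours in the large set of the small one,
completed by those whose clients would lose most. The second rounding triples `b` again, and the
better candidate loses a factor two: its cost at `b = 9` is at most six times the cost of the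
comparison solution at `b = 1`, up to the error (`bipoint_combination`, `PricePair.min_le`).

Let `u` be the sorted costs of the comparison solution, and let `T l` be about `u p` for some `p ≤ l
≤ 2 * p`. Then `9 * (l + 1) * T l` is at most about `18 * (p + 1) * u p`, while six times the
excesses over `T l` is at most six times the sum of `u i - u p` over `i ≤ p`. Together this is at
most about 18 times the sum of the `l + 1` largest costs, which is the source of the factor 18
(`nine_proxy_le`).

The thresholds are guessed. The largest cost `u 0` is one of the `n * n` distances. Starting there,
a binary word with `Q` divisions by `1 + ε` and `A` position steps `p ↦ 2 * p + 1` describes a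
staircase that follows `u` (`exists_code`). The number `2 ^ (Q + A)` of words is polynomial in `(n /
ε) ^ (1 / ε)`, since `(1 + ε) ^ (1 / ε) ≥ 2` (`exists_sizes`). Since `proxy` bounds the cost for
arbitrary thresholds, wrong guesses do no harm, and the candidate of least proxy is kept.

For the running time it suffices that every execution of every loop makes at most `B` iterations:
`Program.bound` is then polynomial in `B`. Correctness and time are proved together, through `wp`.
-/

namespace RealRAM

/-! ### Running times, frame conditions and a program logic -/

/-- Running time of a program all of whose loops are iterated at most `B` times. -/
def Program.bound (B : ℕ) : Program → ℕ
  | .skip => 1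
  | .setNat _ idx x => idx.steps + x.steps + 1
  | .setReal _ idx x => idx.steps + x.steps + 1
  | .seq p q => p.bound B + q.bound B
  | .ite b p q => b.steps + 1 + (p.bound B + q.bound B)
  | .whileDo b p => (B + 1) * (b.steps + 1 + p.bound B)

/-- Each enclosing loop raises the degree by one. For sequences and branches the degrees are added
instead of maximised, which is wasteful but enough. -/
theorem Program.exists_bound_le (p : Program) :
    ∃ c d : ℕ, ∀ B, p.bound B ≤ c * (B + 1) ^ d := by
  induction p with
  | skip => exact ⟨1, 0, fun B => by simp [bound]⟩
  | setNat a idx x => exact ⟨idx.steps + x.steps + 1, 0, fun B => by simp [bound]⟩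
  | setReal a idx x => exact ⟨idx.steps + x.steps + 1, 0, fun B => by simp [bound]⟩
  | seq p q hp hq =>
    obtain ⟨c, d, h⟩ := hp
    obtain ⟨c', d', h'⟩ := hq
    refine ⟨c + c', d + d', fun B => (add_le_add (h B) (h' B)).trans ?_⟩
    have h1 : (B + 1) ^ d ≤ (B + 1) ^ (d + d') := Nat.pow_le_pow_right (by simp) (by simp)
    have h2 : (B + 1) ^ d' ≤ (B + 1) ^ (d + d') := Nat.pow_le_pow_right (by simp) (by simp)
    rw [add_mul]
    gcongr
  | ite b p q hp hq =>
    obtain ⟨c, d, h⟩ := hp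
    obtain ⟨c', d', h'⟩ := hq
    refine ⟨b.steps + 1 + (c + c'), d + d',
      fun B => (Nat.add_le_add_left (add_le_add (h B) (h' B)) _).trans ?_⟩
    have h1 : (B + 1) ^ d ≤ (B + 1) ^ (d + d') := Nat.pow_le_pow_right (by simp) (by simp)
    have h2 : (B + 1) ^ d' ≤ (B + 1) ^ (d + d') := Nat.pow_le_pow_right (by simp) (by simp)
    have h3 : 1 ≤ (B + 1) ^ (d + d') := Nat.one_le_pow _ _ (by simp)
    rw [add_mul, add_mul c]
    exact add_le_add (Nat.le_mul_of_pos_right _ h3)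
      (add_le_add (Nat.mul_le_mul_left _ h1) (Nat.mul_le_mul_left _ h2))
  | whileDo b p hp =>
    obtain ⟨c, d, h⟩ := hp
    refine ⟨b.steps + 1 + c, d + 1, fun B => ?_⟩
    have h3 : 1 ≤ (B + 1) ^ d := Nat.one_le_pow _ _ (by simp)
    calc (B + 1) * (b.steps + 1 + p.bound B)
        ≤ (B + 1) * ((b.steps + 1) * (B + 1) ^ d + c * (B + 1) ^ d) := by
          gcongr
          · exact Nat.le_mul_of_pos_right _ h3
          · exact h B
      _ = _ := by ring

/-- The arrays of naturals to which a program writes. -/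
def Program.natWrites : Program → List ℕ
  | .skip => []
  | .setNat a _ _ => [a]
  | .setReal _ _ _ => []
  | .seq p q => p.natWrites ++ q.natWrites
  | .ite _ p q => p.natWrites ++ q.natWrites
  | .whileDo _ p => p.natWrites

/-- The arrays of reals to which a program writes. -/
def Program.realWrites : Program → List ℕ
  | .skip => []
  | .setNat _ _ _ => []
  | .setReal a _ _ => [a]
  | .seq p q => p.realWrites ++ q.realWrites
  | .ite _ p q => p.realWrites ++ q.realWrites
  | .whileDo _ p => p.realWrites

/-- The states `s` and `s'` agree except on the listed arrays. -/
structure Same (N R : List ℕ) (s s' : State) : Prop where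
  nat : ∀ a, a ∉ N → s'.nat a = s.nat a
  real : ∀ a, a ∉ R → s'.real a = s.real a

theorem Same.refl (N R : List ℕ) (s : State) : Same N R s s := ⟨fun _ _ => rfl, fun _ _ => rfl⟩

theorem Same.trans {N R : List ℕ} {s s' s'' : State} (h : Same N R s s') (h' : Same N R s' s'') :
    Same N R s s'' :=
  ⟨fun a ha => (h'.nat a ha).trans (h.nat a ha), fun a ha => (h'.real a ha).trans (h.real a ha)⟩

theorem Same.mono {N R N' R' : List ℕ} {s s' : State} (h : Same N R s s') (hN : N ⊆ N')
    (hR : R ⊆ R') : Same N' R' s s' :=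
  ⟨fun a ha => h.nat a fun h' => ha (hN h'), fun a ha => h.real a fun h' => ha (hR h')⟩

theorem State.writeNat_nat_of_ne {s : State} {a b i x : ℕ} (h : b ≠ a) :
    (s.writeNat a i x).nat b = s.nat b := by
  simp [State.writeNat, h]

@[simp] theorem State.writeNat_nat_self {s : State} {a i x : ℕ} :
    (s.writeNat a i x).nat a = Function.update (s.nat a) i x := by
  simp [State.writeNat]

@[simp] theorem State.writeNat_real {s : State} {a i x : ℕ} :
    (s.writeNat a i x).real = s.real := rfl

theorem State.writeReal_real_of_ne {s : State} {a b i : ℕ} {x : ℝ} (h : b ≠ a) :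
    (s.writeReal a i x).real b = s.real b := by
  simp [State.writeReal, h]

@[simp] theorem State.writeReal_real_self {s : State} {a i : ℕ} {x : ℝ} :
    (s.writeReal a i x).real a = Function.update (s.real a) i x := by
  simp [State.writeReal]

@[simp] theorem State.writeReal_nat {s : State} {a i : ℕ} {x : ℝ} :
    (s.writeReal a i x).nat = s.nat := rfl

attribute [simp] State.writeNat_nat_of_ne State.writeReal_real_of_ne

theorem Same.writeNat {N R : List ℕ} {s s' : State} (h : Same N R s s') {a : ℕ} (ha : a ∈ N)
    (i x : ℕ) : Same N R s (s'.writeNat a i x) :=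
  ⟨fun b hb => by
    have : b ≠ a := by rintro rfl; exact hb ha
    simp [this, h.nat b hb], h.real⟩

/-- Frame rule: which arrays can change is read off from the program text, so that the side
conditions on concrete programs can be decided. -/
theorem Runs.same {p : Program} {s s' : State} {t : ℕ} (h : Runs p s s' t) :
    Same p.natWrites p.realWrites s s' := by
  induction h with
  | skip s => exact .refl _ _ _
  | setNat s a idx x =>
    refine ⟨fun b hb => ?_, fun b hb => rfl⟩
    simp only [Program.natWrites, List.mem_singleton] at hb
    simp [hb]
  | setReal s a idx x =>
    refine ⟨fun b hb => rfl, fun b hb => ?_⟩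
    simp only [Program.realWrites, List.mem_singleton] at hb
    simp [hb]
  | seq _ _ h₁ h₂ =>
    exact (h₁.mono (List.subset_append_left _ _) (List.subset_append_left _ _)).trans
      (h₂.mono (List.subset_append_right _ _) (List.subset_append_right _ _))
  | ite_true _ _ h => exact h.mono (List.subset_append_left _ _) (List.subset_append_left _ _)
  | ite_false _ _ h => exact h.mono (List.subset_append_right _ _) (List.subset_append_right _ _)
  | while_false _ => exact .refl _ _ _
  | while_true _ _ _ h₁ h₂ => exact h₁.trans h₂

/-- Started in `s`, the program `p` halts within the time `p.bound B` in a state satisfying `Q`. -/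
def wp (B : ℕ) (p : Program) (Q : State → Prop) (s : State) : Prop :=
  ∃ s' t, Runs p s s' t ∧ t ≤ p.bound B ∧ Q s'

variable {B : ℕ} {p q : Program} {Q Q' : State → Prop} {s : State}

theorem wp_skip (h : Q s) : wp B .skip Q s := ⟨s, 1, .skip s, le_rfl, h⟩

theorem wp_setNat {a : ℕ} {idx x : NatExp} (h : Q (s.writeNat a (idx.eval s) (x.eval s))) :
    wp B (.setNat a idx x) Q s := ⟨_, _, .setNat s a idx x, le_rfl, h⟩

theorem wp_setReal {a : ℕ} {idx : NatExp} {x : RealExp}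
    (h : Q (s.writeReal a (idx.eval s) (x.eval s))) :
    wp B (.setReal a idx x) Q s := ⟨_, _, .setReal s a idx x, le_rfl, h⟩

theorem wp_seq (h : wp B p (wp B q Q) s) : wp B (.seq p q) Q s := by
  obtain ⟨s₁, t₁, r₁, b₁, s₂, t₂, r₂, b₂, h⟩ := h
  exact ⟨s₂, t₁ + t₂, r₁.seq r₂, add_le_add b₁ b₂, h⟩

theorem wp_ite {b : Test} (h₁ : b.Holds s → wp B p Q s) (h₂ : ¬ b.Holds s → wp B q Q s) :
    wp B (.ite b p q) Q s := by
  by_cases hb : b.Holds s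
  · obtain ⟨s', t, r, bd, h⟩ := h₁ hb
    exact ⟨s', _, .ite_true hb r, by simp only [Program.bound]; omega, h⟩
  · obtain ⟨s', t, r, bd, h⟩ := h₂ hb
    exact ⟨s', _, .ite_false hb r, by simp only [Program.bound]; omega, h⟩

theorem wp_mono (h : wp B p Q s) (h' : ∀ s', Q s' → Q' s') : wp B p Q' s := by
  obtain ⟨s', t, r, bd, h⟩ := h
  exact ⟨s', t, r, bd, h' s' h⟩

/-- Use of a verified subprogram: its specification is weakened to what is needed next, with the
unchanged arrays available as an extra hypothesis. -/
theorem wp_call {N R : List ℕ} (h : wp B p Q s) (hN : p.natWrites ⊆ N) (hR : p.realWrites ⊆ R)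
    (h' : ∀ s', Same N R s s' → Q s' → Q' s') : wp B p Q' s := by
  obtain ⟨s', t, r, bd, h⟩ := h
  exact ⟨s', t, r, bd, h' s' (r.same.mono hN hR) h⟩

/-- Total correctness: the variant `V` drops in each iteration, so its initial value bounds the
number of iterations and hence justifies the factor `B + 1` in `Program.bound`. -/
theorem wp_while {b : Test} (I : State → Prop) (V : State → ℕ)
    (hstep : ∀ s, I s → b.Holds s → V s ≠ 0 ∧ wp B p (fun s' => I s' ∧ V s' < V s) s)
    (h0 : I s) (hV : V s ≤ B) (hQ : ∀ s, I s → ¬ b.Holds s → Q s) :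
    wp B (.whileDo b p) Q s := by
  have key : ∀ r s, V s ≤ r → I s → ∃ s' t, Runs (.whileDo b p) s s' t ∧
      t ≤ (r + 1) * (b.steps + 1 + p.bound B) ∧ I s' ∧ ¬ b.Holds s' := by
    intro r
    induction r with
    | zero =>
      intro s hr hI
      by_cases hb : b.Holds s
      · exact absurd (Nat.le_zero.mp hr) (hstep s hI hb).1
      · exact ⟨s, _, .while_false hb, by omega, hI, hb⟩
    | succ r ih =>
      intro s hr hI
      by_cases hb : b.Holds s
      · obtain ⟨s₁, t₁, r₁, b₁, h₁, h₁'⟩ := (hstep s hI hb).2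
        obtain ⟨s₂, t₂, r₂, b₂, h₂, h₂'⟩ := ih s₁ (by omega) h₁
        refine ⟨s₂, _, .while_true hb r₁ r₂, ?_, h₂, h₂'⟩
        rw [add_mul (r + 1), one_mul]
        omega
      · exact ⟨s, _, .while_false hb, by nlinarith [Nat.zero_le (p.bound B), Nat.zero_le r], hI, hb⟩
  obtain ⟨s', t, r, bd, h, h'⟩ := key _ s le_rfl h0
  exact ⟨s', t, r, bd.trans (Nat.mul_le_mul_right _ (by omega)), hQ s' h h'⟩

/-- The value of a scalar variable: cell `0` of an array. -/
@[reducible] def nv (a : ℕ) : NatExp := .load a (.const 0)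

/-- The value of a real scalar variable: cell `0` of an array. -/
@[reducible] def rv (a : ℕ) : RealExp := .load a (.const 0)

/-- The loop `for c = 0, …, e - 1 do p`. -/
def Program.forTo (c : ℕ) (e : NatExp) (p : Program) : Program :=
  .seq (.setNat c (.const 0) (.const 0))
    (.whileDo (.not (.natLe e (nv c)))
      (.seq p (.setNat c (.const 0) (.add (nv c) (.const 1)))))

/-- The bound `e` is reevaluated before each pass, so it has to keep its value under all changes
that the body may make. The invariant is required after the counter has been increased, because it
may speak of the whole state. -/
theorem wp_forTo {c : ℕ} {e : NatExp} (N R : List ℕ) (m : ℕ) (I : ℕ → State → Prop)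
    (hN : c ∉ p.natWrites ∧ c ∈ N ∧ p.natWrites ⊆ N) (hR : p.realWrites ⊆ R) (hm : m ≤ B)
    (he : ∀ s', Same N R s s' → e.eval s' = m)
    (h0 : I 0 (s.writeNat c 0 0))
    (hstep : ∀ i s', i < m → Same N R s s' → s'.nat c 0 = i → I i s' →
      wp B p (fun s'' => I (i + 1) (s''.writeNat c 0 (i + 1))) s')
    (hQ : ∀ s', Same N R s s' → s'.nat c 0 = m → I m s' → Q s') :
    wp B (.forTo c e p) Q s := by
  refine wp_seq (wp_setNat ?_)
  refine wp_while (fun s' => Same N R s s' ∧ s'.nat c 0 ≤ m ∧ I (s'.nat c 0) s')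
    (fun s' => m - s'.nat c 0) ?_ ?_ ?_ ?_
  · rintro s' ⟨hs, hle, hI⟩ hb
    simp only [Test.Holds, NatExp.eval, he s' hs, not_le] at hb
    refine ⟨by omega, wp_seq (wp_call (hstep _ s' hb hs rfl hI) (List.Subset.refl _)
      (List.Subset.refl _) fun s'' hs'' hI' => wp_setNat ?_)⟩
    have hc : s''.nat c 0 = s'.nat c 0 := by rw [hs''.nat c hN.1]
    simp only [NatExp.eval, hc]
    refine ⟨⟨(hs.trans (hs''.mono hN.2.2 hR)).writeNat hN.2.1 _ _, ?_, ?_⟩, ?_⟩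
    · simpa using hb
    · simpa using hI'
    · simp; omega
  · refine ⟨(Same.refl N R s).writeNat hN.2.1 _ _, ?_, ?_⟩
    · simp [NatExp.eval]
    · simpa [NatExp.eval] using h0
  · simp only [State.writeNat_nat_self]
    simp [NatExp.eval, hm]
  · rintro s' ⟨hs, hle, hI⟩ hb
    simp only [Test.Holds, NatExp.eval, he s' hs, not_le, not_lt] at hb
    have : s'.nat c 0 = m := by omega
    exact hQ s' hs this (this ▸ hI)

/-- Equality of naturals. -/
def Test.natEq (x y : NatExp) : Test := .and (.natLe x y) (.natLe y x)

@[simp] theorem Test.natEq_holds {x y : NatExp} :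
    (Test.natEq x y).Holds s ↔ x.eval s = y.eval s := by
  simp only [natEq, Holds]; omega

/-- The entry of an array of naturals at the position given by a scalar variable. -/
@[reducible] def na (a i : ℕ) : NatExp := .load a (nv i)

/-- The entry of an array of reals at the position given by a scalar variable. -/
@[reducible] def ra (a i : ℕ) : RealExp := .load a (nv i)

end RealRAM

/-! ### Discrete dual growth and its approximation guarantee -/

namespace OrderedKMedian

open Finset

/-- The total amount by which the budgets `δ * b j` exceed the costs `H i j`. -/
noncomputable def excess (n : ℕ) (δ : ℝ) (H : ℕ → ℕ → ℝ) (i : ℕ) (b : ℕ → ℕ) : ℝ :=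
  ∑ j ∈ range n, max (δ * b j - H i j) 0

/-- State before round `t` of the dual growth process with step width `δ`: the budget of client `j`
has stopped at `δ * a j` (or still grows, if `a j = t`), and facility `i` has been paid for, at the
price `lam`, in round `τ i` (or not yet, if `τ i = t`). -/
structure DualGrowth (n : ℕ) (δ lam : ℝ) (H : ℕ → ℕ → ℝ) (t : ℕ) (a τ : ℕ → ℕ) : Prop where
  a_le : ∀ j < n, a j ≤ t
  tau_le : ∀ i < n, τ i ≤ t
  unpaid : ∀ i < n, ∀ x < τ i, excess n δ H i (fun j => min (a j) x) < lam
  paid : ∀ i < n, τ i < t → lam ≤ excess n δ H i (fun j => min (a j) (τ i))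
  reach : ∀ j < n, a j < t → ∃ i < n, τ i ≤ a j ∧ H i j ≤ δ * a j
  before : ∀ j < n, ∀ i < n, ∀ x < a j, τ i ≤ x → δ * x < H i j

theorem excess_congr {n : ℕ} {δ : ℝ} {H : ℕ → ℕ → ℝ} {i : ℕ} {b b' : ℕ → ℕ}
    (h : ∀ j < n, b j = b' j) : excess n δ H i b = excess n δ H i b' :=
  sum_congr rfl fun j hj => by rw [h j (mem_range.mp hj)]

theorem DualGrowth.zero (n : ℕ) (δ lam : ℝ) (H : ℕ → ℕ → ℝ) {a τ : ℕ → ℕ}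
    (ha : ∀ j < n, a j = 0) (hτ : ∀ i < n, τ i = 0) : DualGrowth n δ lam H 0 a τ where
  a_le j hj := by simp [ha j hj]
  tau_le j hj := by simp [hτ j hj]
  unpaid i hi x hx := by simp [hτ i hi] at hx
  paid i hi hx := by simp at hx
  reach i hi hx := by simp at hx
  before j hj i hi x hx := by simp [ha j hj] at hx

/-- One round consists of two half-steps: unpaid facilities are tested against the old budgets, then
growing budgets are tested against the facilities paid up to and including this round. Reaching the
new bound `t + 1` encodes that nothing has happened yet. -/
theorem DualGrowth.succ {n : ℕ} {δ lam : ℝ} {H : ℕ → ℕ → ℝ} {t : ℕ} {a τ a' τ' : ℕ → ℕ}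
    (h : DualGrowth n δ lam H t a τ)
    (hτ : ∀ i < n, (τ i = t → excess n δ H i a < lam → τ' i = t + 1) ∧
      (¬ (τ i = t ∧ excess n δ H i a < lam) → τ' i = τ i))
    (ha : ∀ j < n, (a j = t → (∀ i < n, τ' i ≤ t → δ * t < H i j) → a' j = t + 1) ∧
      (¬ (a j = t ∧ ∀ i < n, τ' i ≤ t → δ * t < H i j) → a' j = a j)) :
    DualGrowth n δ lam H (t + 1) a' τ' := by
  have hτ' : ∀ i < n, (τ i = t ∧ excess n δ H i a < lam ∧ τ' i = t + 1) ∨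
      (¬ (τ i = t ∧ excess n δ H i a < lam) ∧ τ' i = τ i) := fun i hi => by
    by_cases hc : τ i = t ∧ excess n δ H i a < lam
    · exact .inl ⟨hc.1, hc.2, (hτ i hi).1 hc.1 hc.2⟩
    · exact .inr ⟨hc, (hτ i hi).2 hc⟩
  have ha' : ∀ j < n, (a j = t ∧ (∀ i < n, τ' i ≤ t → δ * t < H i j) ∧ a' j = t + 1) ∨
      (¬ (a j = t ∧ ∀ i < n, τ' i ≤ t → δ * t < H i j) ∧ a' j = a j) := fun j hj => by
    by_cases hc : a j = t ∧ ∀ i < n, τ' i ≤ t → δ * t < H i j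
    · exact .inl ⟨hc.1, hc.2, (ha j hj).1 hc.1 hc.2⟩
    · exact .inr ⟨hc, (ha j hj).2 hc⟩
  -- A budget changes only from `t` to `t + 1`, so budgets truncated at a round `x ≤ t` are
  -- unchanged and earlier statements on payments survive.
  have hmin : ∀ x ≤ t, ∀ j < n, min (a' j) x = min (a j) x := by
    intro x hx j hj
    rcases ha' j hj with ⟨h1, -, h2⟩ | ⟨-, h2⟩ <;> rw [h2]
    rw [h1]; omega
  have hmint : ∀ j < n, min (a j) t = a j := fun j hj => min_eq_left (h.a_le j hj)
  refine ⟨fun j hj => ?_, fun i hi => ?_, fun i hi x hx => ?_, fun i hi hx => ?_,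
    fun j hj hx => ?_, fun j hj i hi x hx hix => ?_⟩
  · have := h.a_le j hj
    rcases ha' j hj with ⟨-, -, h2⟩ | ⟨-, h2⟩ <;> omega
  · have := h.tau_le i hi
    rcases hτ' i hi with ⟨-, -, h2⟩ | ⟨-, h2⟩ <;> omega
  · have hle := h.tau_le i hi
    rcases hτ' i hi with ⟨h0, h1, h2⟩ | ⟨-, h2⟩ <;> rw [h2] at hx
    · rw [excess_congr (hmin x (by omega))]
      rcases Nat.lt_succ_iff_lt_or_eq.mp hx with h3 | rfl
      · exact h.unpaid i hi x (by omega)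
      · rwa [excess_congr hmint]
    · rw [excess_congr (hmin x (by omega))]
      exact h.unpaid i hi x hx
  · have hle := h.tau_le i hi
    rcases hτ' i hi with ⟨h0, h1, h2⟩ | ⟨h1, h2⟩
    · omega
    · rw [h2, excess_congr (hmin _ hle)]
      rcases hle.lt_or_eq with h3 | h3
      · exact h.paid i hi h3
      · rw [h3, excess_congr hmint]
        exact not_lt.mp fun h4 => h1 ⟨h3, h4⟩
  · have hle := h.a_le j hj
    rcases ha' j hj with ⟨h0, h1, h2⟩ | ⟨h1, h2⟩
    · omega
    · rw [h2]
      rcases hle.lt_or_eq with h3 | h3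
      · obtain ⟨i, hi, h4, h5⟩ := h.reach j hj h3
        refine ⟨i, hi, ?_, h5⟩
        rcases hτ' i hi with ⟨h6, -, -⟩ | ⟨-, h6⟩ <;> omega
      · have : ¬ ∀ i < n, τ' i ≤ t → δ * t < H i j := fun h4 => h1 ⟨h3, h4⟩
        push Not at this
        rwa [h3]
  · have hle := h.a_le j hj
    have hτx : x < t → τ i ≤ x := fun hxt => by
      rcases hτ' i hi with ⟨-, -, h6⟩ | ⟨-, h6⟩ <;> omega
    rcases ha' j hj with ⟨h0, h1, h2⟩ | ⟨h1, h2⟩ <;> rw [h2] at hx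
    · rcases Nat.lt_succ_iff_lt_or_eq.mp hx with h3 | rfl
      · exact h.before j hj i hi x (by omega) (hτx h3)
      · exact h1 i hi hix
    · exact h.before j hj i hi x hx (hτx (by omega))

/-- Some client contributes to the payment of both facilities. -/
def Conflict (n : ℕ) (δ : ℝ) (H : ℕ → ℕ → ℝ) (a τ : ℕ → ℕ) (i i' : ℕ) : Prop :=
  ∃ l < n, (a l ≤ τ i ∧ H i l ≤ δ * a l) ∧ (a l ≤ τ i' ∧ H i' l ≤ δ * a l)

/-- `S` is a maximal set of paid facilities without conflicts after `N + 1` rounds of dual growth.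
-/
structure IsGrowthSet (n N : ℕ) (δ lam : ℝ) (H : ℕ → ℕ → ℝ) (a τ : ℕ → ℕ) (S : Finset ℕ) :
    Prop where
  growth : DualGrowth n δ lam H (N + 1) a τ
  paid : ∀ i ∈ S, i < n ∧ τ i ≤ N
  indep : ∀ i ∈ S, ∀ i' ∈ S, i ≠ i' → ¬ Conflict n δ H a τ i i'
  maximal : ∀ i < n, τ i ≤ N → ∃ i' ∈ S, i' = i ∨ Conflict n δ H a τ i i'

section

variable {n N : ℕ} {δ lam : ℝ} {H : ℕ → ℕ → ℝ} {a τ : ℕ → ℕ} {S : Finset ℕ}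

/-- Point `j` is itself a facility at cost zero for client `j`. By round `N` a growing client could
pay for it alone, and once it is paid the budget stops. -/
theorem DualGrowth.a_le_of_le (h : DualGrowth n δ lam H (N + 1) a τ) (hδ : 0 ≤ δ)
    (hlam : lam ≤ δ * N) (hH : ∀ i < n, H i i = 0) {j : ℕ} (hj : j < n) : a j ≤ N := by
  by_contra! hlt
  have h1 : ¬ τ j ≤ N := fun hle => by
    have := h.before j hj j hj N hlt hle
    rw [hH j hj] at this
    exact absurd this (not_lt.mpr (by positivity))
  have h2 := h.unpaid j hj N (by omega)
  refine absurd h2 (not_lt.mpr (hlam.trans ?_))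
  have h3 : δ * N ≤ max (δ * (min (a j) N : ℕ) - H j j) 0 := by
    rw [hH j hj, min_eq_right hlt.le, sub_zero]
    exact le_max_left _ _
  exact h3.trans (single_le_sum (f := fun l => max (δ * (min (a l) N : ℕ) - H j l) 0)
    (fun l _ => le_max_right _ _) (mem_range.mpr hj))

/-- One round before being paid a facility has received less than `lam`. Later each client adds at
most one step `δ`: it either stops by round `τ i`, or it stops as soon as its budget reaches the
open facility. This is the approximate dual feasibility. -/
theorem DualGrowth.excess_le (h : DualGrowth n δ lam H (N + 1) a τ) (hδ : 0 ≤ δ) (hlam : 0 ≤ lam)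
    (hH : ∀ i j, 0 ≤ H i j) {i : ℕ} (hi : i < n) : excess n δ H i a ≤ lam + n * δ := by
  -- If `τ i = 0`, truncated subtraction yields round zero, where all budgets and hence all payments
  -- vanish.
  have h1 : excess n δ H i (fun j => min (a j) (τ i - 1)) ≤ lam := by
    rcases Nat.eq_zero_or_pos (τ i) with h0 | h0
    · refine le_trans (le_of_eq (sum_eq_zero fun j _ => ?_)) hlam
      simpa [h0] using hH i j
    · exact (h.unpaid i hi _ (by omega)).le
  have h2 : excess n δ H i a ≤ excess n δ H i (fun j => min (a j) (τ i - 1)) + n * δ := by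
    have : (n : ℝ) * δ = ∑ j ∈ range n, δ := by simp
    rw [this, excess, excess, ← sum_add_distrib]
    refine sum_le_sum fun j hj => ?_
    have hj := mem_range.mp hj
    rcases le_or_gt (a j) (τ i) with h3 | h3
    · have h4 : (a j : ℝ) ≤ (min (a j) (τ i - 1) : ℕ) + 1 := by
        exact_mod_cast (by omega : a j ≤ min (a j) (τ i - 1) + 1)
      refine max_le ?_ (by positivity)
      have h5 : δ * a j ≤ δ * ((min (a j) (τ i - 1) : ℕ) + 1) := by gcongr
      linarith [le_max_left (δ * (min (a j) (τ i - 1) : ℕ) - H i j) 0]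
    · have h4 := h.before j hj i hi (a j - 1) (by omega) (by omega)
      rw [Nat.cast_sub (by omega)] at h4
      refine max_le ?_ (by positivity)
      have := le_max_right (δ * (min (a j) (τ i - 1) : ℕ) - H i j) 0
      push_cast at h4
      linarith
  linarith

/-- A client still growing after round `τ i` has not reached `i` in that round, so it pays nothing.
The whole price therefore comes from clients with `a j ≤ τ i`, the only ones that `Conflict`
considers. -/
theorem DualGrowth.le_sum_contributors (h : DualGrowth n δ lam H (N + 1) a τ) {i : ℕ} (hi : i < n)
    (hτ : τ i ≤ N) :
    lam ≤ ∑ j ∈ range n, if a j ≤ τ i then max (δ * a j - H i j) 0 else 0 := by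
  refine (h.paid i hi (by omega)).trans (sum_le_sum fun j hj => ?_)
  have hj := mem_range.mp hj
  beta_reduce
  split_ifs with h1
  · rw [min_eq_left h1]
  · have := h.before j hj i hi (τ i) (by omega) le_rfl
    rw [min_eq_right (by omega)]
    exact max_le (by linarith) le_rfl

/-- Weak duality: the part of a budget not spent on the connection to `o j` counts towards the
payment for `o j`, and payments are bounded by `excess_le`. -/
theorem DualGrowth.sum_le (h : DualGrowth n δ lam H (N + 1) a τ) (hδ : 0 ≤ δ) (hlam : 0 ≤ lam)
    (hH : ∀ i j, 0 ≤ H i j) {O : Finset ℕ} {k : ℕ} (hO : ∀ i ∈ O, i < n) (hk : O.card ≤ k)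
    {o : ℕ → ℕ} (ho : ∀ j < n, o j ∈ O) :
    ∑ j ∈ range n, δ * a j ≤ ∑ j ∈ range n, H (o j) j + k * (lam + n * δ) := by
  have h1 : ∑ j ∈ range n, (δ * a j - H (o j) j) ≤ ∑ i ∈ O, excess n δ H i a := by
    unfold excess
    rw [sum_comm]
    refine sum_le_sum fun j hj => (le_max_left _ 0).trans ?_
    exact single_le_sum (f := fun i => max (δ * a j - H i j) 0) (fun i _ => le_max_right _ _)
      (ho j (mem_range.mp hj))
  have h2 : ∑ i ∈ O, excess n δ H i a ≤ ∑ i ∈ O, (lam + n * δ) :=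
    sum_le_sum fun i hi => h.excess_le hδ hlam hH (hO i hi)
  have h3 : (O.card : ℝ) * (lam + n * δ) ≤ k * (lam + n * δ) := by gcongr
  rw [sum_const, nsmul_eq_mul] at h2
  rw [sum_sub_distrib] at h1
  linarith

/-- The Lagrangian multiplier preserving estimate for the facilities opened by dual growth. -/
theorem IsGrowthSet.lmp (h : IsGrowthSet n N δ lam H a τ S) (hδ : 0 ≤ δ) (hlam : lam ≤ δ * N)
    (hH0 : ∀ i < n, H i i = 0) (hH : ∀ i j, 0 ≤ H i j) {H₃ : ℕ → ℕ → ℝ}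
    (h₃ : ∀ i j, H₃ i j ≤ H i j) (htri : ∀ i i' j l, H₃ i' j ≤ H i j + H i l + H i' l)
    {σ : ℕ → ℕ} (hσ : ∀ j < n, ∀ i ∈ S, H₃ (σ j) j ≤ H₃ i j) :
    ∑ j ∈ range n, H₃ (σ j) j + 3 * (lam * S.card) ≤ 3 * ∑ j ∈ range n, δ * a j := by
  have h1 : lam * S.card ≤
      ∑ j ∈ range n, ∑ i ∈ S, if a j ≤ τ i then max (δ * a j - H i j) 0 else 0 := by
    rw [sum_comm, mul_comm, ← nsmul_eq_mul, ← sum_const]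
    exact sum_le_sum fun i hi => h.growth.le_sum_contributors (h.paid i hi).1 (h.paid i hi).2
  have h2 : ∀ j ∈ range n, H₃ (σ j) j +
      3 * (∑ i ∈ S, if a j ≤ τ i then max (δ * a j - H i j) 0 else 0) ≤ 3 * (δ * a j) := by
    intro j hj
    have hj := mem_range.mp hj
    -- A client that contributes to a facility of `S` contributes to no other one, by independence;
    -- its budget covers connection and payment, even with the payment counted three times.
    by_cases hex : ∃ i ∈ S, a j ≤ τ i ∧ H i j ≤ δ * a j
    · obtain ⟨i, hi, h3, h4⟩ := hex
      rw [sum_eq_single_of_mem i hi, if_pos h3, max_eq_left (by linarith)]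
      · have := hσ j hj i hi
        have := h₃ i j
        linarith [hH i j]
      · intro i' hi' hne
        split_ifs with h5
        · refine max_eq_right ?_
          by_contra! h6
          exact h.indep i hi i' hi' hne.symm ⟨j, hj, ⟨h3, h4⟩, h5, by linarith⟩
        · rfl
    · push Not at hex
      rw [sum_eq_zero, mul_zero, add_zero]
      · have haj := h.growth.a_le_of_le hδ hlam hH0 hj
        -- Otherwise the client stopped at a paid facility `i`, which is in `S` or conflicts with
        -- some `i'` in `S` through a client `l`. Since `a l ≤ τ i ≤ a j`, each of the three legs
        -- from `j` to `i'` costs at most the budget of `j`.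
        obtain ⟨i, hi, h3, h4⟩ := h.growth.reach j hj (by omega)
        obtain ⟨i', hi', h5⟩ := h.maximal i hi (h3.trans haj)
        refine (hσ j hj i' hi').trans ?_
        rcases h5 with rfl | ⟨l, hl, ⟨h6, h7⟩, h8, h9⟩
        · have := h₃ i' j
          have : 0 ≤ δ * a j := by positivity
          linarith
        · have h10 : δ * a l ≤ δ * a j := by
            have : (a l : ℝ) ≤ a j := by exact_mod_cast h6.trans h3
            gcongr
          linarith [htri i i' j l]
      · intro i hi
        split_ifs with h3
        · exact max_eq_right (by linarith [hex i hi h3])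
        · rfl
  have h3 := sum_le_sum h2
  rw [sum_add_distrib, ← mul_sum, ← mul_sum] at h3
  linarith

/-- Degenerate case of zero price and step: everything is paid and stopped in round zero, and two
opened points with the same center at cost zero conflict through that center. Hence `o` is injective
on `S`. -/
theorem IsGrowthSet.card_le_of_zero (h : IsGrowthSet n N 0 0 H a τ S) (hH0 : ∀ i < n, H i i = 0)
    (hH : ∀ i j, H i j = H j i) {O : Finset ℕ} (hO : ∀ i ∈ O, i < n) {o : ℕ → ℕ}
    (ho : ∀ j < n, o j ∈ O) (hz : ∀ j < n, H (o j) j ≤ 0) : S.card ≤ O.card := by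
  have hτ : ∀ i < n, τ i = 0 := by
    intro i hi
    by_contra hne
    refine absurd (h.growth.unpaid i hi 0 (Nat.pos_of_ne_zero hne)) (not_lt.mpr ?_)
    exact sum_nonneg fun j _ => le_max_right _ _
  have ha : ∀ j < n, a j = 0 := by
    intro j hj
    by_contra hne
    have := h.growth.before j hj j hj 0 (Nat.pos_of_ne_zero hne) (hτ j hj).le
    simp [hH0 j hj] at this
  refine card_le_card_of_injOn o (fun i hi => ho i (h.paid i hi).1) ?_
  intro i hi i' hi' heq
  by_contra hne
  have hi1 := (h.paid i hi).1
  have hi2 := (h.paid i' hi').1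
  have hl := hO _ (ho i hi1)
  refine h.indep i hi i' hi' hne ⟨o i, hl, ⟨by simp [ha _ hl], ?_⟩, by simp [ha _ hl], ?_⟩
  · rw [hH]; simpa using hz i hi1
  · rw [hH, heq]; simpa using hz i' hi2

end

/-! ### Connection costs for given thresholds -/

/-- The convex cost of a distance `x` given by the weights `w` and the thresholds `b * T l`. -/
noncomputable def hinge (n : ℕ) (w T : ℕ → ℝ) (b x : ℝ) : ℝ :=
  ∑ l ∈ range n, (w l - w (l + 1)) * max (x - b * T l) 0

section

variable {n : ℕ} {w T : ℕ → ℝ}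

theorem hinge_nonneg (hw : ∀ l, w (l + 1) ≤ w l) (b x : ℝ) : 0 ≤ hinge n w T b x :=
  sum_nonneg fun l _ => mul_nonneg (sub_nonneg.mpr (hw l)) (le_max_right _ _)

theorem hinge_mono (hw : ∀ l, w (l + 1) ≤ w l) (b : ℝ) {x y : ℝ} (hxy : x ≤ y) :
    hinge n w T b x ≤ hinge n w T b y :=
  sum_le_sum fun l _ => mul_le_mul_of_nonneg_left (max_le_max (by linarith) le_rfl)
    (sub_nonneg.mpr (hw l))

theorem hinge_anti (hw : ∀ l, w (l + 1) ≤ w l) (hT : ∀ l, 0 ≤ T l) {b b' : ℝ} (hb : b ≤ b')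
    (x : ℝ) : hinge n w T b' x ≤ hinge n w T b x :=
  sum_le_sum fun l _ => mul_le_mul_of_nonneg_left
    (max_le_max (sub_le_sub_left (mul_le_mul_of_nonneg_right hb (hT l)) _) le_rfl)
    (sub_nonneg.mpr (hw l))

theorem hinge_zero (hT : ∀ l, 0 ≤ T l) {b : ℝ} (hb : 0 ≤ b) : hinge n w T b 0 = 0 :=
  sum_eq_zero fun l _ => by
    rw [max_eq_right, mul_zero]
    have := mul_nonneg hb (hT l)
    linarith

/-- The threshold `3 * b * T l` can be split among the three legs. This replaces the triangle
inequality, and each use of it triples the multiple of the thresholds. -/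
theorem hinge_add_add (hw : ∀ l, w (l + 1) ≤ w l) (b x y z : ℝ) :
    hinge n w T (3 * b) (x + y + z) ≤ hinge n w T b x + hinge n w T b y + hinge n w T b z := by
  unfold hinge
  rw [← sum_add_distrib, ← sum_add_distrib]
  refine sum_le_sum fun l _ => ?_
  rw [← mul_add, ← mul_add]
  refine mul_le_mul_of_nonneg_left (max_le ?_ (by positivity)) (sub_nonneg.mpr (hw l))
  linarith [le_max_left (x - b * T l) 0, le_max_left (y - b * T l) 0, le_max_left (z - b * T l) 0]

/-- The coefficients telescope. The resulting crude bound on the cost of any solution fixes the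
range of prices to be searched. -/
theorem hinge_le (hw : ∀ l, w (l + 1) ≤ w l) (hw0 : 0 ≤ w n) (hT : ∀ l, 0 ≤ T l) {b x : ℝ}
    (hb : 0 ≤ b) (hx : 0 ≤ x) : hinge n w T b x ≤ w 0 * x := by
  have h1 : hinge n w T b x ≤ ∑ l ∈ range n, (w l - w (l + 1)) * x :=
    sum_le_sum fun l _ => mul_le_mul_of_nonneg_left
      (max_le (sub_le_self _ (mul_nonneg hb (hT l))) hx) (sub_nonneg.mpr (hw l))
  rw [← sum_mul, sum_range_sub'] at h1
  exact h1.trans (mul_le_mul_of_nonneg_right (by linarith) hx)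

end

/-! ### Combining a small and a large set of facilities -/

/-- Of a set `S` one drops only points of small score, if one keeps a small subset and adds
points of largest score. -/
theorem sum_sdiff_score_le {P S F : Finset ℕ} {f : ℕ → ℝ} {k₁ : ℕ} (hPF : P ⊆ F) (hPS : P ⊆ S)
    (hP : P.card ≤ k₁) (hF : F.card ≤ S.card) (hf : ∀ i, 0 ≤ f i) (hf0 : ∀ i, i ∉ S → f i = 0)
    (hbest : ∀ x ∈ F \ P, ∀ y ∈ S \ F, f y ≤ f x) :
    ((S.card : ℝ) - k₁) * ∑ i ∈ S \ F, f i ≤ ((S.card : ℝ) - F.card) * ∑ i ∈ S, f i := by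
  have hS : 0 ≤ ∑ i ∈ S, f i := sum_nonneg fun i _ => hf i
  have hU : 0 ≤ ∑ i ∈ S \ F, f i := sum_nonneg fun i _ => hf i
  have hF' : (F.card : ℝ) ≤ S.card := by exact_mod_cast hF
  -- If all added points lie in `S`, each scores at least as much as each dropped one, and averaging
  -- gives the fraction. If a point outside `S`, of score zero, was added, all dropped scores
  -- vanish.
  by_cases hsub : F \ P ⊆ S
  · have h1 : ((F \ P).card : ℝ) * ∑ i ∈ S \ F, f i ≤ ((S \ F).card : ℝ) * ∑ i ∈ F \ P, f i := by
      have h2 : ∑ x ∈ F \ P, ∑ y ∈ S \ F, f y ≤ ∑ x ∈ F \ P, ∑ y ∈ S \ F, f x :=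
        sum_le_sum fun x hx => sum_le_sum fun y hy => hbest x hx y hy
      simp only [sum_const, nsmul_eq_mul, ← mul_sum] at h2
      exact h2
    have hFS : F ⊆ S := by
      intro x hx
      by_cases hxP : x ∈ P
      · exact hPS hxP
      · exact hsub (mem_sdiff.mpr ⟨hx, hxP⟩)
    have h3 : ((S \ F).card : ℝ) = S.card - F.card := by
      rw [card_sdiff_of_subset hFS, Nat.cast_sub hF]
    have h4 : ((F \ P).card : ℝ) = F.card - P.card := by
      rw [card_sdiff_of_subset hPF, Nat.cast_sub (card_le_card hPF)]
    have h5 : ∑ i ∈ F \ P, f i + ∑ i ∈ S \ F, f i ≤ ∑ i ∈ S, f i := by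
      rw [← sum_sdiff hFS, add_comm]
      gcongr
      · exact fun i _ _ => hf i
      · exact sdiff_subset
    have h6 : (P.card : ℝ) ≤ k₁ := by exact_mod_cast hP
    rw [h3, h4] at h1
    have h7 : ((S.card : ℝ) - F.card) * (∑ i ∈ F \ P, f i + ∑ i ∈ S \ F, f i) ≤
        ((S.card : ℝ) - F.card) * ∑ i ∈ S, f i :=
      mul_le_mul_of_nonneg_left h5 (by linarith)
    have h8 : ((S.card : ℝ) - k₁) * ∑ i ∈ S \ F, f i ≤
        ((S.card : ℝ) - P.card) * ∑ i ∈ S \ F, f i := mul_le_mul_of_nonneg_right (by linarith) hU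
    linarith
  · obtain ⟨x, hx, hxS⟩ := not_subset.mp hsub
    have h1 : ∑ i ∈ S \ F, f i ≤ 0 :=
      sum_nonpos fun y hy => (hbest x hx y hy).trans (hf0 x hxS).le
    rw [le_antisymm h1 hU, mul_zero]
    exact mul_nonneg (by linarith) hS

/-- `σ` assigns every point to a nearest point of `S`. -/
def IsNearest (n : ℕ) (C : ℕ → ℕ → ℝ) (S : Finset ℕ) (σ : ℕ → ℕ) : Prop :=
  ∀ j < n, σ j ∈ S ∧ ∀ i ∈ S, C (σ j) j ≤ C i j

/-- The total cost of the clients of `i` with respect to `σ₂`, when they are assigned by `σ₁`. -/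
noncomputable def scoreOf (n : ℕ) (H : ℕ → ℕ → ℝ) (σ₁ σ₂ : ℕ → ℕ) (i : ℕ) : ℝ :=
  ∑ j ∈ range n, if σ₂ j = i then H (σ₁ j) j else 0

section

variable {n : ℕ} {w T : ℕ → ℝ} {C : ℕ → ℕ → ℝ} {S₁ S₂ F : Finset ℕ} {σ₁ σ₂ σ : ℕ → ℕ}

/-- Cost of the solution that keeps the points of `S₂` nearest to `S₁`, and others. -/
theorem sum_hinge_le_of_image_subset (hw : ∀ l, w (l + 1) ≤ w l) (hT : ∀ l, 0 ≤ T l)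
    (hsymm : ∀ i j, C i j = C j i) (htri : ∀ i j l, C i l ≤ C i j + C j l)
    (hS₁ : ∀ i ∈ S₁, i < n) (h₁ : IsNearest n C S₁ σ₁) (h₂ : IsNearest n C S₂ σ₂)
    (hσ : IsNearest n C F σ) (hF : S₁.image σ₂ ⊆ F) {b : ℝ} (hb : 0 ≤ b) :
    ∑ j ∈ range n, hinge n w T (3 * b) (C (σ j) j) ≤ ∑ j ∈ range n, hinge n w T b (C (σ₂ j) j) +
      2 * ∑ i ∈ S₂ \ F, scoreOf n (fun i j => hinge n w T b (C i j)) σ₁ σ₂ i := by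
  have h3 : ∑ i ∈ S₂ \ F, scoreOf n (fun i j => hinge n w T b (C i j)) σ₁ σ₂ i =
      ∑ j ∈ range n, if σ₂ j ∈ F then 0 else hinge n w T b (C (σ₁ j) j) := by
    unfold scoreOf
    rw [sum_comm]
    refine sum_congr rfl fun j hj => ?_
    rw [sum_ite_eq]
    have := (h₂ j (mem_range.mp hj)).1
    simp only [mem_sdiff, this, true_and]
    split_ifs <;> simp_all
  rw [h3, mul_sum, ← sum_add_distrib]
  refine sum_le_sum fun j hj => ?_
  have hj := mem_range.mp hj
  split_ifs with hjF
  · rw [mul_zero, add_zero]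
    exact (hinge_mono hw _ ((hσ j hj).2 _ hjF)).trans (hinge_anti hw hT (by linarith) _)
  · have hi := (h₁ j hj).1
    have h4 := (hσ j hj).2 _ (hF (mem_image_of_mem _ hi))
    have h5 := (h₂ _ (hS₁ _ hi)).2 _ (h₂ j hj).1
    -- The client goes to its center in `S₁` and on to the neighbour of that center in `S₂`, which
    -- was kept. The last leg is at most the way back from `σ₁ j` through `j` to `σ₂ j`, hence two
    -- legs to `S₁` and one to `S₂`.
    have h6 : C (σ j) j ≤ C (σ₁ j) j + C (σ₁ j) j + C (σ₂ j) j := by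
      have h7 := htri (σ₂ (σ₁ j)) (σ₁ j) j
      have h8 := htri (σ₂ j) j (σ₁ j)
      rw [hsymm j] at h8
      linarith
    refine (hinge_mono hw _ h6).trans ((hinge_add_add hw b _ _ _).trans ?_)
    linarith

/-- Each client is counted in the score of exactly one point of `S₂`. -/
theorem sum_scoreOf (h₂ : IsNearest n C S₂ σ₂) (H : ℕ → ℕ → ℝ) :
    ∑ i ∈ S₂, scoreOf n H σ₁ σ₂ i = ∑ j ∈ range n, H (σ₁ j) j := by
  unfold scoreOf
  rw [sum_comm]
  refine sum_congr rfl fun j hj => ?_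
  rw [sum_ite_eq, if_pos (h₂ j (mem_range.mp hj)).1]

theorem scoreOf_eq_zero (h₂ : IsNearest n C S₂ σ₂) (H : ℕ → ℕ → ℝ) {i : ℕ} (hi : i ∉ S₂) :
    scoreOf n H σ₁ σ₂ i = 0 :=
  sum_eq_zero fun j hj => if_neg fun (h : σ₂ j = i) => hi (h ▸ (h₂ j (mem_range.mp hj)).1)

end

/-- Combination of a small and a large set of facilities which were found at almost the same
facility price. -/
theorem bipoint_combination {c₁ c₂ vA vB U opt k₁ k₂ k μ δ E : ℝ} (h₁ : k₁ ≤ k) (h₂ : k < k₂)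
    (hk₁ : 0 ≤ k₁) (hδ : 0 ≤ δ)
    (hc₁ : c₁ + 3 * ((μ + δ) * k₁) ≤ 3 * (opt + k * (μ + δ + E)))
    (hc₂ : c₂ + 3 * (μ * k₂) ≤ 3 * (opt + k * (μ + E)))
    (h0 : 0 ≤ c₁) (h0' : 0 ≤ c₂) (hA : vA ≤ c₁) (hB : vB ≤ c₂ + 2 * U)
    (hU : (k₂ - k₁) * U ≤ (k₂ - k) * c₁) :
    min vA vB ≤ 6 * opt + 6 * (k * (E + δ)) := by
  have h3 : (k₂ - k) * c₁ ≤ (k₂ - k) * (3 * (opt + k * (μ + δ + E)) - 3 * ((μ + δ) * k₁)) :=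
    mul_le_mul_of_nonneg_left (by linarith) (by linarith)
  have h4 : (k - k₁) * c₂ ≤ (k - k₁) * (3 * (opt + k * (μ + E)) - 3 * (μ * k₂)) :=
    mul_le_mul_of_nonneg_left (by linarith) (by linarith)
  have h5 : (k₂ - k) * c₁ + (k - k₁) * c₂ ≤ (k₂ - k₁) * (3 * opt + 3 * (k * (E + δ))) := by
    have h6 : 0 ≤ (k₂ - k) * (k₁ * δ) :=
      mul_nonneg (by linarith) (mul_nonneg hk₁ hδ)
    have h7 : 0 ≤ (k - k₁) * (k * δ) :=
      mul_nonneg (by linarith) (mul_nonneg (by linarith) hδ)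
    linarith
  have hK : 0 < k₂ - k₁ := by linarith
  -- One of the two weights is at least half of their sum. Doubling then covers `c₁` alone, or `c₂`
  -- together with the rerouting cost `2 * U`.
  rcases le_total (k₂ - k₁) (2 * (k₂ - k)) with h6 | h6
  · refine (min_le_left _ _).trans (hA.trans (le_of_mul_le_mul_left ?_ hK))
    have h7 : (k₂ - k₁) * c₁ ≤ (2 * (k₂ - k)) * c₁ := mul_le_mul_of_nonneg_right h6 h0
    have h8 : 0 ≤ (k - k₁) * c₂ := mul_nonneg (by linarith) h0'
    linarith
  · refine (min_le_right _ _).trans (hB.trans (le_of_mul_le_mul_left ?_ hK))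
    have h7 : (k₂ - k₁) * c₂ ≤ (2 * (k - k₁)) * c₂ :=
      mul_le_mul_of_nonneg_right (by linarith) h0'
    linarith

/-! ### Ordered cost, thresholds and the proxy -/

/-- `u` lists the values `v 0, …, v (n - 1)` in non-increasing order. -/
structure IsSorting (n : ℕ) (v u : ℕ → ℝ) : Prop where
  sum_eq : ∀ φ : ℝ → ℝ, ∑ j ∈ range n, φ (v j) = ∑ i ∈ range n, φ (u i)
  anti : ∀ i j, i ≤ j → j < n → u j ≤ u i
  nonneg : ∀ i < n, 0 ≤ u i

theorem sum_mul_eq_sum_sub_mul_sum {w u : ℕ → ℝ} {n : ℕ} (hw : w n = 0) :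
    ∑ i ∈ range n, w i * u i = ∑ l ∈ range n, (w l - w (l + 1)) * ∑ i ∈ range (l + 1), u i := by
  have key : ∀ m, ∑ l ∈ range m, (w l - w (l + 1)) * ∑ i ∈ range (l + 1), u i =
      ∑ i ∈ range m, w i * u i - w m * ∑ i ∈ range m, u i := by
    intro m
    induction m with
    | zero => simp
    | succ m ih =>
      rw [sum_range_succ, ih, sum_range_succ u m, sum_range_succ (fun i => w i * u i) m]
      ring
  rw [key, hw]
  ring

/-- An upper bound for the ordered cost of a vector, for given thresholds. -/
noncomputable def proxy (n : ℕ) (w T : ℕ → ℝ) (b : ℝ) (v : ℕ → ℝ) : ℝ :=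
  ∑ l ∈ range n, (w l - w (l + 1)) * ((l + 1) * (b * T l)) + ∑ j ∈ range n, hinge n w T b (v j)

section

variable {n : ℕ} {w T v u : ℕ → ℝ}

/-- This holds for arbitrary thresholds, so the program can bound and compare costs without sorting
and without knowing whether a guess is right. -/
theorem sum_mul_le_proxy (hw : ∀ l, w (l + 1) ≤ w l) (hwn : w n = 0) (hu : IsSorting n v u)
    (b : ℝ) : ∑ i ∈ range n, w i * u i ≤ proxy n w T b v := by
  unfold proxy hinge
  rw [sum_mul_eq_sum_sub_mul_sum hwn, sum_comm, ← sum_add_distrib]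
  refine sum_le_sum fun l hl => ?_
  rw [← mul_sum, ← mul_add]
  refine mul_le_mul_of_nonneg_left ?_ (sub_nonneg.mpr (hw l))
  rw [hu.sum_eq (fun x => max (x - b * T l) 0)]
  have hl := mem_range.mp hl
  calc ∑ i ∈ range (l + 1), u i
      ≤ ∑ i ∈ range (l + 1), (b * T l + max (u i - b * T l) 0) :=
        sum_le_sum fun i _ => by linarith [le_max_left (u i - b * T l) 0]
    _ = (l + 1) * (b * T l) + ∑ i ∈ range (l + 1), max (u i - b * T l) 0 := by
        rw [sum_add_distrib]; simp
    _ ≤ _ := by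
        gcongr
        exact hl

/-- The thresholds `T` approximate the sorted vector `u` at positions of the form `2 ^ a - 1`. -/
def GoodThresholds (n : ℕ) (ε M : ℝ) (u T : ℕ → ℝ) : Prop :=
  ∀ l < n, ∃ p ≤ l, l ≤ 2 * p ∧ u p ≤ T l ∧ T l ≤ (1 + ε) * u p + ε * M / n

/-- After expansion in the coefficients `w l - w (l + 1)` it is enough to compare with the sum of
the `l + 1` largest costs at each level `l`. -/
theorem nine_proxy_le (hw : ∀ l, w (l + 1) ≤ w l) (hwn : w n = 0) (hn : 0 < n)
    (hu : IsSorting n v u) {ε : ℝ} (hε : 0 < ε) (hM : 0 ≤ u 0)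
    (hT : GoodThresholds n ε (u 0) u T) :
    ∑ l ∈ range n, (w l - w (l + 1)) * ((l + 1) * (9 * T l)) +
        6 * ∑ j ∈ range n, hinge n w T 1 (v j) ≤
      (18 + 27 * ε) * ∑ i ∈ range n, w i * u i := by
  have hw' : Antitone w := antitone_nat_of_succ_le hw
  have hwnn : ∀ i < n, 0 ≤ w i := fun i hi => hwn ▸ hw' hi.le
  have hfirst : w 0 * u 0 ≤ ∑ i ∈ range n, w i * u i :=
    single_le_sum (f := fun i => w i * u i)
      (fun i hi => mul_nonneg (hwnn i (mem_range.mp hi)) (hu.nonneg i (mem_range.mp hi)))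
      (mem_range.mpr hn)
  have hn' : (0 : ℝ) < n := by exact_mod_cast hn
  -- Write `X = (p + 1) * u p` and let `Y` be the sum of `u i` over `i ≤ p`. The leading terms are
  -- `18 * X + 6 * (Y - X)`, at most `18 * Y` since `X ≤ Y`. The additive error of `T l` is divided
  -- by `n`, which absorbs the factor `l + 1`.
  have h1 : ∀ l ∈ range n, (l + 1) * (9 * T l) + 6 * ∑ j ∈ range n, max (v j - 1 * T l) 0 ≤
      (18 + 18 * ε) * ∑ i ∈ range (l + 1), u i + 9 * (ε * u 0) := by
    intro l hl
    have hl := mem_range.mp hl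
    obtain ⟨p, hp, hlp, hup, hTl⟩ := hT l hl
    have hup0 := hu.nonneg p (by omega)
    have h2 : ((l : ℝ) + 1) ≤ 2 * (p + 1) := by exact_mod_cast (by omega : l + 1 ≤ 2 * (p + 1))
    have h3 : ((l : ℝ) + 1) ≤ n := by exact_mod_cast hl
    have h4 : (l + 1 : ℝ) * T l ≤ (1 + ε) * (2 * (p + 1) * u p) + ε * u 0 := by
      calc (l + 1 : ℝ) * T l ≤ (l + 1 : ℝ) * ((1 + ε) * u p + ε * u 0 / n) := by gcongr
        _ = (1 + ε) * ((l + 1) * u p) + (l + 1) / n * (ε * u 0) := by ring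
        _ ≤ (1 + ε) * (2 * (p + 1) * u p) + 1 * (ε * u 0) := by
            gcongr
            exact (div_le_one hn').mpr h3
        _ = _ := by ring
    have h5 : ∑ j ∈ range n, max (v j - 1 * T l) 0 ≤ ∑ i ∈ range (p + 1), (u i - u p) := by
      rw [hu.sum_eq (fun x => max (x - 1 * T l) 0)]
      rw [← sum_subset (range_subset_range.mpr (by omega : p + 1 ≤ n))]
      · refine sum_le_sum fun i hi => ?_
        have := hu.anti i p (by simp at hi; omega) (by omega)
        exact max_le (by linarith) (by linarith)
      · intro i hi hi'
        simp only [mem_range] at hi hi'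
        have := hu.anti p i (by omega) hi
        exact max_eq_right (by linarith)
    have h6 : ∑ i ∈ range (p + 1), u i ≤ ∑ i ∈ range (l + 1), u i := by
      refine sum_le_sum_of_subset_of_nonneg (range_subset_range.mpr (by omega)) ?_
      intro i hi _
      exact hu.nonneg i (by simp at hi; omega)
    have h7 : 0 ≤ ∑ i ∈ range (p + 1), (u i - u p) := sum_nonneg fun i hi =>
      sub_nonneg.mpr (hu.anti i p (by simp at hi; omega) (by omega))
    rw [sum_sub_distrib] at h5 h7
    simp only [sum_const, card_range, nsmul_eq_mul] at h5 h7
    push_cast at h5 h7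
    have h8 : (18 + 18 * ε) * ∑ i ∈ range (p + 1), u i ≤
        (18 + 18 * ε) * ∑ i ∈ range (l + 1), u i := by gcongr
    have h9 : 0 ≤ ε * (∑ i ∈ range (p + 1), u i - (p + 1) * u p) := mul_nonneg hε.le h7
    linarith
  have h2 : ∑ l ∈ range n, (w l - w (l + 1)) * ((l + 1) * (9 * T l)) +
      6 * ∑ j ∈ range n, hinge n w T 1 (v j) =
      ∑ l ∈ range n, (w l - w (l + 1)) *
        ((l + 1) * (9 * T l) + 6 * ∑ j ∈ range n, max (v j - 1 * T l) 0) := by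
    unfold hinge
    rw [sum_comm, mul_sum, ← sum_add_distrib]
    refine sum_congr rfl fun l _ => ?_
    rw [← mul_sum]
    ring
  rw [h2]
  calc _ ≤ ∑ l ∈ range n, (w l - w (l + 1)) *
        ((18 + 18 * ε) * ∑ i ∈ range (l + 1), u i + 9 * (ε * u 0)) :=
        sum_le_sum fun l hl => mul_le_mul_of_nonneg_left (h1 l hl) (sub_nonneg.mpr (hw l))
    _ = (18 + 18 * ε) * ∑ i ∈ range n, w i * u i + 9 * ε * (w 0 * u 0) := by
        -- The coefficients sum to `w 0`, so the additive errors amount to `9 * ε * (w 0 * u 0)`,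
        -- and `w 0 * u 0` is the first term of the ordered cost.
        rw [sum_mul_eq_sum_sub_mul_sum hwn]
        simp only [mul_add, sum_add_distrib, ← sum_mul, sum_range_sub', hwn, mul_sum]
        congr 1
        · exact sum_congr rfl fun l _ => sum_congr rfl fun i _ => by ring
        · ring
    _ ≤ _ := by nlinarith

end

/-! ### Consecutive prices and the factor six -/

/-- What the search for a facility price finds: sets of facilities opened at the price `m * δ`
and, unless `m = 0`, at the previous price. -/
structure PricePair (n k N : ℕ) (δ : ℝ) (H : ℕ → ℕ → ℝ) (m : ℕ) (S₁ S₂ : Finset ℕ) : Prop where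
  le : m ≤ N
  first : ∃ a τ, IsGrowthSet n N δ (m * δ) H a τ S₁
  card_le : S₁.card ≤ k
  second : m ≠ 0 → (∃ a τ, IsGrowthSet n N δ ((m - 1 : ℕ) * δ) H a τ S₂) ∧ k < S₂.card

section

variable {n k N m : ℕ} {w T : ℕ → ℝ} {C : ℕ → ℕ → ℝ} {δ : ℝ} {S₁ S₂ O : Finset ℕ} {o : ℕ → ℕ}

/-- The multiplier-preserving estimate meets weak duality. The path from `i'` over `l` and `i` to
`j` has three legs, so the cost at `b = 3` plays the role of `H₃`. -/
theorem IsGrowthSet.sum_hinge_le {lam : ℝ} {a τ : ℕ → ℕ} {S : Finset ℕ} {σ : ℕ → ℕ}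
    (hw : ∀ l, w (l + 1) ≤ w l) (hT : ∀ l, 0 ≤ T l)
    (hsymm : ∀ i j, C i j = C j i) (htri : ∀ i j l, C i l ≤ C i j + C j l) (hself : ∀ i, C i i = 0)
    (hδ : 0 ≤ δ) (hlam : 0 ≤ lam) (hlam' : lam ≤ δ * N)
    (h : IsGrowthSet n N δ lam (fun i j => hinge n w T 1 (C i j)) a τ S)
    (hO : ∀ i ∈ O, i < n) (hk : O.card ≤ k) (ho : ∀ j < n, o j ∈ O)
    (hσ : ∀ j < n, ∀ i ∈ S, C (σ j) j ≤ C i j) :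
    ∑ j ∈ range n, hinge n w T 3 (C (σ j) j) + 3 * (lam * S.card) ≤
      3 * (∑ j ∈ range n, hinge n w T 1 (C (o j) j) + k * (lam + n * δ)) := by
  have h1 := h.growth.sum_le hδ hlam (fun i j => hinge_nonneg hw _ _) hO hk ho
  have h2 := h.lmp (H₃ := fun i j => hinge n w T 3 (C i j)) (σ := σ) hδ hlam'
    (fun i _ => by simp [hself, hinge_zero hT]) (fun i j => hinge_nonneg hw _ _)
    (fun i j => hinge_anti hw hT (by norm_num) _)
    (fun i i' j l => ?_) (fun j hj i hi => hinge_mono hw _ (hσ j hj i hi))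
  · linarith
  · have h3 := hinge_add_add (n := n) (w := w) (T := T) hw 1 (C i j) (C i l) (C i' l)
    rw [mul_one] at h3
    refine (hinge_mono hw _ ?_).trans h3
    have := htri i' l j
    have := htri l i j
    have := hsymm l i
    linarith

theorem exists_isNearest (n : ℕ) (C : ℕ → ℕ → ℝ) {S : Finset ℕ} (hS : S.Nonempty) :
    ∃ σ, IsNearest n C S σ := by
  have := fun j => exists_min_image S (fun i => C i j) hS
  choose σ h using this
  exact ⟨σ, fun j _ => h j⟩

/-- At the largest price not more than `k` facilities are opened. -/
theorem IsGrowthSet.card_le {a τ : ℕ → ℕ} {S : Finset ℕ} {M : ℝ}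
    (hw : ∀ l, w (l + 1) ≤ w l) (hwn : w n = 0) (hT : ∀ l, 0 ≤ T l)
    (hsymm : ∀ i j, C i j = C j i) (htri : ∀ i j l, C i l ≤ C i j + C j l) (hself : ∀ i, C i i = 0)
    (hnn : ∀ i j, 0 ≤ C i j)
    (hO : ∀ i ∈ O, i < n) (hk : O.card ≤ k) (hkn : k ≤ n) (ho : ∀ j < n, o j ∈ O)
    (hM : ∀ j < n, C (o j) j ≤ M) (hM0 : 0 ≤ M) (hn : 0 < n) (hN : 2 * n ^ 2 < N)
    (hδ : δ = 2 * n * (w 0 * M) / N)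
    (h : IsGrowthSet n N δ (N * δ) (fun i j => hinge n w T 1 (C i j)) a τ S) : S.card ≤ k := by
  have hw0 : 0 ≤ w 0 := hwn ▸ antitone_nat_of_succ_le hw (Nat.zero_le n)
  have hN0 : (0 : ℝ) < N := by exact_mod_cast (by omega : 0 < N)
  have hn0 : (0 : ℝ) < n := by exact_mod_cast hn
  have hH : ∀ j < n, hinge n w T 1 (C (o j) j) ≤ w 0 * M := fun j hj =>
    (hinge_le hw hwn.ge hT zero_le_one (hnn _ _)).trans (by gcongr; exact hM j hj)
  -- If `w 0 * M = 0`, the step width and all prices vanish, so no price can force `S` to be small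
  -- and the zero-cost argument is needed.
  rcases (mul_nonneg hw0 hM0).eq_or_lt with h0 | h0
  · rw [← h0] at hδ
    simp only [mul_zero, zero_div] at hδ
    subst hδ
    rw [mul_zero] at h
    refine (h.card_le_of_zero (fun i _ => by simp [hself, hinge_zero hT])
      (fun i j => by rw [hsymm]) hO ho fun j hj => ?_).trans hk
    rw [h0]
    exact hH j hj
  · have hδ0 : 0 < δ := by rw [hδ]; positivity
    by_contra! hlt
    obtain ⟨σ, hσ⟩ := exists_isNearest n C (card_pos.mp (by omega : 0 < S.card))
    have h1 := h.sum_hinge_le hw hT hsymm htri hself hδ0.le (by positivity) (by linarith) hO hk ho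
      fun j hj => (hσ j hj).2
    have h2 : 0 ≤ ∑ j ∈ range n, hinge n w T 3 (C (σ j) j) :=
      sum_nonneg fun j _ => hinge_nonneg hw _ _
    have h3 : ∑ j ∈ range n, hinge n w T 1 (C (o j) j) ≤ n * (w 0 * M) := by
      refine (sum_le_sum fun j hj => hH j (mem_range.mp hj)).trans ?_
      simp
    -- With `k + 1` facilities the estimate gives `N * δ ≤ n * (w 0 * M) + n ^ 2 * δ`. As `N * δ` is
    -- twice the first summand, this means `N ≤ 2 * n ^ 2`, a contradiction.
    have h4 : (N : ℝ) * δ * (k + 1) ≤ N * δ * S.card := by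
      gcongr
      exact_mod_cast hlt
    have h5 : (k : ℝ) * (n * δ) ≤ n * (n * δ) := by gcongr
    have h6 : (N : ℝ) * δ = 2 * n * (w 0 * M) := by rw [hδ]; field_simp
    have h7 : 2 * (n : ℝ) ^ 2 * δ < N * δ := by
      gcongr
      exact_mod_cast hN
    nlinarith

/-- One of the two rounded solutions is good. -/
theorem PricePair.min_le {F₁ F₂ : Finset ℕ} {ρ₁ ρ₂ σ₁ σ₂ : ℕ → ℕ}
    (hw : ∀ l, w (l + 1) ≤ w l) (hT : ∀ l, 0 ≤ T l)
    (hsymm : ∀ i j, C i j = C j i) (htri : ∀ i j l, C i l ≤ C i j + C j l) (hself : ∀ i, C i i = 0)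
    (hO : ∀ i ∈ O, i < n) (hk : O.card ≤ k) (ho : ∀ j < n, o j ∈ O) (hδ : 0 ≤ δ) (hn : 0 < n)
    (h : PricePair n k N δ (fun i j => hinge n w T 1 (C i j)) m S₁ S₂)
    (hF₁ : S₁ ⊆ F₁) (hρ₁ : IsNearest n C F₁ ρ₁)
    (hm : m ≠ 0 → IsNearest n C S₁ σ₁ ∧ IsNearest n C S₂ σ₂ ∧ IsNearest n C F₂ ρ₂ ∧
      F₂.card = k ∧ S₁.image σ₂ ⊆ F₂ ∧ ∀ x ∈ F₂, x ∉ S₁.image σ₂ → ∀ y < n, y ∉ F₂ →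
        scoreOf n (fun i j => hinge n w T 3 (C i j)) σ₁ σ₂ y ≤
          scoreOf n (fun i j => hinge n w T 3 (C i j)) σ₁ σ₂ x) :
    (∑ j ∈ range n, hinge n w T 9 (C (ρ₁ j) j) ≤
        6 * ∑ j ∈ range n, hinge n w T 1 (C (o j) j) + 6 * (k * (n * δ + δ))) ∨
      m ≠ 0 ∧ (∑ j ∈ range n, hinge n w T 9 (C (ρ₂ j) j) ≤
        6 * ∑ j ∈ range n, hinge n w T 1 (C (o j) j) + 6 * (k * (n * δ + δ))) := by
  obtain ⟨a, τ, hg⟩ := h.first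
  have hmN : (m : ℝ) * δ ≤ δ * N := by
    rw [mul_comm]
    gcongr
    exact h.le
  have hopt : 0 ≤ ∑ j ∈ range n, hinge n w T 1 (C (o j) j) :=
    sum_nonneg fun j _ => hinge_nonneg hw _ _
  have hnear : ∀ σ, IsNearest n C S₁ σ → ∑ j ∈ range n, hinge n w T 9 (C (ρ₁ j) j) ≤
      ∑ j ∈ range n, hinge n w T 3 (C (σ j) j) := fun σ hσ => sum_le_sum fun j hj => by
    have hj := mem_range.mp hj
    exact (hinge_mono hw _ ((hρ₁ j hj).2 _ (hF₁ (hσ j hj).1))).trans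
      (hinge_anti hw hT (by norm_num) _)
  -- At price zero the Lagrangian term disappears and the small set alone is within factor three. No
  -- second set exists in this case.
  by_cases hm0 : m = 0
  · left
    subst hm0
    have hS : S₁.Nonempty := by
      obtain ⟨i, hi, h1, -⟩ := hg.growth.reach 0 hn (by
        have := hg.growth.a_le_of_le hδ hmN (fun i _ => by simp [hself, hinge_zero hT]) hn
        omega)
      have := hg.growth.a_le_of_le hδ hmN (fun i _ => by simp [hself, hinge_zero hT]) hn
      obtain ⟨i', hi', -⟩ := hg.maximal i hi (by omega)
      exact ⟨i', hi'⟩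
    obtain ⟨σ, hσ⟩ := exists_isNearest n C hS
    have h1 := hg.sum_hinge_le hw hT hsymm htri hself hδ (by positivity) hmN hO hk ho
      fun j hj => (hσ j hj).2
    have h2 := hnear σ hσ
    have h3 : (0 : ℝ) ≤ k * (n * δ) := by positivity
    have h4 : (0 : ℝ) ≤ k * δ := by positivity
    simp only [CharP.cast_eq_zero, zero_mul, mul_zero, add_zero, zero_add] at h1
    linarith
  · obtain ⟨⟨a', τ', hg'⟩, hk₂⟩ := h.second hm0
    obtain ⟨hσ₁, hσ₂, hρ₂, hF₂, hP, hbest⟩ := hm hm0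
    have hmN' : ((m - 1 : ℕ) : ℝ) * δ ≤ δ * N := by
      rw [mul_comm]
      gcongr
      have := h.le
      omega
    -- The larger price belongs to the smaller set; the difference of one step `δ` enters the final
    -- error.
    have hcast : (m : ℝ) * δ = ((m - 1 : ℕ) : ℝ) * δ + δ := by
      rw [Nat.cast_sub (by omega)]
      push_cast
      ring
    have h1 := hg.sum_hinge_le hw hT hsymm htri hself hδ (by positivity) hmN hO hk ho
      fun j hj => (hσ₁ j hj).2
    have h2 := hg'.sum_hinge_le hw hT hsymm htri hself hδ (by positivity) hmN' hO hk ho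
      fun j hj => (hσ₂ j hj).2
    have h3 := sum_hinge_le_of_image_subset hw hT hsymm htri (fun i hi => (hg.paid i hi).1)
      hσ₁ hσ₂ hρ₂ hP (by norm_num : (0 : ℝ) ≤ 3)
    norm_num at h3
    have hPS : S₁.image σ₂ ⊆ S₂ := by
      intro x hx
      obtain ⟨i, hi, rfl⟩ := mem_image.mp hx
      exact (hσ₂ i (hg.paid i hi).1).1
    have h4 := sum_sdiff_score_le (f := scoreOf n (fun i j => hinge n w T 3 (C i j)) σ₁ σ₂)
      hP hPS card_image_le (by omega)
      (fun i => sum_nonneg fun j _ => by split_ifs <;> [exact hinge_nonneg hw _ _; exact le_rfl])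
      (fun i hi => scoreOf_eq_zero hσ₂ _ hi)
      (fun x hx y hy => hbest x (mem_sdiff.mp hx).1 (mem_sdiff.mp hx).2 y
        (hg'.paid y (mem_sdiff.mp hy).1).1 (mem_sdiff.mp hy).2)
    rw [sum_scoreOf hσ₂, hF₂] at h4
    have h5 := bipoint_combination (k₁ := S₁.card) (k₂ := S₂.card) (k := k) (E := n * δ)
      (by exact_mod_cast h.card_le) (by exact_mod_cast hk₂) (by positivity) hδ
      (by rw [hcast] at h1; exact h1) h2
      (sum_nonneg fun j _ => hinge_nonneg hw _ _) (sum_nonneg fun j _ => hinge_nonneg hw _ _)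
      (hnear σ₁ hσ₁) h3 h4
    rcases min_le_iff.mp h5 with h6 | h6
    · exact .inl h6
    · exact .inr ⟨hm0, h6⟩

end

/-! ### Memory layout and cost matrices -/

open RealRAM

/-- The part of the memory that stays fixed after the preparations: sizes, numbers of steps, row
offsets, powers of two, accuracy, weights and distances. -/
structure Ctx (n k N L : ℕ) (ε : ℝ) (w : ℕ → ℝ) (C : ℕ → ℕ → ℝ) (s : State) : Prop where
  size : s.nat 0 0 = n
  centers : s.nat 0 1 = k
  rounds : s.nat 20 0 = N
  bits : s.nat 21 0 = L
  off : ∀ i ≤ n, s.nat 3 i = i * n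
  pow : ∀ i ≤ L, s.nat 4 i = 2 ^ i
  eps : s.real 0 0 = ε
  weight : s.real 1 = w
  dist : ∀ i < n, ∀ j < n, s.real 2 (i * n + j) = C i j

theorem Ctx.of_same {n k N L : ℕ} {ε : ℝ} {w : ℕ → ℝ} {C : ℕ → ℕ → ℝ} {s s' : State}
    {U V : List ℕ} (h : Ctx n k N L ε w C s) (hs : Same U V s s')
    (hU : 0 ∉ U ∧ 3 ∉ U ∧ 4 ∉ U ∧ 20 ∉ U ∧ 21 ∉ U) (hV : 0 ∉ V ∧ 1 ∉ V ∧ 2 ∉ V) :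
    Ctx n k N L ε w C s' := by
  obtain ⟨h0, h3, h4, h20, h21⟩ := hU
  obtain ⟨g0, g1, g2⟩ := hV
  constructor
  · rw [hs.nat 0 h0]; exact h.size
  · rw [hs.nat 0 h0]; exact h.centers
  · rw [hs.nat 20 h20]; exact h.rounds
  · rw [hs.nat 21 h21]; exact h.bits
  · rw [hs.nat 3 h3]; exact h.off
  · rw [hs.nat 4 h4]; exact h.pow
  · rw [hs.real 0 g0]; exact h.eps
  · rw [hs.real 1 g1]; exact h.weight
  · rw [hs.real 2 g2]; exact h.dist

/-- The number of points. -/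
@[reducible] def nExp : NatExp := nv 0

/-- Position in a matrix, for a row and a column. -/
@[reducible] def at2 (i j : NatExp) : NatExp := .add (.load 3 i) j

/-- The set with the indicator function `f`. -/
def fset (n : ℕ) (f : ℕ → ℕ) : Finset ℕ := (range n).filter fun i => f i = 1

theorem mem_fset {n : ℕ} {f : ℕ → ℕ} {i : ℕ} : i ∈ fset n f ↔ i < n ∧ f i = 1 := by
  simp [fset]

theorem fset_congr {n : ℕ} {f g : ℕ → ℕ} (h : ∀ i < n, f i = g i) : fset n f = fset n g := by
  ext i
  simp only [mem_fset]
  exact and_congr_right fun hi => by rw [h i hi]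

/-- Computation of the matrix of costs with thresholds multiplied by `b`. -/
def hingeProg (b : ℚ) (out : ℕ) : Program :=
  .forTo 40 (.load 3 nExp) <|
    .seq (.setReal 13 (.const 0) (.const 0)) <|
    .seq (.forTo 41 nExp <|
      .ite (.realLe (.mul (.const b) (ra 3 41)) (ra 2 40))
        (.setReal 13 (.const 0) (.add (rv 13)
          (.mul (.sub (ra 1 41) (.load 1 (.add (nv 41) (.const 1))))
            (.sub (ra 2 40) (.mul (.const b) (ra 3 41))))))
        .skip) <|
    .setReal out (nv 40) (rv 13)

/-- Copy a set. -/
def copyProg (a b : ℕ) : Program :=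
  .forTo 47 nExp (.setNat b (nv 47) (na a 47))

section

variable {B n k N L : ℕ} {ε : ℝ} {w : ℕ → ℝ} {C : ℕ → ℕ → ℝ} {s : State} {T : ℕ → ℝ}

/-- The matrix is treated as one array of length `n * n`, so no row and column indices have to be
recovered. Terms with negative excess are skipped instead of taking a maximum. -/
theorem wp_hingeProg (h : Ctx n k N L ε w C s) (hT : ∀ l < n, s.real 3 l = T l) (b : ℚ) {out : ℕ}
    (hout : out ∉ [0, 1, 2, 3, 13]) (hB : n * n ≤ B) (hB' : n ≤ B) :
    wp B (hingeProg b out)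
      (fun s' => ∀ i < n, ∀ j < n, s'.real out (i * n + j) = hinge n w T b (C i j)) s := by
  simp only [List.mem_cons, List.not_mem_nil, or_false, not_or] at hout
  obtain ⟨o0, o1, o2, o3, o13⟩ := hout
  refine wp_forTo [40, 41] [13, out] (n * n)
    (fun i s' => ∀ x < i, s'.real out x = hinge n w T b (s.real 2 x)) ?_ ?_ hB ?_ ?_ ?_ ?_
  · simp [Program.natWrites, Program.forTo]
  · simp [Program.realWrites, Program.forTo]
  · intro s' hs
    have := h.off n le_rfl
    simp [NatExp.eval, hs.nat, h.size, this]
  · simp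
  · intro x s₁ hx hs₁ hc hI
    refine wp_seq (wp_setReal (wp_seq (wp_forTo [41] [13] n (fun l s' =>
      s'.real 13 0 = ∑ l ∈ range l, (w l - w (l + 1)) * max (s.real 2 x - b * T l) 0)
      ?_ ?_ hB' ?_ ?_ ?_ ?_)))
    · simp [Program.natWrites]
    · simp [Program.realWrites]
    · intro s' hs
      simp [NatExp.eval, hs.nat, hs₁.nat, h.size]
    · simp [NatExp.eval, RealExp.eval]
    · intro l s₂ hl hs₂ hc₂ hI₂
      have e1 : s₂.real 3 l = T l := by
        simp [hs₂.real, hs₁.real, hT l hl, Ne.symm o3]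
      have e2 : s₂.real 2 x = s.real 2 x := by
        simp [hs₂.real, hs₁.real, Ne.symm o2]
      have e3 : s₂.real 1 = w := by
        simp [hs₂.real, hs₁.real, Ne.symm o1, h.weight]
      have e4 : s₂.nat 40 0 = x := by
        simp [hs₂.nat, hc]
      refine wp_ite (fun hb => wp_setReal ?_) (fun hb => wp_skip ?_)
      · simp only [Test.Holds, RealExp.eval, NatExp.eval, hc₂, e4, e1, e2] at hb
        simp [RealExp.eval, NatExp.eval, hc₂, e4, e1, e2, e3, hI₂, sum_range_succ, hb]
      · simp only [Test.Holds, RealExp.eval, NatExp.eval, hc₂, e4, e1, e2] at hb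
        have : max (s.real 2 x - b * T l) 0 = 0 := max_eq_right (by linarith)
        simp [hI₂, sum_range_succ, this]
    · intro s₂ hs₂ hc₂ hI₂
      refine wp_setReal ?_
      have e4 : s₂.nat 40 0 = x := by
        simp [hs₂.nat, hc]
      intro y hy
      simp only [NatExp.eval, RealExp.eval, e4, hI₂, State.writeNat_real,
        State.writeReal_real_self, Function.update_apply]
      split_ifs with hyx
      · rw [hyx, hinge]
      · have : s₂.real out = s₁.real out := by
          simp [hs₂.real, o13]
        rw [this]
        exact hI y (by omega)
  · intro s' hs hc hI i hi j hj
    rw [hI _ (by nlinarith), h.dist i hi j hj]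

theorem wp_copyProg (h : Ctx n k N L ε w C s) {a b : ℕ} (ha : a ∉ [47, b]) (hb : b ∉ [0, 47])
    (hB : n ≤ B) : wp B (copyProg a b) (fun s' => fset n (s'.nat b) = fset n (s.nat a)) s := by
  simp only [List.mem_cons, List.not_mem_nil, or_false, not_or] at ha hb
  refine wp_forTo [47, b] [] n (fun i s' => ∀ x < i, s'.nat b x = s.nat a x) ?_ ?_ hB ?_ ?_ ?_ ?_
  · simp [Program.natWrites, Ne.symm hb.2]
  · simp [Program.realWrites]
  · intro s' hs
    simp [NatExp.eval, hs.nat, h.size, Ne.symm hb.1]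
  · simp
  · intro x s₁ hx hs₁ hc hI
    refine wp_setNat ?_
    intro y hy
    simp only [NatExp.eval, hc, hs₁.nat a (by simp [ha]), State.writeNat_nat_of_ne hb.2,
      State.writeNat_nat_self, Function.update_apply]
    split_ifs with hyx
    · rw [hyx]
    · exact hI y (by omega)
  · intro s' hs hc hI
    exact fset_congr hI

end

/-! ### Programs for dual growth and for the choice of facilities -/

/-- The part of the memory that stays fixed during dual growth: the costs `H`, the step width `δ`,
the facility price `lam`. -/
structure GrowthCtx (n N : ℕ) (δ lam : ℝ) (H : ℕ → ℕ → ℝ) (s : State) : Prop where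
  size : s.nat 0 0 = n
  rounds : s.nat 20 0 = N
  off : ∀ i ≤ n, s.nat 3 i = i * n
  step : s.real 11 0 = δ
  price : s.real 12 0 = lam
  cost : ∀ i < n, ∀ j < n, s.real 4 (i * n + j) = H i j

theorem GrowthCtx.of_same {n N : ℕ} {δ lam : ℝ} {H : ℕ → ℕ → ℝ} {s s' : State}
    {U V : List ℕ} (h : GrowthCtx n N δ lam H s) (hs : Same U V s s')
    (hU : 0 ∉ U ∧ 3 ∉ U ∧ 20 ∉ U) (hV : 4 ∉ V ∧ 11 ∉ V ∧ 12 ∉ V) :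
    GrowthCtx n N δ lam H s' := by
  obtain ⟨h0, h3, h20⟩ := hU
  obtain ⟨g0, g1, g2⟩ := hV
  constructor
  · rw [hs.nat 0 h0]; exact h.size
  · rw [hs.nat 20 h20]; exact h.rounds
  · rw [hs.nat 3 h3]; exact h.off
  · rw [hs.real 11 g1]; exact h.step
  · rw [hs.real 12 g2]; exact h.price
  · rw [hs.real 4 g0]; exact h.cost

/-- Computation of the payment for facility number `nat 42 0`. -/
def payProg : Program :=
  .seq (.setReal 13 (.const 0) (.const 0)) <|
  .forTo 43 nExp <|
    .ite (.realLe (.load 4 (at2 (nv 42) (nv 43))) (.mul (rv 11) (.cast (na 10 43))))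
      (.setReal 13 (.const 0) (.add (rv 13)
        (.sub (.mul (rv 11) (.cast (na 10 43))) (.load 4 (at2 (nv 42) (nv 43))))))
      .skip

/-- Update of the payment times. -/
def tauProg : Program :=
  .forTo 42 nExp <|
    .ite (.natEq (na 11 42) (nv 41))
      (.seq payProg
        (.ite (.realLe (rv 12) (rv 13)) .skip
          (.setNat 11 (nv 42) (.add (nv 41) (.const 1)))))
      .skip

/-- Update of the budgets. -/
def budgetProg : Program :=
  .forTo 44 nExp <|
    .ite (.natEq (na 10 44) (nv 41))
      (.seq (.setNat 26 (.const 0) (.const 0)) <|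
        .seq (.forTo 45 nExp <|
          .ite (.and (.natLe (na 11 45) (nv 41))
              (.realLe (.load 4 (at2 (nv 45) (nv 44))) (.mul (rv 11) (.cast (nv 41)))))
            (.setNat 26 (.const 0) (.const 1)) .skip) <|
        .ite (.natEq (nv 26) (.const 0))
          (.setNat 10 (nv 44) (.add (nv 41) (.const 1))) .skip)
      .skip

/-- Dual growth. -/
def growProg : Program :=
  .seq (.forTo 40 nExp <|
    .seq (.setNat 10 (nv 40) (.const 0)) (.setNat 11 (nv 40) (.const 0))) <|
  .forTo 41 (.add (nv 20) (.const 1)) (.seq tauProg budgetProg)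

/-- Greedy choice of a maximal set of paid facilities without conflicts. -/
def chooseProg : Program :=
  .seq (.setNat 25 (.const 0) (.const 0)) <|
  .seq (.forTo 40 nExp (.setNat 7 (nv 40) (.const 0))) <|
  .forTo 40 nExp <|
    .ite (.natLe (na 11 40) (nv 20))
      (.seq (.setNat 26 (.const 0) (.const 0)) <|
        .seq (.forTo 41 nExp <|
          .ite (.natEq (na 7 41) (.const 1))
            (.forTo 42 nExp <|
              .ite (.and
                  (.and (.natLe (na 10 42) (na 11 40))
                    (.realLe (.load 4 (at2 (nv 40) (nv 42))) (.mul (rv 11) (.cast (na 10 42)))))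
                  (.and (.natLe (na 10 42) (na 11 41))
                    (.realLe (.load 4 (at2 (nv 41) (nv 42))) (.mul (rv 11) (.cast (na 10 42))))))
                (.setNat 26 (.const 0) (.const 1)) .skip)
            .skip) <|
        .ite (.natEq (nv 26) (.const 0))
          (.seq (.setNat 7 (nv 40) (.const 1))
            (.setNat 25 (.const 0) (.add (nv 25) (.const 1))))
          .skip)
      .skip

section

variable {B n N : ℕ} {δ lam : ℝ} {H : ℕ → ℕ → ℝ} {s : State}

theorem wp_payProg (h : GrowthCtx n N δ lam H s) {i : ℕ} (hi : i < n) (hc : s.nat 42 0 = i)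
    (hB : n ≤ B) :
    wp B payProg (fun s' => s'.real 13 0 = excess n δ H i (s.nat 10)) s := by
  refine wp_seq (wp_setReal (wp_forTo [43] [13] n (fun j s' =>
    s'.real 13 0 = ∑ j ∈ range j, max (δ * (s.nat 10 j) - H i j) 0) ?_ ?_ hB ?_ ?_ ?_ ?_))
  · simp [Program.natWrites]
  · simp [Program.realWrites]
  · intro s' hs
    simp [NatExp.eval, hs.nat, h.size]
  · simp [NatExp.eval, RealExp.eval]
  · intro j s₁ hj hs₁ hc₁ hI
    have e0 : s₁.nat 42 0 = i := by simp [hs₁.nat, hc]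
    have e1 : s₁.real 4 (s₁.nat 3 i + j) = H i j := by
      simp [hs₁.nat, hs₁.real, h.off i hi.le, h.cost i hi j hj]
    have e2 : s₁.real 11 0 = δ := by simp [hs₁.real, h.step]
    have e3 : s₁.nat 10 = s.nat 10 := by simp [hs₁.nat]
    refine wp_ite (fun hb => wp_setReal ?_) (fun hb => wp_skip ?_)
    · simp only [Test.Holds, RealExp.eval, NatExp.eval, hc₁, e0, e1, e2, e3] at hb
      simp [RealExp.eval, NatExp.eval, hc₁, e0, e1, e2, e3, hI, sum_range_succ, hb]
    · simp only [Test.Holds, RealExp.eval, NatExp.eval, hc₁, e0, e1, e2, e3] at hb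
      have : max (δ * (s.nat 10 j) - H i j) 0 = 0 := max_eq_right (by linarith)
      simp [hI, sum_range_succ, this]
  · intro s' hs' hc' hI
    exact hI

/-- The specification is the first hypothesis of `DualGrowth.succ`. The array is updated in place,
so the invariant also says that positions not yet visited are untouched. -/
theorem wp_tauProg (h : GrowthCtx n N δ lam H s) {t : ℕ} (ht : s.nat 41 0 = t) (hB : n ≤ B) :
    wp B tauProg (fun s' => ∀ i < n,
      (s.nat 11 i = t → excess n δ H i (s.nat 10) < lam → s'.nat 11 i = t + 1) ∧
      (¬ (s.nat 11 i = t ∧ excess n δ H i (s.nat 10) < lam) → s'.nat 11 i = s.nat 11 i)) s := by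
  refine wp_forTo [11, 42, 43] [13] n (fun i s' => (∀ x < i,
      (s.nat 11 x = t → excess n δ H x (s.nat 10) < lam → s'.nat 11 x = t + 1) ∧
      (¬ (s.nat 11 x = t ∧ excess n δ H x (s.nat 10) < lam) → s'.nat 11 x = s.nat 11 x)) ∧
      ∀ x, i ≤ x → s'.nat 11 x = s.nat 11 x) ?_ ?_ hB ?_ ?_ ?_ ?_
  · simp [Program.natWrites, payProg, Program.forTo]
  · simp [Program.realWrites, payProg, Program.forTo]
  · intro s' hs
    simp [NatExp.eval, hs.nat, h.size]
  · simp
  · intro i s₁ hi hs₁ hc₁ hI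
    have e1 : s₁.nat 11 i = s.nat 11 i := hI.2 i le_rfl
    have e2 : s₁.nat 41 0 = t := by simp [hs₁.nat, ht]
    have e3 : s₁.nat 10 = s.nat 10 := by simp [hs₁.nat]
    have keep : ∀ s₂ : State, s₂.nat 11 = s₁.nat 11 →
        ¬ (s.nat 11 i = t ∧ excess n δ H i (s.nat 10) < lam) →
        (∀ x < i + 1,
        (s.nat 11 x = t → excess n δ H x (s.nat 10) < lam → s₂.nat 11 x = t + 1) ∧
        (¬ (s.nat 11 x = t ∧ excess n δ H x (s.nat 10) < lam) → s₂.nat 11 x = s.nat 11 x)) ∧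
        ∀ x, i + 1 ≤ x → s₂.nat 11 x = s.nat 11 x := by
      intro s₂ hs₂ hno
      rw [hs₂]
      refine ⟨fun x hx => ?_, fun x hx => hI.2 x (by omega)⟩
      rcases Nat.lt_succ_iff_lt_or_eq.mp hx with hx | rfl
      · exact hI.1 x hx
      · exact ⟨fun h1 h2 => absurd ⟨h1, h2⟩ hno, fun _ => e1⟩
    refine wp_ite (fun hb => ?_) (fun hb => wp_skip ?_)
    · simp only [Test.natEq_holds, NatExp.eval, hc₁, e1, e2] at hb
      have hg := h.of_same hs₁ (by simp) (by simp)
      refine wp_seq (wp_call (N := [43]) (R := [13]) (wp_payProg hg hi hc₁ hB)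
        (by simp [Program.natWrites, payProg, Program.forTo])
        (by simp [Program.realWrites, payProg, Program.forTo]) ?_)
      intro s₂ hs₂ hQ
      rw [e3] at hQ
      have e4 : s₂.real 12 0 = lam := by simp [hs₂.real, hg.price]
      refine wp_ite (fun hb' => wp_skip ?_) (fun hb' => wp_setNat ?_)
      · simp only [Test.Holds, RealExp.eval, NatExp.eval, e4, hQ] at hb'
        exact keep _ (by simp [hs₂.nat]) fun hc => absurd hc.2 (not_lt.mpr hb')
      · simp only [Test.Holds, RealExp.eval, NatExp.eval, e4, hQ, not_le] at hb'
        have e5 : s₂.nat 42 0 = i := by simp [hs₂.nat, hc₁]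
        have e6 : s₂.nat 41 0 = t := by simp [hs₂.nat, e2]
        have e7 : s₂.nat 11 = s₁.nat 11 := by simp [hs₂.nat]
        simp only [NatExp.eval, e5, e6, ne_eq, Nat.reduceEqDiff,
          not_false_eq_true, State.writeNat_nat_of_ne, State.writeNat_nat_self, e7,
          Function.update_apply]
        refine ⟨fun x hx => ?_, fun x hx => ?_⟩
        · rcases Nat.lt_succ_iff_lt_or_eq.mp hx with hx | rfl
          · rw [if_neg (by omega)]
            exact hI.1 x hx
          · simp [hb, hb']
        · rw [if_neg (by omega)]
          exact hI.2 x (by omega)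
    · simp only [Test.natEq_holds, NatExp.eval, hc₁, e1, e2] at hb
      exact keep _ (by simp) fun hc => hb hc.1
  · intro s' hs' hc' hI
    exact hI.1

/-- Counterpart for the second hypothesis of `DualGrowth.succ`. The flag `nat 26` stays zero exactly
as long as no paid facility within reach has been seen. -/
theorem wp_budgetProg (h : GrowthCtx n N δ lam H s) {t : ℕ} (ht : s.nat 41 0 = t) (hB : n ≤ B) :
    wp B budgetProg (fun s' => ∀ j < n,
      (s.nat 10 j = t → (∀ i < n, s.nat 11 i ≤ t → δ * t < H i j) → s'.nat 10 j = t + 1) ∧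
      (¬ (s.nat 10 j = t ∧ ∀ i < n, s.nat 11 i ≤ t → δ * t < H i j) →
        s'.nat 10 j = s.nat 10 j)) s := by
  refine wp_forTo [10, 26, 44, 45] [] n (fun j s' => (∀ x < j,
      (s.nat 10 x = t → (∀ i < n, s.nat 11 i ≤ t → δ * t < H i x) → s'.nat 10 x = t + 1) ∧
      (¬ (s.nat 10 x = t ∧ ∀ i < n, s.nat 11 i ≤ t → δ * t < H i x) →
        s'.nat 10 x = s.nat 10 x)) ∧
      ∀ x, j ≤ x → s'.nat 10 x = s.nat 10 x) ?_ ?_ hB ?_ ?_ ?_ ?_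
  · simp [Program.natWrites, Program.forTo]
  · simp [Program.realWrites, Program.forTo]
  · intro s' hs
    simp [NatExp.eval, hs.nat, h.size]
  · simp
  · intro j s₁ hj hs₁ hc₁ hI
    have e1 : s₁.nat 10 j = s.nat 10 j := hI.2 j le_rfl
    have e2 : s₁.nat 41 0 = t := by simp [hs₁.nat, ht]
    have keep : ∀ s₂ : State, s₂.nat 10 = s₁.nat 10 →
        ¬ (s.nat 10 j = t ∧ ∀ i < n, s.nat 11 i ≤ t → δ * t < H i j) →
        (∀ x < j + 1,
        (s.nat 10 x = t → (∀ i < n, s.nat 11 i ≤ t → δ * t < H i x) → s₂.nat 10 x = t + 1) ∧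
        (¬ (s.nat 10 x = t ∧ ∀ i < n, s.nat 11 i ≤ t → δ * t < H i x) →
          s₂.nat 10 x = s.nat 10 x)) ∧
        ∀ x, j + 1 ≤ x → s₂.nat 10 x = s.nat 10 x := by
      intro s₂ hs₂ hno
      rw [hs₂]
      refine ⟨fun x hx => ?_, fun x hx => hI.2 x (by omega)⟩
      rcases Nat.lt_succ_iff_lt_or_eq.mp hx with hx | rfl
      · exact hI.1 x hx
      · exact ⟨fun h1 h2 => absurd ⟨h1, h2⟩ hno, fun _ => e1⟩
    refine wp_ite (fun hb => ?_) (fun hb => wp_skip ?_)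
    · simp only [Test.natEq_holds, NatExp.eval, hc₁, e1, e2] at hb
      have hg := h.of_same hs₁ (by simp) (by simp)
      refine wp_seq (wp_setNat (wp_seq (wp_forTo [26, 45] [] n (fun i s' =>
        s'.nat 26 0 = 0 ↔ ∀ x < i, s.nat 11 x ≤ t → δ * t < H x j) ?_ ?_ hB ?_ ?_ ?_ ?_)))
      · simp [Program.natWrites]
      · simp [Program.realWrites]
      · intro s' hs
        simp [NatExp.eval, hs.nat, hs₁.nat, h.size]
      · simp [NatExp.eval]
      · intro i s₂ hi hs₂ hc₂ hI₂
        have d0 : s₂.nat 44 0 = j := by simp [hs₂.nat, hc₁]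
        have d1 : s₂.real 4 (s₂.nat 3 i + j) = H i j := by
          simp [hs₂.nat, hs₂.real, hg.off i hi.le, hg.cost i hi j hj]
        have d2 : s₂.real 11 0 = δ := by simp [hs₂.real, hg.step]
        have d3 : s₂.nat 11 = s.nat 11 := by simp [hs₂.nat, hs₁.nat]
        have d4 : s₂.nat 41 0 = t := by simp [hs₂.nat, e2]
        refine wp_ite (fun hb' => wp_setNat ?_) (fun hb' => wp_skip ?_)
        · simp only [Test.Holds, RealExp.eval, NatExp.eval, hc₂, d0, d1, d2, d3, d4] at hb'
          simp only [NatExp.eval, ne_eq, Nat.reduceEqDiff,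
            not_false_eq_true, State.writeNat_nat_of_ne, State.writeNat_nat_self,
            Function.update_self, one_ne_zero, false_iff]
          intro hall
          exact absurd (hall i (by omega) hb'.1) (not_lt.mpr hb'.2)
        · simp only [Test.Holds, RealExp.eval, NatExp.eval, hc₂, d0, d1, d2, d3, d4] at hb'
          simp only [ne_eq, Nat.reduceEqDiff,
            not_false_eq_true, State.writeNat_nat_of_ne, hI₂]
          refine ⟨fun hall x hx => ?_, fun hall x hx => hall x (by omega)⟩
          rcases Nat.lt_succ_iff_lt_or_eq.mp hx with hx | rfl
          · exact hall x hx
          · intro h1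
            by_contra h2
            exact hb' ⟨h1, not_lt.mp h2⟩
      · intro s₂ hs₂ hc₂ hI₂
        have d3 : s₂.nat 10 = s₁.nat 10 := by simp [hs₂.nat]
        have d4 : s₂.nat 41 0 = t := by simp [hs₂.nat, e2]
        have d5 : s₂.nat 44 0 = j := by simp [hs₂.nat, hc₁]
        refine wp_ite (fun hb' => wp_setNat ?_) (fun hb' => wp_skip ?_)
        · simp only [Test.natEq_holds, NatExp.eval, hI₂] at hb'
          simp only [NatExp.eval, d3, d4, d5, ne_eq, Nat.reduceEqDiff,
            not_false_eq_true, State.writeNat_nat_of_ne, State.writeNat_nat_self,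
            Function.update_apply]
          refine ⟨fun x hx => ?_, fun x hx => ?_⟩
          · rcases Nat.lt_succ_iff_lt_or_eq.mp hx with hx | rfl
            · rw [if_neg (by omega)]
              exact hI.1 x hx
            · rw [if_pos rfl]
              exact ⟨fun _ _ => rfl, fun hno => absurd ⟨hb, hb'⟩ hno⟩
          · rw [if_neg (by omega)]
            exact hI.2 x (by omega)
        · simp only [Test.natEq_holds, NatExp.eval, hI₂] at hb'
          exact keep _ (by simp [d3]) fun hc => hb' hc.2
    · simp only [Test.natEq_holds, NatExp.eval, hc₁, e1, e2] at hb
      exact keep _ (by simp) fun hc => hb hc.1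
  · intro s' hs' hc' hI
    exact hI.1

theorem wp_growProg (h : GrowthCtx n N δ lam H s) (hB : n ≤ B) (hB' : N + 1 ≤ B) :
    wp B growProg (fun s' => DualGrowth n δ lam H (N + 1) (s'.nat 10) (s'.nat 11)) s := by
  refine wp_seq (wp_forTo [10, 11, 40] [] n (fun i s' => ∀ x < i, s'.nat 10 x = 0 ∧ s'.nat 11 x = 0)
    ?_ ?_ hB ?_ ?_ ?_ ?_)
  · simp [Program.natWrites]
  · simp [Program.realWrites]
  · intro s' hs
    simp [NatExp.eval, hs.nat, h.size]
  · simp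
  · intro i s₁ hi hs₁ hc₁ hI
    refine wp_seq (wp_setNat (wp_setNat ?_))
    intro x hx
    simp only [NatExp.eval, hc₁, ne_eq, Nat.reduceEqDiff,
      not_false_eq_true, State.writeNat_nat_of_ne, State.writeNat_nat_self, Function.update_apply]
    split_ifs with hxi
    · simp
    · exact hI x (by omega)
  · intro s₁ hs₁ hc₁ hI
    have h₁ := h.of_same hs₁ (by simp) (by simp)
    refine wp_forTo [10, 11, 26, 41, 42, 43, 44, 45] [13] (N + 1)
      (fun t s' => DualGrowth n δ lam H t (s'.nat 10) (s'.nat 11)) ?_ ?_ hB' ?_ ?_ ?_ ?_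
    · simp [Program.natWrites, tauProg, budgetProg, payProg, Program.forTo]
    · simp [Program.realWrites, tauProg, budgetProg, payProg, Program.forTo]
    · intro s' hs
      simp [NatExp.eval, hs.nat, h₁.rounds]
    · exact .zero _ _ _ _ (fun j hj => by simp [hI j hj]) (fun j hj => by simp [hI j hj])
    · intro t s₂ ht hs₂ hc₂ hI₂
      have h₂ := h₁.of_same hs₂ (by simp) (by simp)
      refine wp_seq (wp_call (N := [11, 42, 43]) (R := [13]) (wp_tauProg h₂ hc₂ hB)
        (by simp [Program.natWrites, tauProg, payProg, Program.forTo])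
        (by simp [Program.realWrites, tauProg, payProg, Program.forTo]) ?_)
      intro s₃ hs₃ hQ₃
      have h₃ := h₂.of_same hs₃ (by simp) (by simp)
      refine wp_call (N := [10, 26, 44, 45]) (R := []) (wp_budgetProg (t := t) h₃
        (by simp [hs₃.nat, hc₂]) hB)
        (by simp [Program.natWrites, budgetProg, Program.forTo])
        (by simp [Program.realWrites, budgetProg, Program.forTo]) ?_
      intro s₄ hs₄ hQ₄
      have e1 : s₃.nat 10 = s₂.nat 10 := by simp [hs₃.nat]
      have e2 : s₄.nat 11 = s₃.nat 11 := by simp [hs₄.nat]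
      simp only [ne_eq, Nat.reduceEqDiff, not_false_eq_true,
        State.writeNat_nat_of_ne, e2]
      rw [e1] at hQ₄
      exact hI₂.succ hQ₃ hQ₄
    · intro s' hs' hc' hI'
      exact hI'

end

theorem fset_update_one {n i : ℕ} {f : ℕ → ℕ} (hi : i < n) :
    fset n (Function.update f i 1) = insert i (fset n f) := by
  ext x
  simp only [mem_fset, mem_insert, Function.update_apply]
  by_cases hx : x = i
  · simp [hx, hi]
  · simp [hx]

section

variable {B n N : ℕ} {δ lam : ℝ} {H : ℕ → ℕ → ℝ} {s : State}

/-- Paid facilities are scanned by number and taken unless they conflict with an earlier choice. A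
rejected facility has a conflict with a member, which gives maximality. -/
theorem wp_chooseProg (h : GrowthCtx n N δ lam H s)
    (hd : DualGrowth n δ lam H (N + 1) (s.nat 10) (s.nat 11)) (hB : n ≤ B) :
    wp B chooseProg (fun s' =>
      IsGrowthSet n N δ lam H (s.nat 10) (s.nat 11) (fset n (s'.nat 7)) ∧
        s'.nat 25 0 = (fset n (s'.nat 7)).card) s := by
  refine wp_seq (wp_setNat (wp_seq (wp_forTo [7, 40] [] n (fun i s' => ∀ x < i, s'.nat 7 x = 0)
    ?_ ?_ hB ?_ ?_ ?_ ?_)))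
  · simp [Program.natWrites]
  · simp [Program.realWrites]
  · intro s' hs
    simp [NatExp.eval, hs.nat, h.size]
  · simp
  · intro i s₁ hi hs₁ hc₁ hI
    refine wp_setNat ?_
    intro x hx
    simp only [NatExp.eval, hc₁, ne_eq, Nat.reduceEqDiff,
      not_false_eq_true, State.writeNat_nat_of_ne, State.writeNat_nat_self, Function.update_apply]
    split_ifs with hxi
    · rfl
    · exact hI x (by omega)
  intro s₁ hs₁ hc₁ hI
  have hs₁' : Same [7, 25, 40] [] s s₁ :=
    ((Same.refl _ _ s).writeNat (by simp) _ _).trans (hs₁.mono (by simp) (by simp))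
  have h₁ := h.of_same hs₁' (by simp) (by simp)
  have a₁ : s₁.nat 10 = s.nat 10 := by simp [hs₁.nat]
  have τ₁ : s₁.nat 11 = s.nat 11 := by simp [hs₁.nat]
  have f₁ : fset n (s₁.nat 7) = ∅ := by
    ext x
    simp only [mem_fset, notMem_empty, iff_false, not_and]
    intro hx
    simp [hI x hx]
  have c₁ : s₁.nat 25 0 = 0 := by simp [hs₁.nat, NatExp.eval]
  set a := s.nat 10
  set τ := s.nat 11
  refine wp_forTo [7, 25, 26, 40, 41, 42] [] n (fun i s' =>
    (∀ x ∈ fset n (s'.nat 7), x < i ∧ τ x ≤ N) ∧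
    (∀ x ∈ fset n (s'.nat 7), ∀ y ∈ fset n (s'.nat 7), x ≠ y → ¬ Conflict n δ H a τ x y) ∧
    (∀ x < i, τ x ≤ N → ∃ y ∈ fset n (s'.nat 7), y = x ∨ Conflict n δ H a τ x y) ∧
    s'.nat 25 0 = (fset n (s'.nat 7)).card) ?_ ?_ hB ?_ ?_ ?_ ?_
  · simp [Program.natWrites, Program.forTo]
  · simp [Program.realWrites, Program.forTo]
  · intro s' hs
    simp [NatExp.eval, hs.nat, h₁.size]
  · simp [f₁, c₁]
  · rintro i s₂ hi hs₂ hc₂ ⟨hI1, hI2, hI3, hI4⟩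
    have a₂ : s₂.nat 10 = a := by simp [hs₂.nat, a₁]
    have τ₂ : s₂.nat 11 = τ := by simp [hs₂.nat, τ₁]
    have N₂ : s₂.nat 20 0 = N := by simp [hs₂.nat, h₁.rounds]
    have hg := h₁.of_same hs₂ (by simp) (by simp)
    refine wp_ite (fun hb => ?_) (fun hb => wp_skip ?_)
    · simp only [Test.Holds, NatExp.eval, hc₂, τ₂, N₂] at hb
      refine wp_seq (wp_setNat (wp_seq (wp_forTo [26, 41, 42] [] n (fun x s' =>
        s'.nat 26 0 = 0 ↔ ∀ y < x, s₂.nat 7 y = 1 → ¬ Conflict n δ H a τ i y)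
        ?_ ?_ hB ?_ ?_ ?_ ?_)))
      · simp [Program.natWrites, Program.forTo]
      · simp [Program.realWrites, Program.forTo]
      · intro s' hs
        simp [NatExp.eval, hs.nat, hg.size]
      · simp [NatExp.eval]
      · intro x s₃ hx hs₃ hc₃ hI₃
        have e7 : s₃.nat 7 = s₂.nat 7 := by simp [hs₃.nat]
        refine wp_ite (fun hb' => ?_) (fun hb' => wp_skip ?_)
        · simp only [Test.natEq_holds, NatExp.eval, hc₃, e7] at hb'
          refine wp_forTo [26, 42] [] n (fun l s' =>
            s'.nat 26 0 = 0 ↔ ((∀ y < x, s₂.nat 7 y = 1 → ¬ Conflict n δ H a τ i y) ∧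
              ∀ m < l, ¬ ((a m ≤ τ i ∧ H i m ≤ δ * a m) ∧ (a m ≤ τ x ∧ H x m ≤ δ * a m))))
            ?_ ?_ hB ?_ ?_ ?_ ?_
          · simp [Program.natWrites]
          · simp [Program.realWrites]
          · intro s' hs
            simp [NatExp.eval, hs.nat, hs₃.nat, hg.size]
          · simpa using hI₃
          · intro l s₄ hl hs₄ hc₄ hI₄
            have d0 : s₄.nat 40 0 = i := by simp [hs₄.nat, hs₃.nat, hc₂]
            have d1 : s₄.nat 41 0 = x := by simp [hs₄.nat, hc₃]
            have d2 : s₄.real 4 (s₄.nat 3 i + l) = H i l := by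
              simp [hs₄.nat, hs₃.nat, hs₄.real, hs₃.real, hg.off i hi.le, hg.cost i hi l hl]
            have d3 : s₄.real 4 (s₄.nat 3 x + l) = H x l := by
              simp [hs₄.nat, hs₃.nat, hs₄.real, hs₃.real, hg.off x hx.le, hg.cost x hx l hl]
            have d4 : s₄.nat 10 = a := by simp [hs₄.nat, hs₃.nat, a₂]
            have d5 : s₄.nat 11 = τ := by simp [hs₄.nat, hs₃.nat, τ₂]
            have d6 : s₄.real 11 0 = δ := by simp [hs₄.real, hs₃.real, hg.step]
            refine wp_ite (fun hb'' => wp_setNat ?_) (fun hb'' => wp_skip ?_)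
            · simp only [Test.Holds, RealExp.eval, NatExp.eval, hc₄, d0, d1, d2, d3, d4, d5, d6]
                at hb''
              simp only [NatExp.eval, ne_eq, Nat.reduceEqDiff, not_false_eq_true,
                State.writeNat_nat_of_ne, State.writeNat_nat_self, Function.update_self,
                one_ne_zero, false_iff]
              exact fun hall => hall.2 l (by omega) hb''
            · simp only [Test.Holds, RealExp.eval, NatExp.eval, hc₄, d0, d1, d2, d3, d4, d5, d6]
                at hb''
              simp only [ne_eq, Nat.reduceEqDiff, not_false_eq_true,
                State.writeNat_nat_of_ne, hI₄]
              refine and_congr_right fun _ => ⟨fun hall m hm => ?_, fun hall m hm =>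
                hall m (by omega)⟩
              rcases Nat.lt_succ_iff_lt_or_eq.mp hm with hm | rfl
              · exact hall m hm
              · exact hb''
          · intro s₄ hs₄ hc₄ hI₄
            simp only [ne_eq, Nat.reduceEqDiff, not_false_eq_true,
              State.writeNat_nat_of_ne, hI₄]
            refine ⟨fun hall y hy hy1 => ?_, fun hall => ⟨fun y hy => hall y (by omega), ?_⟩⟩
            · rcases Nat.lt_succ_iff_lt_or_eq.mp hy with hy | rfl
              · exact hall.1 y hy hy1
              · rintro ⟨l, hl, hl'⟩
                exact hall.2 l hl hl'
            · intro l hl hl'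
              exact hall x (by omega) hb' ⟨l, hl, hl'⟩
        · simp only [Test.natEq_holds, NatExp.eval, hc₃, e7] at hb'
          simp only [ne_eq, Nat.reduceEqDiff, not_false_eq_true,
            State.writeNat_nat_of_ne, hI₃]
          refine ⟨fun hall y hy hy1 => ?_, fun hall y hy => hall y (by omega)⟩
          rcases Nat.lt_succ_iff_lt_or_eq.mp hy with hy | rfl
          · exact hall y hy hy1
          · exact absurd hy1 hb'
      · intro s₃ hs₃ hc₃ hI₃
        have e7 : s₃.nat 7 = s₂.nat 7 := by simp [hs₃.nat]
        have e25 : s₃.nat 25 = s₂.nat 25 := by simp [hs₃.nat]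
        have e40 : s₃.nat 40 0 = i := by simp [hs₃.nat, hc₂]
        have hnot : i ∉ fset n (s₂.nat 7) := fun hmem => absurd (hI1 i hmem).1 (lt_irrefl i)
        refine wp_ite (fun hb' => wp_seq (wp_setNat (wp_setNat ?_))) (fun hb' => wp_skip ?_)
        · simp only [Test.natEq_holds, NatExp.eval, hI₃] at hb'
          have hno : ∀ y ∈ fset n (s₂.nat 7), ¬ Conflict n δ H a τ i y := fun y hy =>
            hb' y (mem_fset.mp hy).1 (mem_fset.mp hy).2
          -- The test covers only one order of the two facilities; the conflict relation is
          -- symmetric.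
          have hno' : ∀ y ∈ fset n (s₂.nat 7), ¬ Conflict n δ H a τ y i := fun y hy => by
            rintro ⟨l, hl, h1, h2⟩
            exact hno y hy ⟨l, hl, h2, h1⟩
          simp only [NatExp.eval, e40, ne_eq, Nat.reduceEqDiff, not_false_eq_true,
            State.writeNat_nat_of_ne, State.writeNat_nat_self, Function.update_self, e7, e25,
            fset_update_one hi, card_insert_of_notMem hnot, hI4, and_true]
          refine ⟨?_, ?_, ?_⟩
          · intro x hx
            rcases mem_insert.mp hx with rfl | hx
            · exact ⟨by omega, hb⟩
            · exact ⟨(hI1 x hx).1.trans (by omega), (hI1 x hx).2⟩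
          · intro x hx y hy hxy
            rcases mem_insert.mp hx with rfl | hx' <;>
              rcases mem_insert.mp hy with rfl | hy'
            · exact absurd rfl hxy
            · exact hno y hy'
            · exact hno' x hx'
            · exact hI2 x hx' y hy' hxy
          · intro x hx hxN
            rcases Nat.lt_succ_iff_lt_or_eq.mp hx with hx | rfl
            · obtain ⟨y, hy, h'⟩ := hI3 x hx hxN
              exact ⟨y, mem_insert_of_mem hy, h'⟩
            · exact ⟨x, mem_insert_self _ _, .inl rfl⟩
        · simp only [Test.natEq_holds, NatExp.eval, hI₃] at hb'
          push Not at hb'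
          obtain ⟨y, hy, hy1, hy2⟩ := hb'
          simp only [ne_eq, Nat.reduceEqDiff, not_false_eq_true,
            State.writeNat_nat_of_ne, e7, e25]
          refine ⟨fun x hx => ⟨(hI1 x hx).1.trans (by omega), (hI1 x hx).2⟩, hI2, ?_, hI4⟩
          intro x hx hxN
          rcases Nat.lt_succ_iff_lt_or_eq.mp hx with hx | rfl
          · exact hI3 x hx hxN
          · exact ⟨y, mem_fset.mpr ⟨hy, hy1⟩, .inr hy2⟩
    · simp only [Test.Holds, NatExp.eval, hc₂, τ₂, N₂] at hb
      simp only [ne_eq, Nat.reduceEqDiff, not_false_eq_true,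
        State.writeNat_nat_of_ne]
      refine ⟨fun x hx => ⟨(hI1 x hx).1.trans (by omega), (hI1 x hx).2⟩, hI2, ?_, hI4⟩
      intro x hx hxN
      rcases Nat.lt_succ_iff_lt_or_eq.mp hx with hx | rfl
      · exact hI3 x hx hxN
      · exact absurd hxN hb
  · rintro s' hs' hc' ⟨hI1, hI2, hI3, hI4⟩
    exact ⟨⟨hd, hI1, hI2, hI3⟩, hI4⟩

end

/-! ### Linear search for the price -/

/-- Search for a facility price at which at most `k` facilities are opened. -/
def searchProg : Program :=
  .seq (.setNat 23 (.const 0) (.const 0)) <|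
  .seq (.setNat 24 (.const 0) (.const 0)) <|
  .forTo 46 (.add (nv 20) (.const 1)) <|
    .ite (.natEq (nv 23) (.const 0))
      (.seq (.setReal 12 (.const 0) (.mul (.cast (nv 46)) (rv 11))) <|
        .seq growProg <| .seq chooseProg <|
        .ite (.natLe (nv 25) (.load 0 (.const 1)))
          (.seq (.setNat 23 (.const 0) (.const 1)) (copyProg 7 8))
          (.seq (.setNat 24 (.const 0) (.const 1)) (copyProg 7 9)))
      .skip

theorem searchProg_natWrites : searchProg.natWrites ⊆
    [7, 8, 9, 10, 11, 23, 24, 25, 26, 40, 41, 42, 43, 44, 45, 46, 47] := by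
  decide

theorem searchProg_realWrites : searchProg.realWrites ⊆ [12, 13] := by
  decide

/-- Result of the search. -/
def SearchResult (n k N : ℕ) (δ : ℝ) (H : ℕ → ℕ → ℝ) (s : State) : Prop :=
  (s.nat 23 0 = 1 ∧ ∃ m, PricePair n k N δ H m (fset n (s.nat 8)) (fset n (s.nat 9)) ∧
    (s.nat 24 0 = 1 ↔ m ≠ 0)) ∨
  (s.nat 23 0 = 0 ∧ ∃ a τ S, IsGrowthSet n N δ (N * δ) H a τ S ∧ k < S.card)

/-- Before success the invariant remembers only that the previous price opened more than `k`
facilities. The first success thus comes with its predecessor, and the number of facilities need not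
be monotone in the price. -/
theorem wp_searchProg {B n k N L : ℕ} {ε δ : ℝ} {w : ℕ → ℝ} {C H : ℕ → ℕ → ℝ} {s : State}
    (h : Ctx n k N L ε w C s) (hδ : s.real 11 0 = δ)
    (hH : ∀ i < n, ∀ j < n, s.real 4 (i * n + j) = H i j) (hB : n ≤ B) (hB' : N + 1 ≤ B) :
    wp B searchProg (SearchResult n k N δ H) s := by
  refine wp_seq (wp_setNat (wp_seq (wp_setNat (wp_forTo
    [7, 8, 9, 10, 11, 23, 24, 25, 26, 40, 41, 42, 43, 44, 45, 46, 47] [12, 13] (N + 1)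
    (fun m s' =>
      (s'.nat 23 0 = 1 ∧ ∃ m, PricePair n k N δ H m (fset n (s'.nat 8)) (fset n (s'.nat 9)) ∧
        (s'.nat 24 0 = 1 ↔ m ≠ 0)) ∨
      (s'.nat 23 0 = 0 ∧ ((m = 0 ∧ s'.nat 24 0 = 0) ∨ (m ≠ 0 ∧ s'.nat 24 0 = 1 ∧
        (∃ a τ, IsGrowthSet n N δ ((m - 1 : ℕ) * δ) H a τ (fset n (s'.nat 9))) ∧
          k < (fset n (s'.nat 9)).card))))
    ?_ ?_ hB' ?_ ?_ ?_ ?_))))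
  · decide
  · decide
  · intro s' hs
    simp [NatExp.eval, hs.nat, h.rounds]
  · simp [NatExp.eval]
  · intro m s₁ hm hs₁ hc₁ hI
    have hs₁' : Same [7, 8, 9, 10, 11, 23, 24, 25, 26, 40, 41, 42, 43, 44, 45, 46, 47] [12, 13]
        s s₁ :=
      (((Same.refl _ _ s).writeNat (by simp) _ _).writeNat (by simp) _ _).trans hs₁
    have h₁ := h.of_same hs₁' (by simp) (by simp)
    have δ₁ : s₁.real 11 0 = δ := by simp [hs₁'.real, hδ]
    refine wp_ite (fun hb => ?_) (fun hb => wp_skip ?_)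
    · simp only [Test.natEq_holds, NatExp.eval] at hb
      have hI' : (m = 0 ∧ s₁.nat 24 0 = 0) ∨ (m ≠ 0 ∧ s₁.nat 24 0 = 1 ∧
        (∃ a τ, IsGrowthSet n N δ ((m - 1 : ℕ) * δ) H a τ (fset n (s₁.nat 9))) ∧
          k < (fset n (s₁.nat 9)).card) := by
        rcases hI with ⟨h1, -⟩ | ⟨-, h1⟩
        · omega
        · exact h1
      refine wp_seq (wp_setReal ?_)
      have hg : GrowthCtx n N δ (m * δ) H (s₁.writeReal 12 0 (m * δ)) := by
        constructor
        · exact h₁.size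
        · exact h₁.rounds
        · exact h₁.off
        · simp [δ₁]
        · simp
        · simpa [hs₁'.real] using hH
      simp only [NatExp.eval, RealExp.eval, hc₁, δ₁]
      refine wp_seq (wp_call (N := [10, 11, 26, 40, 41, 42, 43, 44, 45]) (R := [13])
        (wp_growProg hg hB hB')
        (by decide) (by decide) ?_)
      intro s₂ hs₂ hQ₂
      have hg₂ := hg.of_same hs₂ (by simp) (by simp)
      refine wp_seq (wp_call (N := [7, 25, 26, 40, 41, 42]) (R := [])
        (wp_chooseProg hg₂ hQ₂ hB)
        (by decide) (by decide) ?_)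
      rintro s₃ hs₃ ⟨hS, hcard⟩
      have k₃ : s₃.nat 0 1 = k := by simp [hs₃.nat, hs₂.nat, h₁.centers]
      have e9 : s₃.nat 9 = s₁.nat 9 := by simp [hs₃.nat, hs₂.nat]
      have e24 : s₃.nat 24 = s₁.nat 24 := by simp [hs₃.nat, hs₂.nat]
      have e23 : s₃.nat 23 0 = 0 := by simp [hs₃.nat, hs₂.nat, hb]
      have h₃ : Ctx n k N L ε w C s₃ :=
        ((h₁.of_same (s' := s₁.writeReal 12 0 (m * δ)) (U := []) (V := [12])
          ⟨fun _ _ => rfl, fun b hb => by simp at hb; simp [hb]⟩ (by simp) (by simp)).of_same hs₂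
            (by simp) (by simp)).of_same hs₃ (by simp) (by simp)
      refine wp_ite (fun hb' => wp_seq (wp_setNat ?_)) (fun hb' => wp_seq (wp_setNat ?_))
      · simp only [Test.Holds, NatExp.eval, k₃, hcard] at hb'
        refine wp_call (N := [8, 47]) (R := []) (wp_copyProg (a := 7) (b := 8) (h₃.of_same
          ((Same.refl [23] [] s₃).writeNat (by simp) _ _) (by simp) (by simp))
          (by simp) (by simp) hB) (by decide) (by decide) ?_
        intro s₄ hs₄ hQ₄
        left
        simp only [ne_eq, Nat.reduceEqDiff, not_false_eq_true,
          State.writeNat_nat_of_ne, hQ₄, hs₄.nat 23 (by simp), hs₄.nat 24 (by simp),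
          hs₄.nat 9 (by simp), NatExp.eval, State.writeNat_nat_self, Function.update_self,
          true_and, e9, e24]
        refine ⟨m, ⟨by omega, ⟨_, _, hS⟩, hb', fun hm0 => ?_⟩, ?_⟩
        · rcases hI' with hI' | hI'
          · exact absurd hI'.1 hm0
          · exact hI'.2.2
        · rcases hI' with hI' | hI' <;> simp [hI'.1, hI'.2]
      · simp only [Test.Holds, NatExp.eval, k₃, hcard, not_le] at hb'
        refine wp_call (N := [9, 47]) (R := []) (wp_copyProg (a := 7) (b := 9) (h₃.of_same
          ((Same.refl [24] [] s₃).writeNat (by simp) _ _) (by simp) (by simp))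
          (by simp) (by simp) hB) (by decide) (by decide) ?_
        intro s₄ hs₄ hQ₄
        right
        simp only [ne_eq, Nat.reduceEqDiff, not_false_eq_true,
          State.writeNat_nat_of_ne, hQ₄, hs₄.nat 23 (by simp), hs₄.nat 24 (by simp),
          NatExp.eval, State.writeNat_nat_self, Function.update_self,
          true_and, e23]
        exact .inr ⟨⟨_, _, hS⟩, hb'⟩
    · simp only [Test.natEq_holds, NatExp.eval] at hb
      left
      rcases hI with hI | hI
      · simpa using hI
      · exact absurd hI.1 hb
  · intro s' hs' hc' hI
    rcases hI with hI | ⟨hI, hI' | hI'⟩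
    · exact .inl hI
    · omega
    · right
      obtain ⟨-, -, ⟨a, τ, hS⟩, hk⟩ := hI'
      exact ⟨hI, a, τ, _, hS, hk⟩

/-! ### Programs for nearest centers, scores and completion to `k` points -/

/-- Assignment of every point to a nearest point of the set `a`. -/
def nearProg (a out : ℕ) : Program :=
  .forTo 40 nExp <|
    .seq (.setNat 26 (.const 0) (.const 0)) <|
    .forTo 41 nExp <|
      .ite (.natEq (na a 41) (.const 1))
        (.ite (.natEq (nv 26) (.const 0))
          (.seq (.setNat 26 (.const 0) (.const 1)) (.setNat out (nv 40) (nv 41)))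
          (.ite (.realLe (.load 2 (at2 (na out 40) (nv 40))) (.load 2 (at2 (nv 41) (nv 40))))
            .skip (.setNat out (nv 40) (nv 41))))
        .skip

/-- Computation of the scores of all points. -/
def scoreProg : Program :=
  .seq (.forTo 40 nExp (.setReal 7 (nv 40) (.const 0))) <|
  .forTo 40 nExp <|
    .setReal 7 (na 13 40) (.add (.load 7 (na 13 40)) (.load 5 (at2 (na 12 40) (nv 40))))

/-- The image of a set under the assignment `nat 13`. -/
def pairProg : Program :=
  .seq (.forTo 40 nExp (.setNat 5 (nv 40) (.const 0))) <|
  .forTo 40 nExp <|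
    .ite (.natEq (na 8 40) (.const 1)) (.setNat 5 (na 13 40) (.const 1)) .skip

/-- Extension of a set by points of largest score. -/
def fillProg : Program :=
  .seq (.setNat 30 (.const 0) (.const 0)) <|
  .seq (.forTo 40 nExp <|
    .ite (.natEq (na 5 40) (.const 1))
      (.setNat 30 (.const 0) (.add (nv 30) (.const 1))) .skip) <|
  .forTo 40 (.load 0 (.const 1)) <|
    .ite (.natLe (.load 0 (.const 1)) (nv 30)) .skip <|
      .seq (.setNat 26 (.const 0) (.const 0)) <|
      .seq (.forTo 41 nExp <|
        .ite (.natEq (na 5 41) (.const 1)) .skip <|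
          .ite (.natEq (nv 26) (.const 0))
            (.seq (.setNat 26 (.const 0) (.const 1)) (.setNat 29 (.const 0) (nv 41)))
            (.ite (.realLe (ra 7 41) (ra 7 29)) .skip (.setNat 29 (.const 0) (nv 41)))) <|
      .seq (.setNat 5 (nv 29) (.const 1)) <|
      .setNat 30 (.const 0) (.add (nv 30) (.const 1))

/-- Copy the candidate solution to the output. -/
def recordProg : Program :=
  .seq (.setNat 27 (.const 0) (.const 1)) <|
  .seq (.setReal 15 (.const 0) (rv 16)) <|
  .forTo 47 nExp <|
    .seq (.ite (.natEq (na 5 47) (.const 1))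
      (.setNat 1 (nv 47) (.const 1)) (.setNat 1 (nv 47) (.const 0))) <|
    .setNat 2 (nv 47) (na 6 47)

/-- Computation of the upper bound for the cost of the candidate solution. -/
def proxyProg : Program :=
  .seq (.setReal 16 (.const 0) (.const 0)) <|
  .seq (.forTo 40 nExp <|
    .setReal 16 (.const 0) (.add (rv 16)
      (.mul (.sub (ra 1 40) (.load 1 (.add (nv 40) (.const 1))))
        (.mul (.cast (.add (nv 40) (.const 1))) (.mul (.const 9) (ra 3 40)))))) <|
  .forTo 40 nExp <|
    .setReal 16 (.const 0) (.add (rv 16) (.load 6 (at2 (na 6 40) (nv 40))))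

/-- Evaluation of a candidate set, which is recorded if it is the best so far. -/
def considerProg : Program :=
  .seq (nearProg 5 6) <|
  .seq proxyProg <|
  .ite (.and (.natEq (nv 27) (.const 1)) (.realLe (rv 15) (rv 16))) .skip recordProg

section

variable {B n k N L : ℕ} {ε : ℝ} {w : ℕ → ℝ} {C : ℕ → ℕ → ℝ} {s : State} {T : ℕ → ℝ}

/-- The flag `nat 26` tells whether a member of the set has been met, so no starting value is
needed. For an empty set nothing is written, hence the premise of nonemptiness. -/
theorem wp_nearProg (h : Ctx n k N L ε w C s) {a out : ℕ} (ha : a ∉ [26, 40, 41, out])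
    (hout : out ∉ [0, 3, 4, 20, 21, 26, 40, 41]) (hB : n ≤ B) :
    wp B (nearProg a out) (fun s' => (fset n (s.nat a)).Nonempty →
      IsNearest n C (fset n (s.nat a)) (s'.nat out)) s := by
  simp only [List.mem_cons, List.not_mem_nil, or_false, not_or] at ha hout
  obtain ⟨a26, a40, a41, aout⟩ := ha
  obtain ⟨o0, o3, o4, o20, o21, o26, o40, o41⟩ := hout
  refine wp_forTo [26, 40, 41, out] [] n (fun j s' => (fset n (s.nat a)).Nonempty → ∀ x < j,
    s'.nat out x ∈ fset n (s.nat a) ∧ ∀ i ∈ fset n (s.nat a), C (s'.nat out x) x ≤ C i x)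
    ?_ ?_ hB ?_ ?_ ?_ ?_
  · simp [Program.natWrites, Program.forTo, Ne.symm o40]
  · simp [Program.realWrites, Program.forTo]
  · intro s' hs
    simp [NatExp.eval, hs.nat, h.size, Ne.symm o0]
  · simp
  · intro j s₁ hj hs₁ hc₁ hI
    have sa₁ : s₁.nat a = s.nat a := hs₁.nat a (by simp [a26, a40, a41, aout])
    have h₁ := h.of_same hs₁ (by simp [Ne.symm o0, Ne.symm o3, Ne.symm o4, Ne.symm o20, Ne.symm o21])
      (by simp)
    refine wp_seq (wp_setNat (wp_forTo [26, 41, out] [] n (fun i s' =>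
      (∀ x < j, s'.nat out x = s₁.nat out x) ∧
      ((s'.nat 26 0 = 0 ∧ ∀ y < i, y ∉ fset n (s.nat a)) ∨
        (s'.nat 26 0 = 1 ∧ s'.nat out j ∈ fset n (s.nat a) ∧
          ∀ y < i, y ∈ fset n (s.nat a) → C (s'.nat out j) j ≤ C y j))) ?_ ?_ hB ?_ ?_ ?_ ?_))
    · simp [Program.natWrites, Ne.symm o41]
    · simp [Program.realWrites]
    · intro s' hs
      simp [NatExp.eval, hs.nat, h₁.size, Ne.symm o0]
    · simp [NatExp.eval, o26, o41]
    · rintro i s₂ hi hs₂ hc₂ ⟨hI₂, hI₃⟩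
      have sa₂ : s₂.nat a = s.nat a := by
        rw [hs₂.nat a (by simp [a26, a41, aout]), State.writeNat_nat_of_ne a26, sa₁]
      have d0 : s₂.nat 40 0 = j := by simp [hs₂.nat, Ne.symm o40, hc₁]
      have keep : ∀ s₃ : State, s₃.nat out = s₂.nat out → s₃.nat 26 = s₂.nat 26 →
          (i ∈ fset n (s.nat a) → s₂.nat 26 0 ≠ 0 ∧ C (s₂.nat out j) j ≤ C i j) →
          (∀ x < j, s₃.nat out x = s₁.nat out x) ∧
          ((s₃.nat 26 0 = 0 ∧ ∀ y < i + 1, y ∉ fset n (s.nat a)) ∨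
            (s₃.nat 26 0 = 1 ∧ s₃.nat out j ∈ fset n (s.nat a) ∧
              ∀ y < i + 1, y ∈ fset n (s.nat a) → C (s₃.nat out j) j ≤ C y j)) := by
        intro s₃ g1 g2 g3
        rw [g1, g2]
        refine ⟨hI₂, hI₃.imp (fun hl => ⟨hl.1, fun y hy hyS => ?_⟩)
          (fun hr => ⟨hr.1, hr.2.1, fun y hy hyS => ?_⟩)⟩
        · rcases Nat.lt_succ_iff_lt_or_eq.mp hy with hy | rfl
          · exact hl.2 y hy hyS
          · exact (g3 hyS).1 hl.1
        · rcases Nat.lt_succ_iff_lt_or_eq.mp hy with hy | rfl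
          · exact hr.2.2 y hy hyS
          · exact (g3 hyS).2
      refine wp_ite (fun hb => wp_ite (fun hb' => wp_seq (wp_setNat (wp_setNat ?_)))
        (fun hb' => wp_ite (fun hb'' => wp_skip ?_) (fun hb'' => wp_setNat ?_)))
        (fun hb => wp_skip ?_)
      · simp only [Test.natEq_holds, NatExp.eval, hc₂, sa₂] at hb hb'
        have hiS : i ∈ fset n (s.nat a) := mem_fset.mpr ⟨hi, hb⟩
        have hl : ∀ y < i, y ∉ fset n (s.nat a) := by
          rcases hI₃ with hl | hr
          · exact hl.2
          · omega
        simp only [NatExp.eval, ne_eq, Nat.reduceEqDiff, not_false_eq_true, hc₂, d0, o26, o41,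
          State.writeNat_nat_of_ne, State.writeNat_nat_self, Ne.symm o26]
        simp only [Function.update_apply, if_true, hiS, true_and]
        refine ⟨fun x hx => by rw [if_neg (by omega)]; exact hI₂ x hx, .inr fun y hy hyS => ?_⟩
        rcases Nat.lt_succ_iff_lt_or_eq.mp hy with hy | rfl
        · exact absurd hyS (hl y hy)
        · exact le_rfl
      · simp only [Test.natEq_holds, NatExp.eval] at hb'
        obtain ⟨-, hr, -⟩ := hI₃.resolve_left fun hl => hb' hl.1
        have hr' := (mem_fset.mp hr).1
        have e1 : s₂.real 2 (s₂.nat 3 (s₂.nat out j) + j) = C (s₂.nat out j) j := by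
          simp [hs₂.nat 3, hs₂.real, Ne.symm o3, h₁.off _ hr'.le, h₁.dist _ hr' j hj]
        have e2 : s₂.real 2 (s₂.nat 3 i + j) = C i j := by
          simp [hs₂.nat 3, hs₂.real, Ne.symm o3, h₁.off _ hi.le, h₁.dist _ hi j hj]
        simp only [Test.Holds, RealExp.eval, NatExp.eval, d0, hc₂, e1, e2] at hb''
        exact keep _ (State.writeNat_nat_of_ne o41) (by simp) fun _ => ⟨hb', hb''⟩
      · simp only [Test.natEq_holds, NatExp.eval, hc₂, sa₂] at hb hb'
        obtain ⟨hf, hr, hr2⟩ := hI₃.resolve_left fun hl => hb' hl.1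
        have hr' := (mem_fset.mp hr).1
        have e1 : s₂.real 2 (s₂.nat 3 (s₂.nat out j) + j) = C (s₂.nat out j) j := by
          simp [hs₂.nat 3, hs₂.real, Ne.symm o3, h₁.off _ hr'.le, h₁.dist _ hr' j hj]
        have e2 : s₂.real 2 (s₂.nat 3 i + j) = C i j := by
          simp [hs₂.nat 3, hs₂.real, Ne.symm o3, h₁.off _ hi.le, h₁.dist _ hi j hj]
        simp only [Test.Holds, RealExp.eval, NatExp.eval, d0, hc₂, e1, e2, not_le] at hb''
        have hiS : i ∈ fset n (s.nat a) := mem_fset.mpr ⟨hi, hb⟩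
        simp only [NatExp.eval, ne_eq, Nat.reduceEqDiff, not_false_eq_true, hc₂, d0, o41,
          State.writeNat_nat_of_ne, State.writeNat_nat_self, Ne.symm o26]
        simp only [Function.update_apply, if_true, hiS, true_and]
        refine ⟨fun x hx => by rw [if_neg (by omega)]; exact hI₂ x hx,
          .inr ⟨hf, fun y hy hyS => ?_⟩⟩
        rcases Nat.lt_succ_iff_lt_or_eq.mp hy with hy | rfl
        · exact hb''.le.trans (hr2 y hy hyS)
        · exact le_rfl
      · simp only [Test.natEq_holds, NatExp.eval, hc₂, sa₂] at hb
        exact keep _ (State.writeNat_nat_of_ne o41) (by simp) fun hiS =>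
          absurd (mem_fset.mp hiS).2 hb
    · rintro s₂ hs₂ hc₂ ⟨hI₂, hI₃⟩ hne x hx
      rw [State.writeNat_nat_of_ne o40]
      rcases Nat.lt_succ_iff_lt_or_eq.mp hx with hx | rfl
      · rw [hI₂ x hx]
        exact hI hne x hx
      · obtain ⟨y, hy⟩ := hne
        obtain ⟨-, h1, h2⟩ := hI₃.resolve_left fun hl => hl.2 y (mem_fset.mp hy).1 hy
        exact ⟨h1, fun i hi => h2 i (mem_fset.mp hi).1 hi⟩
  · intro s' hs' hc' hI hne
    exact fun x hx => hI hne x hx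

theorem wp_scoreProg (h : Ctx n k N L ε w C s) {H : ℕ → ℕ → ℝ}
    (hH : ∀ i < n, ∀ j < n, s.real 5 (i * n + j) = H i j) (hσ : ∀ j < n, s.nat 12 j < n)
    (hB : n ≤ B) :
    wp B scoreProg (fun s' => ∀ i < n, s'.real 7 i = scoreOf n H (s.nat 12) (s.nat 13) i) s := by
  refine wp_seq (wp_forTo [40] [7] n (fun i s' => ∀ x < i, s'.real 7 x = 0) (by decide) (by decide)
    hB ?_ (by simp) ?_ ?_)
  · intro s' hs
    simp [NatExp.eval, hs.nat, h.size]
  · intro i s₁ hi hs₁ hc₁ hI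
    refine wp_setReal fun x hx => ?_
    simp only [NatExp.eval, RealExp.eval, hc₁, State.writeNat_real, State.writeReal_real_self,
      Function.update_apply]
    split_ifs with hxi
    · simp
    · exact hI x (by omega)
  · intro s₁ hs₁ hc₁ hI
    refine wp_forTo [40] [7] n (fun j s' => ∀ i < n, s'.real 7 i =
      ∑ x ∈ range j, if s.nat 13 x = i then H (s.nat 12 x) x else 0) (by decide) (by decide)
      hB ?_ (by simpa using hI) ?_ ?_
    · intro s' hs
      simp [NatExp.eval, hs.nat, hs₁.nat, h.size]
    · intro j s₂ hj hs₂ hc₂ hI₂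
      refine wp_setReal fun i hi => ?_
      have e1 : s₂.nat 12 = s.nat 12 := by simp [hs₂.nat, hs₁.nat]
      have e2 : s₂.nat 13 = s.nat 13 := by simp [hs₂.nat, hs₁.nat]
      have e3 : s₂.real 5 (s₂.nat 3 (s.nat 12 j) + j) = H (s.nat 12 j) j := by
        simp [hs₂.nat, hs₁.nat, hs₂.real, hs₁.real, h.off _ (hσ j hj).le, hH _ (hσ j hj) j hj]
      simp only [NatExp.eval, RealExp.eval, hc₂, e1, e2, e3, State.writeNat_real,
        State.writeReal_real_self, Function.update_apply, sum_range_succ]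
      by_cases hij : i = s.nat 13 j
      · subst hij
        simp [hI₂ _ hi]
      · rw [if_neg hij, if_neg (Ne.symm hij), add_zero]
        exact hI₂ i hi
    · intro s' hs' hc' hI' i hi
      exact hI' i hi

theorem wp_pairProg (h : Ctx n k N L ε w C s) (hσ : ∀ j < n, s.nat 13 j < n) (hB : n ≤ B) :
    wp B pairProg (fun s' => fset n (s'.nat 5) = (fset n (s.nat 8)).image (s.nat 13)) s := by
  refine wp_seq (wp_forTo [5, 40] [] n (fun i s' => ∀ x < i, s'.nat 5 x = 0) (by decide)
    (by decide) hB ?_ (by simp) ?_ ?_)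
  · intro s' hs
    simp [NatExp.eval, hs.nat, h.size]
  · intro i s₁ hi hs₁ hc₁ hI
    refine wp_setNat fun x hx => ?_
    simp only [NatExp.eval, hc₁, ne_eq, Nat.reduceEqDiff,
      not_false_eq_true, State.writeNat_nat_of_ne, State.writeNat_nat_self, Function.update_apply]
    split_ifs with hxi
    · rfl
    · exact hI x (by omega)
  · intro s₁ hs₁ hc₁ hI
    refine wp_forTo [5, 40] [] n (fun j s' => ∀ x, x ∈ fset n (s'.nat 5) ↔
      ∃ i < j, i ∈ fset n (s.nat 8) ∧ s.nat 13 i = x) (by decide) (by decide) hB ?_ ?_ ?_ ?_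
    · intro s' hs
      simp [NatExp.eval, hs.nat, hs₁.nat, h.size]
    · intro x
      simp only [ne_eq, Nat.reduceEqDiff, not_false_eq_true, State.writeNat_nat_of_ne, mem_fset,
        not_lt_zero, false_and, exists_false, iff_false, not_and]
      intro hx
      simp [hI x hx]
    · intro j s₂ hj hs₂ hc₂ hI₂
      have e1 : s₂.nat 8 = s.nat 8 := by simp [hs₂.nat, hs₁.nat]
      have e2 : s₂.nat 13 = s.nat 13 := by simp [hs₂.nat, hs₁.nat]
      have split : ∀ x, (∃ i < j + 1, i ∈ fset n (s.nat 8) ∧ s.nat 13 i = x) ↔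
          (∃ i < j, i ∈ fset n (s.nat 8) ∧ s.nat 13 i = x) ∨
            (j ∈ fset n (s.nat 8) ∧ s.nat 13 j = x) := by
        intro x
        constructor
        · rintro ⟨i, hi, hi'⟩
          rcases Nat.lt_succ_iff_lt_or_eq.mp hi with hi | rfl
          · exact .inl ⟨i, hi, hi'⟩
          · exact .inr hi'
        · rintro (⟨i, hi, hi'⟩ | hi')
          · exact ⟨i, by omega, hi'⟩
          · exact ⟨j, by omega, hi'⟩
      refine wp_ite (fun hb => wp_setNat fun x => ?_) (fun hb => wp_skip fun x => ?_)
      · simp only [Test.natEq_holds, NatExp.eval, hc₂, e1] at hb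
        have hjS : j ∈ fset n (s.nat 8) := mem_fset.mpr ⟨hj, hb⟩
        simp only [NatExp.eval, hc₂, e2, ne_eq, Nat.reduceEqDiff, not_false_eq_true,
          State.writeNat_nat_of_ne, State.writeNat_nat_self, fset_update_one (hσ j hj), mem_insert,
          hI₂, split, hjS, true_and]
        rw [or_comm, eq_comm]
      · simp only [Test.natEq_holds, NatExp.eval, hc₂, e1] at hb
        have hjS : j ∉ fset n (s.nat 8) := fun hjS => hb (mem_fset.mp hjS).2
        simp only [ne_eq, Nat.reduceEqDiff, not_false_eq_true,
          State.writeNat_nat_of_ne, hI₂, split, hjS, false_and, or_false]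
    · intro s' hs' hc' hI'
      ext x
      rw [hI', mem_image]
      exact ⟨fun ⟨i, _, hi⟩ => ⟨i, hi⟩, fun ⟨i, hi⟩ => ⟨i, (mem_fset.mp hi.1).1, hi⟩⟩

/-- Each of the `k` passes adds a point unless there are already `k`, so the passes suffice for any
initial size. An added point had the largest score outside the set, and it keeps this rank because
the outside only shrinks. -/
theorem wp_fillProg (h : Ctx n k N L ε w C s) (hk : (fset n (s.nat 5)).card ≤ k) (hkn : k ≤ n)
    (hB : n ≤ B) :
    wp B fillProg (fun s' => fset n (s.nat 5) ⊆ fset n (s'.nat 5) ∧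
      (fset n (s'.nat 5)).card = k ∧
      ∀ x ∈ fset n (s'.nat 5), x ∉ fset n (s.nat 5) → ∀ y < n, y ∉ fset n (s'.nat 5) →
        s.real 7 y ≤ s.real 7 x) s := by
  refine wp_seq (wp_setNat (wp_seq (wp_forTo [30, 40] [] n (fun i s' => s'.nat 30 0 =
    ((range i).filter fun x => s.nat 5 x = 1).card) (by decide) (by decide) hB ?_
    (by simp [NatExp.eval])
      ?_ ?_)))
  · intro s' hs
    simp [NatExp.eval, hs.nat, h.size]
  · intro i s₁ hi hs₁ hc₁ hI
    have e5 : s₁.nat 5 = s.nat 5 := by simp [hs₁.nat]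
    refine wp_ite (fun hb => wp_setNat ?_) (fun hb => wp_skip ?_)
    · simp only [Test.natEq_holds, NatExp.eval, hc₁, e5] at hb
      rw [range_add_one, filter_insert, if_pos hb, card_insert_of_notMem (by simp)]
      simp [NatExp.eval, hI]
    · simp only [Test.natEq_holds, NatExp.eval, hc₁, e5] at hb
      rw [range_add_one, filter_insert, if_neg hb]
      simp [hI]
  · intro s₁ hs₁ hc₁ hI
    have e5 : s₁.nat 5 = s.nat 5 := by simp [hs₁.nat]
    have hs₁' : Same [30, 40] [] s s₁ := ((Same.refl _ _ s).writeNat (by simp) _ _).trans hs₁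
    have h₁ := h.of_same hs₁' (by simp) (by simp)
    refine wp_forTo [5, 26, 29, 30, 40, 41] [] k (fun r s' =>
      s'.nat 30 0 = (fset n (s'.nat 5)).card ∧ r ≤ (fset n (s'.nat 5)).card ∧
      (fset n (s'.nat 5)).card ≤ k ∧ fset n (s.nat 5) ⊆ fset n (s'.nat 5) ∧
      ∀ x ∈ fset n (s'.nat 5), x ∉ fset n (s.nat 5) → ∀ y < n, y ∉ fset n (s'.nat 5) →
        s.real 7 y ≤ s.real 7 x) (by decide) (by decide) (hkn.trans hB) ?_ ?_ ?_ ?_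
    · intro s' hs
      simp [NatExp.eval, hs.nat, h₁.centers]
    · simp only [ne_eq, Nat.reduceEqDiff, not_false_eq_true, State.writeNat_nat_of_ne, e5, hI]
      exact ⟨rfl, Nat.zero_le _, hk, Subset.refl _, fun x hx hx' => absurd hx hx'⟩
    · rintro r s₂ hr hs₂ hc₂ ⟨hI1, hI2, hI3, hI4, hI5⟩
      have h₂ := h₁.of_same hs₂ (by simp) (by simp)
      have e7 : s₂.real 7 = s.real 7 := by simp [hs₂.real, hs₁.real]
      refine wp_ite (fun hb => wp_skip ?_) (fun hb => wp_seq (wp_setNat (wp_seq ?_)))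
      · simp only [Test.Holds, NatExp.eval, h₂.centers, hI1] at hb
        simp only [ne_eq, Nat.reduceEqDiff, not_false_eq_true, State.writeNat_nat_of_ne]
        exact ⟨hI1, by omega, hI3, hI4, hI5⟩
      · simp only [Test.Holds, NatExp.eval, h₂.centers, hI1, not_le] at hb
        refine wp_forTo [26, 29, 41] [] n (fun i s' =>
          (s'.nat 26 0 = 0 ∧ ∀ y < i, y ∈ fset n (s₂.nat 5)) ∨
          (s'.nat 26 0 = 1 ∧ s'.nat 29 0 < n ∧ s'.nat 29 0 ∉ fset n (s₂.nat 5) ∧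
            ∀ y < i, y ∉ fset n (s₂.nat 5) → s.real 7 y ≤ s.real 7 (s'.nat 29 0)))
          (by decide) (by decide) hB ?_ (by simp [NatExp.eval]) ?_ ?_
        · intro s' hs
          simp [NatExp.eval, hs.nat, h₂.size]
        · intro i s₃ hi hs₃ hc₃ hI₃
          have d5 : s₃.nat 5 = s₂.nat 5 := by simp [hs₃.nat]
          have d7 : s₃.real 7 = s.real 7 := by simp [hs₃.real, e7]
          have keep : ∀ s₄ : State, s₄.nat 26 = s₃.nat 26 → s₄.nat 29 = s₃.nat 29 →
              (i ∉ fset n (s₂.nat 5) → s₃.nat 26 0 ≠ 0 ∧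
                s.real 7 i ≤ s.real 7 (s₃.nat 29 0)) →
              (s₄.nat 26 0 = 0 ∧ ∀ y < i + 1, y ∈ fset n (s₂.nat 5)) ∨
              (s₄.nat 26 0 = 1 ∧ s₄.nat 29 0 < n ∧ s₄.nat 29 0 ∉ fset n (s₂.nat 5) ∧
                ∀ y < i + 1, y ∉ fset n (s₂.nat 5) → s.real 7 y ≤ s.real 7 (s₄.nat 29 0)) := by
            intro s₄ g1 g2 g3
            rw [g1, g2]
            refine hI₃.imp (fun hl => ⟨hl.1, fun y hy => ?_⟩)
              (fun hr => ⟨hr.1, hr.2.1, hr.2.2.1, fun y hy hyS => ?_⟩)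
            · rcases Nat.lt_succ_iff_lt_or_eq.mp hy with hy | rfl
              · exact hl.2 y hy
              · by_contra hyS
                exact (g3 hyS).1 hl.1
            · rcases Nat.lt_succ_iff_lt_or_eq.mp hy with hy | rfl
              · exact hr.2.2.2 y hy hyS
              · exact (g3 hyS).2
          refine wp_ite (fun hb => wp_skip ?_) (fun hb => wp_ite
            (fun hb' => wp_seq (wp_setNat (wp_setNat ?_)))
            (fun hb' => wp_ite (fun hb'' => wp_skip ?_) (fun hb'' => wp_setNat ?_)))
          · simp only [Test.natEq_holds, NatExp.eval, hc₃, d5] at hb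
            exact keep _ (by simp) (by simp) fun hno => absurd (mem_fset.mpr ⟨hi, hb⟩) hno
          · simp only [Test.natEq_holds, NatExp.eval, hc₃, d5] at hb hb'
            have hiS : i ∉ fset n (s₂.nat 5) := fun hiS => hb (mem_fset.mp hiS).2
            have hl : ∀ y < i, y ∈ fset n (s₂.nat 5) := by
              rcases hI₃ with hl | hr
              · exact hl.2
              · omega
            right
            simp only [NatExp.eval, ne_eq, Nat.reduceEqDiff, not_false_eq_true, hc₃,
              State.writeNat_nat_of_ne, State.writeNat_nat_self, Function.update_self, true_and]
            refine ⟨hi, hiS, fun y hy hyS => ?_⟩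
            rcases Nat.lt_succ_iff_lt_or_eq.mp hy with hy | rfl
            · exact absurd (hl y hy) hyS
            · exact le_rfl
          · simp only [Test.natEq_holds, NatExp.eval] at hb'
            simp only [Test.Holds, RealExp.eval, NatExp.eval, hc₃, d7] at hb''
            exact keep _ (by simp) (by simp) fun _ => ⟨hb', hb''⟩
          · simp only [Test.natEq_holds, NatExp.eval, hc₃, d5] at hb hb'
            simp only [Test.Holds, RealExp.eval, NatExp.eval, hc₃, d7, not_le] at hb''
            have hiS : i ∉ fset n (s₂.nat 5) := fun hiS => hb (mem_fset.mp hiS).2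
            obtain ⟨hf, -, -, hr⟩ := hI₃.resolve_left fun hl => hb' hl.1
            right
            simp only [NatExp.eval, ne_eq, Nat.reduceEqDiff, not_false_eq_true, hc₃,
              State.writeNat_nat_of_ne, State.writeNat_nat_self, Function.update_self]
            refine ⟨hf, hi, hiS, fun y hy hyS => ?_⟩
            rcases Nat.lt_succ_iff_lt_or_eq.mp hy with hy | rfl
            · exact (hr y hy hyS).trans hb''.le
            · exact le_rfl
        · intro s₃ hs₃ hc₃ hI₃
          have d5 : s₃.nat 5 = s₂.nat 5 := by simp [hs₃.nat]
          have d30 : s₃.nat 30 0 = (fset n (s₂.nat 5)).card := by simp [hs₃.nat, hI1]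
          -- Fewer than `k ≤ n` points are present, so the scan has met a point outside.
          obtain ⟨-, hx, hxS, hbest⟩ := hI₃.resolve_left fun hl => by
            have hsub : range n ⊆ fset n (s₂.nat 5) := fun y hy => hl.2 y (mem_range.mp hy)
            have := card_le_card hsub
            rw [card_range] at this
            omega
          refine wp_seq (wp_setNat (wp_setNat ?_))
          simp only [NatExp.eval, ne_eq, Nat.reduceEqDiff, not_false_eq_true,
            State.writeNat_nat_of_ne, State.writeNat_nat_self, Function.update_self, d5, d30,
            fset_update_one hx, card_insert_of_notMem hxS, true_and]
          refine ⟨by omega, by omega, hI4.trans (subset_insert _ _), ?_⟩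
          intro y hy hyS z hz hzS
          have hzS' : z ∉ fset n (s₂.nat 5) := fun hz' => hzS (mem_insert_of_mem hz')
          rcases mem_insert.mp hy with rfl | hy
          · exact hbest z hz hzS'
          · exact hI5 y hy hyS z hz hzS'
    · rintro s' hs' hc' ⟨hI1, hI2, hI3, hI4, hI5⟩
      exact ⟨hI4, le_antisymm hI3 hI2, hI5⟩

end

/-! ### Recording the best candidate -/

/-- The output arrays hold a solution whose cost is at most the recorded value. -/
def HoldsSolution (n k : ℕ) (w : ℕ → ℝ) (C : ℕ → ℕ → ℝ) (s : State) : Prop :=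
  ∃ F : Finset ℕ, (∀ i ∈ F, i < n) ∧ F.card = k ∧ (∀ i < n, s.nat 1 i = if i ∈ F then 1 else 0) ∧
    (∀ j < n, s.nat 2 j ∈ F) ∧
    ∀ u, IsSorting n (fun j => C (s.nat 2 j) j) u → ∑ i ∈ range n, w i * u i ≤ s.real 15 0

/-- If a solution has been recorded, then it is in the output arrays. -/
def ValidRecord (n k : ℕ) (w : ℕ → ℝ) (C : ℕ → ℕ → ℝ) (s : State) : Prop :=
  s.nat 27 0 = 1 → HoldsSolution n k w C s

/-- A solution of value at most `v` has been recorded. -/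
def Recorded (v : ℝ) (s : State) : Prop := s.nat 27 0 = 1 ∧ s.real 15 0 ≤ v

theorem ValidRecord.of_same {n k : ℕ} {w : ℕ → ℝ} {C : ℕ → ℕ → ℝ} {s s' : State} {U V : List ℕ}
    (h : ValidRecord n k w C s) (hs : Same U V s s') (hU : 1 ∉ U ∧ 2 ∉ U ∧ 27 ∉ U) (hV : 15 ∉ V) :
    ValidRecord n k w C s' := by
  unfold ValidRecord HoldsSolution at *
  rwa [hs.nat 1 hU.1, hs.nat 2 hU.2.1, hs.nat 27 hU.2.2, hs.real 15 hV]

theorem Recorded.of_same {v : ℝ} {s s' : State} {U V : List ℕ}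
    (h : Recorded v s) (hs : Same U V s s') (hU : 27 ∉ U) (hV : 15 ∉ V) : Recorded v s' := by
  unfold Recorded at *
  rwa [hs.nat 27 hU, hs.real 15 hV]

section

variable {B n k N L : ℕ} {ε : ℝ} {w : ℕ → ℝ} {C : ℕ → ℕ → ℝ} {s : State} {T : ℕ → ℝ}

theorem wp_proxyProg (h : Ctx n k N L ε w C s) (hT : ∀ l < n, s.real 3 l = T l)
    (hH : ∀ i < n, ∀ j < n, s.real 6 (i * n + j) = hinge n w T 9 (C i j))
    (hσ : ∀ j < n, s.nat 6 j < n) (hB : n ≤ B) :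
    wp B proxyProg (fun s' => s'.real 16 0 = proxy n w T 9 (fun j => C (s.nat 6 j) j)) s := by
  refine wp_seq (wp_setReal (wp_seq (wp_forTo [40] [16] n (fun l s' => s'.real 16 0 =
    ∑ l ∈ range l, (w l - w (l + 1)) * ((l + 1) * (9 * T l))) (by decide) (by decide)
    hB ?_ (by simp [RealExp.eval, NatExp.eval]) ?_ ?_)))
  · intro s' hs
    simp [NatExp.eval, hs.nat, h.size]
  · intro l s₁ hl hs₁ hc₁ hI
    refine wp_setReal ?_
    have e1 : s₁.real 3 l = T l := by simp [hs₁.real, hT l hl]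
    have e2 : s₁.real 1 = w := by simp [hs₁.real, h.weight]
    simp [NatExp.eval, RealExp.eval, hc₁, hI, e1, e2, sum_range_succ]
  · intro s₁ hs₁ hc₁ hI
    refine wp_forTo [40] [16] n (fun j s' => s'.real 16 0 =
      ∑ l ∈ range n, (w l - w (l + 1)) * ((l + 1) * (9 * T l)) +
      ∑ j ∈ range j, hinge n w T 9 (C (s.nat 6 j) j)) (by decide) (by decide)
      hB ?_ (by simp [hI]) ?_ ?_
    · intro s' hs
      simp [NatExp.eval, hs.nat, hs₁.nat, h.size]
    · intro j s₂ hj hs₂ hc₂ hI₂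
      refine wp_setReal ?_
      have e1 : s₂.real 6 (s₂.nat 3 (s₂.nat 6 j) + j) = hinge n w T 9 (C (s.nat 6 j) j) := by
        simp [hs₂.real, hs₁.real, hs₂.nat, hs₁.nat, h.off _ (hσ j hj).le, hH _ (hσ j hj) j hj]
      simp [NatExp.eval, RealExp.eval, hc₂, hI₂, e1, sum_range_succ, add_assoc]
    · intro s' hs' hc' hI'
      exact hI'

theorem wp_recordProg (h : Ctx n k N L ε w C s) (hB : n ≤ B) :
    wp B recordProg (fun s' => s'.nat 27 0 = 1 ∧ s'.real 15 0 = s.real 16 0 ∧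
      (∀ i < n, s'.nat 1 i = if i ∈ fset n (s.nat 5) then 1 else 0) ∧
      ∀ j < n, s'.nat 2 j = s.nat 6 j) s := by
  refine wp_seq (wp_setNat (wp_seq (wp_setReal (wp_forTo [1, 2, 47] [] n (fun i s' =>
    ∀ x < i, (s'.nat 1 x = if s.nat 5 x = 1 then 1 else 0) ∧ s'.nat 2 x = s.nat 6 x)
    (by decide) (by decide) hB ?_ (by simp) ?_ ?_))))
  · intro s' hs
    simp [NatExp.eval, hs.nat, h.size]
  · intro i s₁ hi hs₁ hc₁ hI
    have e5 : s₁.nat 5 = s.nat 5 := by simp [hs₁.nat]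
    have e6 : s₁.nat 6 = s.nat 6 := by simp [hs₁.nat]
    refine wp_seq (wp_ite (fun hb => wp_setNat (wp_setNat ?_)) (fun hb => wp_setNat (wp_setNat ?_)))
    all_goals
      simp only [Test.natEq_holds, NatExp.eval, hc₁, e5] at hb
      intro x hx
      simp only [NatExp.eval, ne_eq, Nat.reduceEqDiff, not_false_eq_true, hc₁, e6,
        State.writeNat_nat_of_ne, State.writeNat_nat_self, Function.update_apply,
        OfNat.ofNat_ne_one, OfNat.one_ne_ofNat]
      by_cases hxi : x = i
      · simp [hxi, hb]
      · simpa [hxi] using hI x (by omega)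
  · intro s₁ hs₁ hc₁ hI
    refine ⟨by simp [hs₁.nat, NatExp.eval], by simp [hs₁.real, RealExp.eval, NatExp.eval],
      fun i hi => ?_, fun j hj => (hI j hj).2⟩
    rw [(hI i hi).1]
    simp [mem_fset, hi]

theorem considerProg_natWrites : considerProg.natWrites ⊆ [1, 2, 6, 26, 27, 40, 41, 47] := by
  decide

theorem considerProg_realWrites : considerProg.realWrites ⊆ [15, 16] := by
  decide

/-- The recorded value only decreases and ends at or below the proxy of the candidate. It remains a
bound for the cost of the stored solution, even though different guesses use different thresholds.
-/
theorem wp_considerProg (h : Ctx n k N L ε w C s) (hT : ∀ l < n, s.real 3 l = T l)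
    (hH : ∀ i < n, ∀ j < n, s.real 6 (i * n + j) = hinge n w T 9 (C i j))
    (hw : ∀ l, w (l + 1) ≤ w l) (hwn : w n = 0)
    (hF : (fset n (s.nat 5)).card = k) (hk : 1 ≤ k) (hV : ValidRecord n k w C s) (hB : n ≤ B) :
    wp B considerProg (fun s' => ValidRecord n k w C s' ∧ (∀ v, Recorded v s → Recorded v s') ∧
      ∃ σ, IsNearest n C (fset n (s.nat 5)) σ ∧
        Recorded (proxy n w T 9 (fun j => C (σ j) j)) s') s := by
  refine wp_seq (wp_call (N := [6, 26, 40, 41]) (R := []) (wp_nearProg h (a := 5) (out := 6)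
    (by simp) (by simp) hB) (by decide) (by decide) ?_)
  intro s₁ hs₁ hnear
  have hnear := hnear (card_pos.mp (by omega))
  have h₁ := h.of_same hs₁ (by simp) (by simp)
  have hV₁ := hV.of_same hs₁ (by simp) (by simp)
  have hσ : ∀ j < n, s₁.nat 6 j < n := fun j hj => (mem_fset.mp (hnear j hj).1).1
  refine wp_seq (wp_call (N := [40]) (R := [16]) (wp_proxyProg h₁ (T := T)
    (by simpa [hs₁.real] using hT) (by simpa [hs₁.real] using hH) hσ hB)
    (by decide) (by decide) ?_)
  intro s₂ hs₂ hU
  have h₂ := h₁.of_same hs₂ (by simp) (by simp)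
  have hV₂ := hV₁.of_same hs₂ (by simp) (by simp)
  have hR₂ : ∀ v, Recorded v s → Recorded v s₂ := fun v hv =>
    (hv.of_same hs₁ (by simp) (by simp)).of_same hs₂ (by simp) (by simp)
  refine wp_ite (fun hb => wp_skip ?_) (fun hb => wp_mono (wp_recordProg h₂ hB) ?_)
  · simp only [Test.Holds, Test.natEq_holds, NatExp.eval, RealExp.eval, hU] at hb
    exact ⟨hV₂, hR₂, _, hnear, hb⟩
  · simp only [Test.Holds, Test.natEq_holds, NatExp.eval, RealExp.eval, hU] at hb
    rintro s₃ ⟨h27, h15, hc, ha⟩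
    rw [hU] at h15
    have e6 : s₂.nat 6 = s₁.nat 6 := by simp [hs₂.nat]
    have e5 : s₂.nat 5 = s.nat 5 := by simp [hs₂.nat, hs₁.nat]
    rw [e6] at ha
    rw [e5] at hc
    refine ⟨fun _ => ⟨_, fun i hi => (mem_fset.mp hi).1, hF, hc, fun j hj => ?_, fun u hu => ?_⟩,
      fun v hv => ⟨h27, ?_⟩, _, hnear, h27, h15.le⟩
    · rw [ha j hj]
      exact (hnear j hj).1
    · rw [h15]
      refine sum_mul_le_proxy hw hwn ⟨fun φ => ?_, hu.anti, hu.nonneg⟩ 9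
      rw [← hu.sum_eq φ]
      exact sum_congr rfl fun j hj => by rw [ha j (mem_range.mp hj)]
    · have := hR₂ v hv
      rw [h15]
      by_contra! hlt
      exact hb ⟨this.1, by linarith [this.2]⟩

end

/-! ### Binary codes of thresholds -/

/-- Value at position `l` of the thresholds described by the binary digits of `c`: a digit `0`
divides the current value `x` by `1 + ε`, a digit `1` assigns `x` to all positions from `p` on. -/
noncomputable def decodeAt (ε : ℝ) (l : ℕ) : ℕ → ℕ → ℝ → ℕ → ℝ → ℝ
  | 0, _, _, _, y => y
  | L + 1, c, x, p, y =>
    if 2 ^ L ≤ c then decodeAt ε l L (c - 2 ^ L) x (2 * p + 1) (if p ≤ l then x else y)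
    else decodeAt ε l L c (x / (1 + ε)) p y

theorem decodeAt_nonneg {ε : ℝ} (hε : 0 < ε) (l : ℕ) (L c : ℕ) {x y : ℝ} (p : ℕ) (hx : 0 ≤ x)
    (hy : 0 ≤ y) : 0 ≤ decodeAt ε l L c x p y := by
  induction L generalizing c x p y with
  | zero => exact hy
  | succ L ih =>
    unfold decodeAt
    split_ifs
    · exact ih _ _ hx hx
    · exact ih _ _ hx hy
    · exact ih _ _ (by positivity) hy

theorem decodeAt_of_lt {ε : ℝ} (l : ℕ) (L c : ℕ) (x y : ℝ) {p : ℕ} (hp : l < p) :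
    decodeAt ε l L c x p y = y := by
  induction L generalizing c x p with
  | zero => rfl
  | succ L ih =>
    unfold decodeAt
    split_ifs
    · omega
    · exact ih _ _ (by omega)
    · exact ih _ _ hp

/-- Greedy staircase: at position `p` the value `x` is lowered until it is close to `u p`, then used
for the positions from `p` to `2 * p`. Here `a` counts the position steps still available and `q`
the divisions; after `q` divisions `x` would fall to `θ`, where every position accepts it. -/
theorem exists_code {n : ℕ} {ε θ : ℝ} {u : ℕ → ℝ} (hε : 0 < ε) (hθ : 0 ≤ θ)
    (hu : ∀ i j, i ≤ j → j < n → u j ≤ u i) (hu0 : ∀ i < n, 0 ≤ u i) (L a q p : ℕ) (x : ℝ)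
    (hL : a + q ≤ L) (ha : n + 1 ≤ (p + 1) * 2 ^ a) (hx : x ≤ θ * (1 + ε) ^ q)
    (hup : p < n → u p ≤ x) :
    ∃ c < 2 ^ L, ∀ y, ∀ l < n, p ≤ l → ∃ r ≤ l, l ≤ 2 * r ∧ u r ≤ decodeAt ε l L c x p y ∧
      decodeAt ε l L c x p y ≤ (1 + ε) * u r + θ := by
  induction L generalizing a q p x with
  | zero =>
    refine ⟨0, by simp, fun y l hl hpl => ?_⟩
    have : a = 0 := by omega
    subst this
    omega
  | succ L ih =>
    by_cases hp : p < n
    swap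
    · exact ⟨0, by positivity, fun y l hl hpl => by omega⟩
    have hup := hup hp
    by_cases hx' : x ≤ (1 + ε) * u p + θ
    · obtain ⟨a, rfl⟩ : ∃ b, a = b + 1 := Nat.exists_eq_succ_of_ne_zero (by
        rintro rfl
        omega)
      obtain ⟨c, hc, h⟩ := ih a q (2 * p + 1) x (by omega) (by rw [pow_succ] at ha; linarith) hx
        (fun hp' => (hu p _ (by omega) hp').trans hup)
      refine ⟨2 ^ L + c, by rw [pow_succ]; omega, fun y l hl hpl => ?_⟩
      rw [decodeAt, if_pos (by omega), Nat.add_sub_cancel_left, if_pos hpl]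
      rcases lt_or_ge l (2 * p + 1) with hlp | hlp
      · rw [decodeAt_of_lt l L c x x hlp]
        exact ⟨p, hpl, by omega, hup, hx'⟩
      · exact h x l hl hlp
    · push Not at hx'
      have hup0 := hu0 p hp
      -- A division is available, since `q = 0` would mean `x ≤ θ`, and such an `x` would have been
      -- accepted.
      obtain ⟨q, rfl⟩ : ∃ b, q = b + 1 := Nat.exists_eq_succ_of_ne_zero (by
        rintro rfl
        rw [pow_zero, mul_one] at hx
        nlinarith)
      obtain ⟨c, hc, h⟩ := ih a q p (x / (1 + ε)) (by omega) ha
        (by rw [div_le_iff₀ (by linarith)]; rw [pow_succ] at hx; linarith)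
        (fun _ => by rw [le_div_iff₀ (by linarith)]; linarith)
      refine ⟨c, by rw [pow_succ]; omega, fun y l hl hpl => ?_⟩
      rw [decodeAt, if_neg (by omega)]
      exact h y l hl hpl

/-- Computation of the thresholds described by `nat 28 0`, starting with the value `real 10 0`. -/
def decodeProg : Program :=
  .seq (.setReal 14 (.const 0) (rv 10)) <|
  .seq (.setNat 22 (.const 0) (.const 0)) <|
  .seq (.forTo 40 nExp (.setReal 3 (nv 40) (rv 10))) <|
  .forTo 40 (nv 21) <|
    .ite (.natLe (.load 4 (.sub (nv 21) (.add (nv 40) (.const 1)))) (nv 28))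
      (.seq (.setNat 28 (.const 0)
          (.sub (nv 28) (.load 4 (.sub (nv 21) (.add (nv 40) (.const 1)))))) <|
        .seq (.forTo 41 nExp <|
          .ite (.natLe (nv 22) (nv 41)) (.setReal 3 (nv 41) (rv 14)) .skip) <|
        .setNat 22 (.const 0) (.add (.add (nv 22) (nv 22)) (.const 1)))
      (.setReal 14 (.const 0) (.div (rv 14) (.add (.const 1) (rv 0))))

/-- The invariant says that decoding the remaining digits from the current memory still gives the
intended thresholds. Digits are obtained from the top by comparing with, and subtracting, stored
powers of two. -/
theorem wp_decodeProg {B n k N L : ℕ} {ε : ℝ} {w : ℕ → ℝ} {C : ℕ → ℕ → ℝ} {s : State} {M : ℝ}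
    {c : ℕ} (h : Ctx n k N L ε w C s) (hM : s.real 10 0 = M) (hc : s.nat 28 0 = c) (hB : n ≤ B)
    (hB' : L ≤ B) :
    wp B decodeProg (fun s' => ∀ l < n, s'.real 3 l = decodeAt ε l L c M 0 M) s := by
  refine wp_seq (wp_setReal (wp_seq (wp_setNat (wp_seq (wp_forTo [40] [3] n (fun i s' =>
    ∀ l < i, s'.real 3 l = M) (by decide) (by decide) hB ?_ (by simp) ?_ ?_)))))
  · intro s' hs
    simp [NatExp.eval, hs.nat, h.size]
  · intro i s₁ hi hs₁ hc₁ hI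
    refine wp_setReal fun l hl => ?_
    have e1 : s₁.real 10 0 = M := by simp [hs₁.real, hM]
    simp only [NatExp.eval, RealExp.eval, hc₁, State.writeNat_real, State.writeReal_real_self,
      Function.update_apply, e1]
    split_ifs with hxi
    · rfl
    · exact hI l (by omega)
  intro s₁ hs₁ hc₁ hI
  refine wp_forTo [22, 28, 40, 41] [3, 14] L (fun r s' => ∀ l < n,
    decodeAt ε l (L - r) (s'.nat 28 0) (s'.real 14 0) (s'.nat 22 0) (s'.real 3 l) =
      decodeAt ε l L c M 0 M) (by decide) (by decide) hB' ?_ ?_ ?_ ?_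
  · intro s' hs
    simp [NatExp.eval, hs.nat, hs₁.nat, h.bits]
  · intro l hl
    simp [hI l hl, hs₁.nat, hs₁.real, hc, hM, NatExp.eval, RealExp.eval]
  · intro r s₂ hr hs₂ hc₂ hI₂
    obtain ⟨m, hm⟩ : ∃ m, L - r = m + 1 := ⟨L - r - 1, by omega⟩
    have hm' : L - (r + 1) = m := by omega
    rw [hm] at hI₂
    have e21 : s₂.nat 21 0 = L := by simp [hs₂.nat, hs₁.nat, h.bits]
    have e4 : s₂.nat 4 m = 2 ^ m := by simp [hs₂.nat, hs₁.nat, h.pow m (by omega)]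
    have e0 : s₂.real 0 0 = ε := by simp [hs₂.real, hs₁.real, h.eps]
    rw [hm']
    refine wp_ite (fun hb => wp_seq (wp_setNat (wp_seq (wp_forTo [41] [3] n (fun i s' =>
      (∀ l < i, s'.real 3 l = if s₂.nat 22 0 ≤ l then s₂.real 14 0 else s₂.real 3 l) ∧
      ∀ l, i ≤ l → s'.real 3 l = s₂.real 3 l) (by decide) (by decide) hB ?_ ?_ ?_ ?_))))
      (fun hb => wp_setReal fun l hl => ?_)
    · intro s' hs
      simp [NatExp.eval, hs.nat, hs₂.nat, hs₁.nat, h.size]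
    · simp
    · intro i s₃ hi hs₃ hc₃ hI₃
      have d1 : s₃.nat 22 0 = s₂.nat 22 0 := by simp [hs₃.nat]
      have d2 : s₃.real 14 0 = s₂.real 14 0 := by simp [hs₃.real]
      refine wp_ite (fun hb' => wp_setReal ?_) (fun hb' => wp_skip ?_)
      · simp only [Test.Holds, NatExp.eval, hc₃, d1] at hb'
        simp only [NatExp.eval, RealExp.eval, hc₃, d2, State.writeNat_real,
          State.writeReal_real_self, Function.update_apply]
        refine ⟨fun l hl => ?_, fun l hl => ?_⟩
        · split_ifs with h1 h2 h2
          · rfl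
          · omega
          · rw [hI₃.1 l (by omega), if_pos h2]
          · rw [hI₃.1 l (by omega), if_neg h2]
        · rw [if_neg (by omega)]
          exact hI₃.2 l (by omega)
      · simp only [Test.Holds, NatExp.eval, hc₃, d1] at hb'
        simp only [State.writeNat_real]
        refine ⟨fun l hl => ?_, fun l hl => hI₃.2 l (by omega)⟩
        rcases Nat.lt_succ_iff_lt_or_eq.mp hl with hl | rfl
        · exact hI₃.1 l hl
        · rw [hI₃.2 l le_rfl, if_neg hb']
    · intro s₃ hs₃ hc₃ hI₃
      simp only [Test.Holds, NatExp.eval, hc₂, e21, hm', e4] at hb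
      refine wp_setNat fun l hl => ?_
      have := hI₂ l hl
      rw [decodeAt, if_pos hb] at this
      rw [← this]
      simp only [NatExp.eval, hc₂, e21, hm', e4] at hs₃
      simp [NatExp.eval, hI₃.1 l hl, hs₃.nat, hs₃.real, two_mul]
    · simp only [Test.Holds, NatExp.eval, hc₂, e21, hm', e4] at hb
      have := hI₂ l hl
      rw [decodeAt, if_neg hb] at this
      rw [← this]
      simp [NatExp.eval, RealExp.eval, e0]
  · intro s' hs' hc' hI' l hl
    have := hI' l hl
    rwa [Nat.sub_self, decodeAt] at this

/-! ### Treatment of one guess -/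

/-- Hypotheses on an instance and on the number `N` of steps of the dual growth. -/
structure Setting (n k N : ℕ) (ε : ℝ) (w : ℕ → ℝ) (C : ℕ → ℕ → ℝ) : Prop where
  anti : ∀ l, w (l + 1) ≤ w l
  last : w n = 0
  symm : ∀ i j, C i j = C j i
  tri : ∀ i j l, C i l ≤ C i j + C j l
  self : ∀ i, C i i = 0
  nonneg : ∀ i j, 0 ≤ C i j
  one_le : 1 ≤ k
  le : k ≤ n
  pos : 0 < ε
  lt_one : ε < 1
  large : 24 * (n : ℝ) ^ 3 ≤ N * ε

theorem Setting.sq_lt {n k N : ℕ} {ε : ℝ} {w : ℕ → ℝ} {C : ℕ → ℕ → ℝ}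
    (h : Setting n k N ε w C) : 2 * n ^ 2 < N := by
  have hn : (1 : ℝ) ≤ n := by exact_mod_cast h.one_le.trans h.le
  have h1 : (N : ℝ) * ε ≤ N * 1 := by
    gcongr
    exact h.lt_one.le
  have h2 := h.large
  have h3 : (n : ℝ) ^ 2 ≤ n ^ 3 := pow_le_pow_right₀ hn (by norm_num)
  have h4 : (1 : ℝ) ≤ n ^ 3 := one_le_pow₀ hn
  have : 2 * (n : ℝ) ^ 2 < N := by linarith
  exact_mod_cast this

/-- The sum identity of `IsSorting` is applied to the indicator of the values exceeding `u 0`, of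
which the sorted list has none. -/
theorem IsSorting.le_first {n : ℕ} {v u : ℕ → ℝ} (h : IsSorting n v u) {j : ℕ} (hj : j < n) :
    v j ≤ u 0 := by
  by_contra! hlt
  have h1 := h.sum_eq (fun x => if u 0 < x then 1 else 0)
  have h2 : ∑ i ∈ range n, (if u 0 < u i then (1 : ℝ) else 0) = 0 :=
    sum_eq_zero fun i hi => if_neg (not_lt.mpr (h.anti 0 i (Nat.zero_le i) (mem_range.mp hi)))
  have h3 : (if u 0 < v j then (1 : ℝ) else 0) ≤
      ∑ j ∈ range n, if u 0 < v j then (1 : ℝ) else 0 :=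
    single_le_sum (f := fun j => if u 0 < v j then (1 : ℝ) else 0)
      (fun i _ => by split_ifs <;> norm_num) (mem_range.mpr hj)
  rw [h1, h2, if_pos hlt] at h3
  linarith

theorem IsGrowthSet.nonempty {n N : ℕ} {δ lam : ℝ} {H : ℕ → ℕ → ℝ} {a τ : ℕ → ℕ} {S : Finset ℕ}
    (h : IsGrowthSet n N δ lam H a τ S) (hδ : 0 ≤ δ) (hlam : lam ≤ δ * N)
    (hH : ∀ i < n, H i i = 0) (hn : 0 < n) : S.Nonempty := by
  have h0 := h.growth.a_le_of_le hδ hlam hH hn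
  obtain ⟨i, hi, h1, -⟩ := h.growth.reach 0 hn (by omega)
  obtain ⟨i', hi', -⟩ := h.maximal i hi (by omega)
  exact ⟨i', hi'⟩

/-- The set `O` of at most `k` centers with the assignment `o` has the sorted costs `u`. -/
structure IsCenterSet (n k : ℕ) (C : ℕ → ℕ → ℝ) (O : Finset ℕ) (o : ℕ → ℕ) (u : ℕ → ℝ) :
    Prop where
  lt : ∀ i ∈ O, i < n
  card_le : O.card ≤ k
  mem : ∀ j < n, o j ∈ O
  sorting : IsSorting n (fun j => C (o j) j) u

/-- A rounded solution is good, if the thresholds are. -/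
theorem proxy_le {n k N : ℕ} {ε : ℝ} {w T u : ℕ → ℝ} {C : ℕ → ℕ → ℝ} {O : Finset ℕ} {o : ℕ → ℕ}
    {δ : ℝ} {v : ℕ → ℝ}
    (h : Setting n k N ε w C) (hO : IsCenterSet n k C O o u)
    (hδ : δ = 2 * n * (w 0 * u 0) / N) (hT : GoodThresholds n ε (u 0) u T)
    (hv : ∑ j ∈ range n, hinge n w T 9 (v j) ≤
      6 * ∑ j ∈ range n, hinge n w T 1 (C (o j) j) + 6 * (k * (n * δ + δ))) :
    proxy n w T 9 v ≤ (18 + 28 * ε) * ∑ i ∈ range n, w i * u i := by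
  have hn : 0 < n := h.one_le.trans h.le
  have hn' : (1 : ℝ) ≤ n := by exact_mod_cast h.one_le.trans h.le
  have hN : (0 : ℝ) < N := by
    have := h.sq_lt
    exact_mod_cast (by omega : 0 < N)
  have hu0 := hO.sorting.nonneg 0 hn
  have hw' : Antitone w := antitone_nat_of_succ_le h.anti
  have hw0 : ∀ i < n, 0 ≤ w i := fun i hi => h.last ▸ hw' hi.le
  have h1 := nine_proxy_le h.anti h.last hn hO.sorting h.pos hu0 hT
  have hfirst : w 0 * u 0 ≤ ∑ i ∈ range n, w i * u i :=
    single_le_sum (f := fun i => w i * u i) (fun i hi =>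
      mul_nonneg (hw0 i (mem_range.mp hi)) (hO.sorting.nonneg i (mem_range.mp hi)))
      (mem_range.mpr hn)
  have hδ0 : 0 ≤ δ := by
    rw [hδ]
    have := hw0 0 hn
    positivity
  -- Origin of the constant 24: the error is at most `12 * n ^ 2 * δ = 24 * n ^ 3 / N * (w 0 * u
  -- 0)`. It supplies the last `ε` in `18 + 28 * ε`.
  have h2 : 6 * ((k : ℝ) * (n * δ + δ)) ≤ ε * (w 0 * u 0) := by
    have hkn : (k : ℝ) ≤ n := by exact_mod_cast h.le
    have h3 : (k : ℝ) * (n * δ + δ) ≤ n * (n * δ + n * δ) := by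
      gcongr
      nlinarith
    have h4 : (n : ℝ) * (n * δ + n * δ) = 4 * n ^ 3 / N * (w 0 * u 0) := by rw [hδ]; ring
    have h5 : 24 * (n : ℝ) ^ 3 / N ≤ ε := by
      rw [div_le_iff₀ hN]
      linarith [h.large]
    have h6 : 24 * (n : ℝ) ^ 3 / N * (w 0 * u 0) ≤ ε * (w 0 * u 0) :=
      mul_le_mul_of_nonneg_right h5 (mul_nonneg (hw0 0 hn) hu0)
    calc 6 * ((k : ℝ) * (n * δ + δ)) ≤ 6 * (4 * n ^ 3 / N * (w 0 * u 0)) := by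
          rw [← h4]
          linarith
      _ = 24 * (n : ℝ) ^ 3 / N * (w 0 * u 0) := by ring
      _ ≤ _ := h6
  have h3 : ε * (w 0 * u 0) ≤ ε * ∑ i ∈ range n, w i * u i :=
    mul_le_mul_of_nonneg_left hfirst h.pos.le
  unfold proxy
  linarith

/-- Rounding of the result of the search to solutions with `k` centers. -/
def roundProg : Program :=
  .seq (copyProg 8 5) <|
  .seq fillProg <|
  .seq considerProg <|
  .ite (.natEq (nv 24) (.const 1))
    (.seq (nearProg 8 12) <| .seq (nearProg 9 13) <| .seq scoreProg <|
      .seq pairProg <| .seq fillProg considerProg)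
    .skip

/-- Treatment of one guess of the maximum distance `real 10 0` and the thresholds, which are
described by `nat 28 0`. -/
def guessProg : Program :=
  .seq decodeProg <|
  .seq (hingeProg 1 4) <| .seq (hingeProg 3 5) <| .seq (hingeProg 9 6) <|
  .seq (.setReal 11 (.const 0) (.div
    (.mul (.mul (.const 2) (.cast nExp)) (.mul (.load 1 (.const 0)) (rv 10))) (.cast (nv 20)))) <|
  .seq searchProg <|
  .ite (.natEq (nv 23) (.const 1)) roundProg .skip

section

variable {B n k N L m : ℕ} {ε δ : ℝ} {w T : ℕ → ℝ} {C : ℕ → ℕ → ℝ} {s : State}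

/-- Both candidates are submitted to the record, so the program need not know which of them
`PricePair.min_le` certifies. If `m = 0` the first one is certified and the second is not computed.
-/
theorem wp_roundProg (h : Ctx n k N L ε w C s) (hs : Setting n k N ε w C)
    (hT : ∀ l < n, s.real 3 l = T l) (hT0 : ∀ l, 0 ≤ T l)
    (hH₃ : ∀ i < n, ∀ j < n, s.real 5 (i * n + j) = hinge n w T 3 (C i j))
    (hH₉ : ∀ i < n, ∀ j < n, s.real 6 (i * n + j) = hinge n w T 9 (C i j)) (hδ : 0 ≤ δ)
    (hP : PricePair n k N δ (fun i j => hinge n w T 1 (C i j)) m (fset n (s.nat 8))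
      (fset n (s.nat 9)))
    (hm : s.nat 24 0 = 1 ↔ m ≠ 0) (hV : ValidRecord n k w C s) (hB : n ≤ B) :
    wp B roundProg (fun s' => ValidRecord n k w C s' ∧ (∀ v, Recorded v s → Recorded v s') ∧
      ∀ O o u, IsCenterSet n k C O o u → ∃ v : ℕ → ℝ, Recorded (proxy n w T 9 v) s' ∧
        ∑ j ∈ range n, hinge n w T 9 (v j) ≤
          6 * ∑ j ∈ range n, hinge n w T 1 (C (o j) j) + 6 * (k * (n * δ + δ))) s := by
  have hn : 0 < n := hs.one_le.trans hs.le
  refine wp_seq (wp_call (N := [5, 47]) (R := []) (wp_copyProg h (a := 8) (b := 5) (by simp)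
    (by simp) hB) (by decide) (by decide) ?_)
  intro s₁ hs₁ hF₁
  have h₁ := h.of_same hs₁ (by simp) (by simp)
  refine wp_seq (wp_call (N := [5, 26, 29, 30, 40, 41]) (R := [])
    (wp_fillProg h₁ (by rw [hF₁]; exact hP.card_le) hs.le hB) (by decide) (by decide) ?_)
  rintro s₂ hs₂ ⟨hF₂, hcard₂, -⟩
  rw [hF₁] at hF₂
  have h₂ := h₁.of_same hs₂ (by simp) (by simp)
  have hV₂ := (hV.of_same hs₁ (by simp) (by simp)).of_same hs₂ (by simp) (by simp)
  have hR₂ : ∀ v, Recorded v s → Recorded v s₂ := fun v hv =>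
    (hv.of_same hs₁ (by simp) (by simp)).of_same hs₂ (by simp) (by simp)
  refine wp_seq (wp_call (wp_considerProg h₂ (T := T) (by simpa [hs₂.real, hs₁.real] using hT)
    (by simpa [hs₂.real, hs₁.real] using hH₉) hs.anti hs.last hcard₂ hs.one_le hV₂ hB)
    considerProg_natWrites considerProg_realWrites ?_)
  rintro s₃ hs₃ ⟨hV₃, hR₃, ρ₁, hρ₁, hrec₁⟩
  have h₃ : Ctx n k N L ε w C s₃ := h₂.of_same hs₃ (by simp) (by simp)
  have e8 : s₃.nat 8 = s.nat 8 := by simp [hs₃.nat, hs₂.nat, hs₁.nat]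
  have e9 : s₃.nat 9 = s.nat 9 := by simp [hs₃.nat, hs₂.nat, hs₁.nat]
  have e24 : s₃.nat 24 0 = 1 ↔ m ≠ 0 := by
    rw [← hm]
    simp [hs₃.nat, hs₂.nat, hs₁.nat]
  have eT : s₃.real 3 = s.real 3 := by simp [hs₃.real, hs₂.real, hs₁.real]
  have e5 : s₃.real 5 = s.real 5 := by simp [hs₃.real, hs₂.real, hs₁.real]
  have e6 : s₃.real 6 = s.real 6 := by simp [hs₃.real, hs₂.real, hs₁.real]
  have hH0 : ∀ i < n, hinge n w T 1 (C i i) = 0 := fun i _ => by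
    simp [hs.self, hinge_zero hT0]
  have hS₁ : (fset n (s.nat 8)).Nonempty := by
    obtain ⟨a, τ, hg⟩ := hP.first
    refine hg.nonempty hδ ?_ hH0 hn
    rw [mul_comm]
    gcongr
    exact hP.le
  refine wp_ite (fun hb => ?_) (fun hb => wp_skip ?_)
  · simp only [Test.natEq_holds, NatExp.eval, e24] at hb
    have hS₂ : (fset n (s.nat 9)).Nonempty := card_pos.mp (by have := (hP.second hb).2; omega)
    refine wp_seq (wp_call (N := [12, 26, 40, 41]) (R := [])
      (wp_nearProg h₃ (a := 8) (out := 12) (by simp) (by simp) hB) (by decide) (by decide) ?_)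
    intro s₄ hs₄ hnear₁
    have h₄ := h₃.of_same hs₄ (by simp) (by simp)
    rw [e8] at hnear₁
    have hnear₁ := hnear₁ hS₁
    refine wp_seq (wp_call (N := [13, 26, 40, 41]) (R := [])
      (wp_nearProg h₄ (a := 9) (out := 13) (by simp) (by simp) hB) (by decide) (by decide) ?_)
    intro s₅ hs₅ hnear₂
    have h₅ := h₄.of_same hs₅ (by simp) (by simp)
    rw [hs₄.nat 9 (by simp), e9] at hnear₂
    have hnear₂ := hnear₂ hS₂
    rw [← hs₅.nat 12 (by simp)] at hnear₁
    have hσ₁ : ∀ j < n, s₅.nat 12 j < n := fun j hj => (mem_fset.mp (hnear₁ j hj).1).1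
    have hσ₂ : ∀ j < n, s₅.nat 13 j < n := fun j hj => (mem_fset.mp (hnear₂ j hj).1).1
    refine wp_seq (wp_call (N := [40]) (R := [7])
      (wp_scoreProg h₅ (H := fun i j => hinge n w T 3 (C i j))
        (by simpa [hs₅.real, hs₄.real, e5] using hH₃) hσ₁ hB) (by decide) (by decide) ?_)
    intro s₆ hs₆ hscore
    have h₆ := h₅.of_same hs₆ (by simp) (by simp)
    refine wp_seq (wp_call (N := [5, 40]) (R := [])
      (wp_pairProg h₆ (by simpa [hs₆.nat] using hσ₂) hB) (by decide) (by decide) ?_)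
    intro s₇ hs₇ hpair
    have h₇ := h₆.of_same hs₇ (by simp) (by simp)
    simp only [hs₆.nat 13 (by simp), hs₆.nat 8 (by simp), hs₅.nat 8 (by simp),
      hs₄.nat 8 (by simp), e8] at hpair
    refine wp_seq (wp_call (N := [5, 26, 29, 30, 40, 41]) (R := [])
      (wp_fillProg h₇ (by rw [hpair]; exact card_image_le.trans hP.card_le) hs.le hB)
      (by decide) (by decide) ?_)
    rintro s₈ hs₈ ⟨hF₈, hcard₈, hbest⟩
    have h₈ := h₇.of_same hs₈ (by simp) (by simp)
    rw [hpair] at hF₈ hbest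
    have hV₈ : ValidRecord n k w C s₈ :=
      ((((hV₃.of_same hs₄ (by simp) (by simp)).of_same hs₅ (by simp) (by simp)).of_same hs₆
        (by simp) (by simp)).of_same hs₇ (by simp) (by simp)).of_same hs₈ (by simp) (by simp)
    have hR₈ : ∀ v, Recorded v s₃ → Recorded v s₈ := fun v hv =>
      ((((hv.of_same hs₄ (by simp) (by simp)).of_same hs₅ (by simp) (by simp)).of_same hs₆
        (by simp) (by simp)).of_same hs₇ (by simp) (by simp)).of_same hs₈ (by simp) (by simp)
    refine wp_mono (wp_considerProg h₈ (T := T)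
      (by simpa [hs₈.real, hs₇.real, hs₆.real, hs₅.real, hs₄.real, eT] using hT)
      (by simpa [hs₈.real, hs₇.real, hs₆.real, hs₅.real, hs₄.real, e6] using hH₉)
      hs.anti hs.last hcard₈ hs.one_le hV₈ hB) ?_
    rintro s₉ ⟨hV₉, hR₉, ρ₂, hρ₂, hrec₂⟩
    refine ⟨hV₉, fun v hv => hR₉ v (hR₈ v (hR₃ v (hR₂ v hv))), fun O o u hO => ?_⟩
    have hbest' : ∀ x ∈ fset n (s₈.nat 5), x ∉ (fset n (s.nat 8)).image (s₅.nat 13) → ∀ y < n,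
        y ∉ fset n (s₈.nat 5) →
        scoreOf n (fun i j => hinge n w T 3 (C i j)) (s₅.nat 12) (s₅.nat 13) y ≤
          scoreOf n (fun i j => hinge n w T 3 (C i j)) (s₅.nat 12) (s₅.nat 13) x := by
      intro x hx hxS y hy hyF
      have := hbest x hx hxS y hy hyF
      rwa [hs₇.real 7 (by simp), hscore y hy, hscore x (mem_fset.mp hx).1] at this
    rcases hP.min_le hs.anti hT0 hs.symm hs.tri hs.self hO.lt hO.card_le hO.mem hδ hn hF₂ hρ₁
      (fun _ => ⟨hnear₁, hnear₂, hρ₂, hcard₈, hF₈, hbest'⟩) with h' | ⟨-, h'⟩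
    · exact ⟨_, hR₉ _ (hR₈ _ hrec₁), h'⟩
    · exact ⟨_, hrec₂, h'⟩
  · simp only [Test.natEq_holds, NatExp.eval, e24] at hb
    refine ⟨hV₃, fun v hv => hR₃ v (hR₂ v hv), fun O o u hO => ?_⟩
    rcases hP.min_le (F₂ := ∅) (ρ₂ := id) (σ₁ := id) (σ₂ := id) hs.anti hT0 hs.symm hs.tri hs.self
      hO.lt hO.card_le hO.mem hδ hn hF₂ hρ₁
      (fun hm0 => absurd hm0 hb) with h' | ⟨hm0, -⟩
    · exact ⟨_, hrec₁, h'⟩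
    · exact absurd hm0 hb

/-- Only the quality clause depends on a right guess. If `M` is the true maximum, the search cannot
fail, by `IsGrowthSet.card_le`; after a failed search the record is simply kept. -/
theorem wp_guessProg (h : Ctx n k N L ε w C s) (hs : Setting n k N ε w C) {M : ℝ} {c : ℕ}
    (hM : s.real 10 0 = M) (hM0 : 0 ≤ M) (hc : s.nat 28 0 = c)
    (hV : ValidRecord n k w C s) (hB : n * n ≤ B) (hBN : N + 1 ≤ B) (hBL : L ≤ B) :
    wp B guessProg (fun s' => ValidRecord n k w C s' ∧ (∀ v, Recorded v s → Recorded v s') ∧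
      ∀ O o u, IsCenterSet n k C O o u → u 0 = M →
        GoodThresholds n ε (u 0) u (fun l => decodeAt ε l L c M 0 M) →
        Recorded ((18 + 28 * ε) * ∑ i ∈ range n, w i * u i) s') s := by
  have hn : 0 < n := hs.one_le.trans hs.le
  have hBn : n ≤ B := (Nat.le_mul_of_pos_left n hn).trans hB
  have hT0 : ∀ l, 0 ≤ decodeAt ε l L c M 0 M := fun l => decodeAt_nonneg hs.pos _ _ _ _ hM0 hM0
  refine wp_seq (wp_call (N := [22, 28, 40, 41]) (R := [3, 14]) (wp_decodeProg h hM hc hBn hBL)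
    (by decide) (by decide) ?_)
  intro s₁ hs₁ hT₁
  set T := fun l => decodeAt ε l L c M 0 M with hTdef
  replace hT₁ : ∀ l < n, s₁.real 3 l = T l := hT₁
  replace hT0 : ∀ l, 0 ≤ T l := hT0
  have h₁ := h.of_same hs₁ (by simp) (by simp)
  refine wp_seq (wp_call (N := [40, 41]) (R := [4, 13]) (wp_hingeProg h₁ hT₁ 1 (out := 4)
    (by simp) hB hBn) (by decide) (by decide) ?_)
  intro s₂ hs₂ hH₁
  have h₂ := h₁.of_same hs₂ (by simp) (by simp)
  have hT₂ : ∀ l < n, s₂.real 3 l = T l := by simpa [hs₂.real] using hT₁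
  refine wp_seq (wp_call (N := [40, 41]) (R := [5, 13]) (wp_hingeProg h₂ hT₂ 3 (out := 5)
    (by simp) hB hBn) (by decide) (by decide) ?_)
  intro s₃ hs₃ hH₃
  have h₃ := h₂.of_same hs₃ (by simp) (by simp)
  have hT₃ : ∀ l < n, s₃.real 3 l = T l := by simpa [hs₃.real] using hT₂
  refine wp_seq (wp_call (N := [40, 41]) (R := [6, 13]) (wp_hingeProg h₃ hT₃ 9 (out := 6)
    (by simp) hB hBn) (by decide) (by decide) ?_)
  intro s₄ hs₄ hH₉
  have h₄ := h₃.of_same hs₄ (by simp) (by simp)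
  have hT₄ : ∀ l < n, s₄.real 3 l = T l := by simpa [hs₄.real] using hT₃
  push_cast at hH₁ hH₃ hH₉
  rw [← hs₃.real 4 (by simp), ← hs₄.real 4 (by simp)] at hH₁
  rw [← hs₄.real 5 (by simp)] at hH₃
  have e10 : s₄.real 10 0 = M := by simp [hs₄.real, hs₃.real, hs₂.real, hs₁.real, hM]
  have hV₄ : ValidRecord n k w C s₄ :=
    (((hV.of_same hs₁ (by simp) (by simp)).of_same hs₂ (by simp) (by simp)).of_same hs₃
      (by simp) (by simp)).of_same hs₄ (by simp) (by simp)
  have hR₄ : ∀ v, Recorded v s → Recorded v s₄ := fun v hv =>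
    (((hv.of_same hs₁ (by simp) (by simp)).of_same hs₂ (by simp) (by simp)).of_same hs₃
      (by simp) (by simp)).of_same hs₄ (by simp) (by simp)
  refine wp_seq (wp_setReal ?_)
  simp only [NatExp.eval, RealExp.eval, h₄.size, h₄.weight, h₄.rounds, e10, Rat.cast_ofNat]
  -- With this step width the largest price `N * δ` is twice the trivial bound `n * (w 0 * M)` on
  -- the cost of the comparison solution.
  set δ : ℝ := 2 * n * (w 0 * M) / N with hδ
  have hδ0 : 0 ≤ δ := by
    have : 0 ≤ w 0 := hs.last ▸ antitone_nat_of_succ_le hs.anti (Nat.zero_le n)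
    positivity
  have hs₅ : Same [] [11] s₄ (s₄.writeReal 11 0 δ) :=
    ⟨fun _ _ => rfl, fun b hb => by simp at hb; simp [hb]⟩
  have h₅ := h₄.of_same hs₅ (by simp) (by simp)
  refine wp_seq (wp_call (wp_searchProg h₅ (δ := δ) (by simp)
    (H := fun i j => hinge n w T 1 (C i j)) (by simpa using hH₁) hBn hBN)
    searchProg_natWrites searchProg_realWrites ?_)
  intro s₆ hs₆ hres
  have h₆ : Ctx n k N L ε w C s₆ := h₅.of_same hs₆ (by simp) (by simp)
  have hV₆ : ValidRecord n k w C s₆ :=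
    (hV₄.of_same hs₅ (by simp) (by simp)).of_same hs₆ (by simp) (by simp)
  have hR₆ : ∀ v, Recorded v s → Recorded v s₆ := fun v hv =>
    ((hR₄ v hv).of_same hs₅ (by simp) (by simp)).of_same hs₆ (by simp) (by simp)
  refine wp_ite (fun hb => ?_) (fun hb => wp_skip ?_)
  · simp only [Test.natEq_holds, NatExp.eval] at hb
    rcases hres with ⟨-, m, hP, hm⟩ | ⟨h0, -⟩
    swap
    · omega
    refine wp_mono (wp_roundProg h₆ hs (T := T) (by simpa [hs₆.real] using hT₄) hT0
      (by simpa [hs₆.real] using hH₃) (by simpa [hs₆.real] using hH₉) hδ0 hP hm hV₆ hBn) ?_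
    rintro s₇ ⟨hV₇, hR₇, hex⟩
    refine ⟨hV₇, fun v hv => hR₇ v (hR₆ v hv), fun O o u hO huM hgood => ?_⟩
    obtain ⟨v, hrec, hle⟩ := hex O o u hO
    exact ⟨hrec.1, hrec.2.trans (proxy_le hs hO (by rw [huM]) hgood hle)⟩
  · simp only [Test.natEq_holds, NatExp.eval] at hb
    refine ⟨hV₆, hR₆, fun O o u hO huM hgood => ?_⟩
    rcases hres with ⟨h0, -⟩ | ⟨-, a, τ, S, hS, hk⟩
    · exact absurd h0 hb
    · refine absurd (hS.card_le hs.anti hs.last hT0 hs.symm hs.tri hs.self hs.nonneg hO.lt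
        hO.card_le hs.le hO.mem (fun j hj => ?_) hM0 hn hs.sq_lt hδ) (by omega)
      rw [← huM]
      exact hO.sorting.le_first hj

end

/-! ### Preparations and the loop over all guesses -/

/-- Computation of the row offsets. -/
def offsetProg : Program :=
  .forTo 40 nExp (.setNat 3 (.add (nv 40) (.const 1)) (.add (na 3 40) nExp))

/-- Computation of the number of steps of the dual growth. -/
def roundsProg : Program :=
  .whileDo (.not (.realLe
      (.mul (.const 24) (.mul (.cast nExp) (.mul (.cast nExp) (.cast nExp))))
      (.mul (.cast (nv 20)) (rv 0))))
    (.setNat 20 (.const 0) (.add (nv 20) (.const 1)))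

/-- Computation of the number of binary digits that describe thresholds. -/
def bitsProg : Program :=
  .seq (.setReal 17 (.const 0) (.const 1)) <|
  .seq (.whileDo (.not (.realLe (.cast nExp) (.mul (rv 0) (rv 17))))
    (.seq (.setReal 17 (.const 0) (.mul (rv 17) (.add (.const 1) (rv 0))))
      (.setNat 21 (.const 0) (.add (nv 21) (.const 1))))) <|
  .whileDo (.not (.natLe nExp (nv 22)))
    (.seq (.setNat 22 (.const 0) (.add (.add (nv 22) (nv 22)) (.const 1)))
      (.setNat 21 (.const 0) (.add (nv 21) (.const 1))))

/-- Computation of the powers of two. -/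
def powersProg : Program :=
  .seq (.setNat 4 (.const 0) (.const 1)) <|
  .forTo 40 (nv 21) (.setNat 4 (.add (nv 40) (.const 1)) (.add (na 4 40) (na 4 40)))

/-- All guesses. -/
def loopProg : Program :=
  .forTo 48 (.load 3 nExp) <|
    .seq (.setReal 10 (.const 0) (ra 2 48)) <|
    .forTo 49 (.load 4 (nv 21)) <|
      .seq (.setNat 28 (.const 0) (nv 49)) guessProg

/-- The approximation algorithm. -/
def mainProg : Program :=
  .seq offsetProg <| .seq roundsProg <| .seq bitsProg <| .seq powersProg loopProg

section

variable {B n k N L Q A : ℕ} {ε : ℝ} {w : ℕ → ℝ} {C : ℕ → ℕ → ℝ} {s : State}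

theorem wp_offsetProg (hn : s.nat 0 0 = n) (h0 : s.nat 3 0 = 0) (hB : n ≤ B) :
    wp B offsetProg (fun s' => ∀ i ≤ n, s'.nat 3 i = i * n) s := by
  refine wp_forTo [3, 40] [] n (fun i s' => ∀ x ≤ i, s'.nat 3 x = x * n) (by decide) (by decide)
    hB ?_ ?_ ?_ ?_
  · intro s' hs
    simp [NatExp.eval, hs.nat, hn]
  · intro x hx
    have : x = 0 := by omega
    simp [this, h0]
  · intro i s₁ hi hs₁ hc₁ hI
    refine wp_setNat fun x hx => ?_
    simp only [NatExp.eval, hc₁, ne_eq, Nat.reduceEqDiff, not_false_eq_true,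
      State.writeNat_nat_of_ne, State.writeNat_nat_self, Function.update_apply]
    split_ifs with hxi
    · rw [hI i le_rfl, hs₁.nat 0 (by simp), hn, hxi]
      ring
    · exact hI x (by omega)
  · intro s' hs' hc' hI
    exact hI

/-- A real number cannot be rounded to a natural one, so the least suitable `N` is found by counting
up; its minimality bounds the time. -/
theorem wp_roundsProg (hn : s.nat 0 0 = n) (h0 : s.nat 20 0 = 0) (hε : s.real 0 0 = ε)
    (hN : 24 * (n : ℝ) ^ 3 ≤ N * ε) (hN' : ∀ m < N, m * ε < 24 * (n : ℝ) ^ 3) (hB : N ≤ B) :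
    wp B roundsProg (fun s' => s'.nat 20 0 = N) s := by
  have hb : ∀ s' : State, s'.nat 0 0 = n → s'.real 0 0 = ε →
      ((Test.not (.realLe (.mul (.const 24) (.mul (.cast nExp) (.mul (.cast nExp) (.cast nExp))))
        (.mul (.cast (nv 20)) (rv 0)))).Holds s' ↔ (s'.nat 20 0 : ℝ) * ε < 24 * (n : ℝ) ^ 3) := by
    intro s' h1 h2
    simp only [Test.Holds, RealExp.eval, NatExp.eval, h1, h2, not_le, Rat.cast_ofNat]
    rw [show (24 : ℝ) * (n * (n * n)) = 24 * (n : ℝ) ^ 3 by ring]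
  refine wp_while (fun s' => s'.nat 0 0 = n ∧ s'.real 0 0 = ε ∧ s'.nat 20 0 ≤ N)
    (fun s' => N - s'.nat 20 0) ?_ ⟨hn, hε, by omega⟩ (by omega) ?_
  · rintro s' ⟨h1, h2, h3⟩ hlt
    rw [hb s' h1 h2] at hlt
    have hlt' : s'.nat 20 0 < N := by
      rcases h3.lt_or_eq with h3 | h3
      · exact h3
      · rw [h3] at hlt
        exact absurd hN (not_le.mpr hlt)
    refine ⟨by omega, wp_setNat ?_⟩
    simp [NatExp.eval, h1, h2]
    omega
  · rintro s' ⟨h1, h2, h3⟩ hge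
    rw [hb s' h1 h2] at hge
    rcases h3.lt_or_eq with h3 | h3
    · exact absurd (hN' _ h3) hge
    · exact h3

/-- The same counter measures first `Q`, by powers of `1 + ε`, and then `A`, by the positions `2 ^ a
- 1` which the decoding visits. -/
theorem wp_bitsProg (hn : s.nat 0 0 = n) (h21 : s.nat 21 0 = 0) (h22 : s.nat 22 0 = 0)
    (hε : s.real 0 0 = ε) (hQ : (n : ℝ) ≤ ε * (1 + ε) ^ Q)
    (hQ' : ∀ q < Q, ε * (1 + ε) ^ q < n) (hA : n + 1 ≤ 2 ^ A) (hA' : ∀ a < A, 2 ^ a < n + 1)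
    (hBQ : Q ≤ B) (hBA : A ≤ B) : wp B bitsProg (fun s' => s'.nat 21 0 = Q + A) s := by
  refine wp_seq (wp_setReal (wp_seq (wp_while (fun s' => s'.nat 0 0 = n ∧ s'.nat 22 0 = 0 ∧
    s'.real 0 0 = ε ∧ s'.nat 21 0 ≤ Q ∧ s'.real 17 0 = (1 + ε) ^ s'.nat 21 0)
    (fun s' => Q - s'.nat 21 0) ?_ ?_ ?_ ?_)))
  · rintro s' ⟨h1, h2, h3, h4, h5⟩ hlt
    simp only [Test.Holds, RealExp.eval, NatExp.eval, h1, h3, h5, not_le] at hlt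
    have hlt' : s'.nat 21 0 < Q := by
      rcases h4.lt_or_eq with h4 | h4
      · exact h4
      · rw [h4] at hlt
        exact absurd hQ (not_le.mpr hlt)
    refine ⟨by omega, wp_seq (wp_setReal (wp_setNat ?_))⟩
    simp [NatExp.eval, RealExp.eval, h1, h2, h3, h5, pow_succ]
    omega
  · simp [hn, h22, hε, h21, RealExp.eval, NatExp.eval]
  · simp only [State.writeReal_nat]
    omega
  · rintro s₁ ⟨h1, h2, h3, h4, h5⟩ hge
    simp only [Test.Holds, RealExp.eval, NatExp.eval, h1, h3, h5, not_le] at hge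
    have hQ1 : s₁.nat 21 0 = Q := by
      rcases h4.lt_or_eq with h4 | h4
      · exact absurd (hQ' _ h4) hge
      · exact h4
    refine wp_while (fun s' => s'.nat 0 0 = n ∧ ∃ a ≤ A, s'.nat 21 0 = Q + a ∧
      s'.nat 22 0 + 1 = 2 ^ a) (fun s' => Q + A - s'.nat 21 0) ?_ ?_ (by omega) ?_
    · rintro s' ⟨g1, a, ha, g2, g3⟩ hlt
      simp only [Test.Holds, NatExp.eval, g1, not_le] at hlt
      have ha' : a < A := by
        rcases ha.lt_or_eq with ha | rfl
        · exact ha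
        · omega
      refine ⟨by omega, wp_seq (wp_setNat (wp_setNat ?_))⟩
      refine ⟨⟨by simp [g1], a + 1, ha', ?_, ?_⟩, ?_⟩
      · simp [NatExp.eval, g2, add_assoc]
      · simp [NatExp.eval, pow_succ]
        omega
      · simp [NatExp.eval]
        omega
    · exact ⟨h1, 0, Nat.zero_le _, by omega, by simp [h2]⟩
    · rintro s' ⟨g1, a, ha, g2, g3⟩ hge
      simp only [Test.Holds, NatExp.eval, g1, not_le, not_lt] at hge
      rcases ha.lt_or_eq with ha | rfl
      · have := hA' a ha
        omega
      · exact g2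

theorem wp_powersProg (hL : s.nat 21 0 = L) (hB : L ≤ B) :
    wp B powersProg (fun s' => ∀ i ≤ L, s'.nat 4 i = 2 ^ i) s := by
  refine wp_seq (wp_setNat (wp_forTo [4, 40] [] L (fun i s' => ∀ x ≤ i, s'.nat 4 x = 2 ^ x)
    (by decide) (by decide) hB ?_ ?_ ?_ ?_))
  · intro s' hs
    simp [NatExp.eval, hs.nat, hL]
  · intro x hx
    have : x = 0 := by omega
    simp [this, NatExp.eval]
  · intro i s₁ hi hs₁ hc₁ hI
    refine wp_setNat fun x hx => ?_
    simp only [NatExp.eval, hc₁, ne_eq, Nat.reduceEqDiff, not_false_eq_true,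
      State.writeNat_nat_of_ne, State.writeNat_nat_self, Function.update_apply]
    split_ifs with hxi
    · rw [hI i le_rfl, hxi]
      ring
    · exact hI x (by omega)
  · intro s' hs' hc' hI
    exact hI

set_option maxRecDepth 4000 in
theorem wp_loopProg (h : Ctx n k N (Q + A) ε w C s) (hs : Setting n k N ε w C)
    (hQ : (n : ℝ) ≤ ε * (1 + ε) ^ Q) (hA : n + 1 ≤ 2 ^ A) (h27 : s.nat 27 0 = 0)
    (hB : n * n ≤ B) (hBN : N + 1 ≤ B) (hBL : Q + A ≤ B) (hBP : 2 ^ (Q + A) ≤ B) :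
    wp B loopProg (fun s' => ValidRecord n k w C s' ∧
      ∀ O o u, IsCenterSet n k C O o u → (∃ i < n, ∃ j < n, u 0 = C i j) →
        Recorded ((18 + 28 * ε) * ∑ i ∈ range n, w i * u i) s') s := by
  have hn : 0 < n := hs.one_le.trans hs.le
  set U := [1, 2, 5, 6, 7, 8, 9, 10, 11, 12, 13, 22, 23, 24, 25, 26, 27, 28, 29, 30, 40, 41, 42,
    43, 44, 45, 46, 47, 48, 49] with hU
  set V := [3, 4, 5, 6, 7, 10, 11, 12, 13, 14, 15, 16] with hV
  have hrow : ∀ x < n * n, s.real 2 x = C (x / n) (x % n) := by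
    intro x hx
    have h1 : x / n < n := Nat.div_lt_of_lt_mul hx
    have h2 : x % n < n := Nat.mod_lt _ hn
    rw [← h.dist _ h1 _ h2]
    congr 1
    rw [mul_comm, Nat.div_add_mod]
  refine wp_forTo U V (n * n) (fun x s' => ValidRecord n k w C s' ∧ ∀ y < x, ∀ O o u,
    IsCenterSet n k C O o u → u 0 = s.real 2 y →
      Recorded ((18 + 28 * ε) * ∑ i ∈ range n, w i * u i) s') (by decide) (by decide) hB
      ?_ ?_ ?_ ?_
  · intro s' hs'
    simp [NatExp.eval, hs'.nat, h.size, h.off n le_rfl, hU]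
  · refine ⟨fun h' => ?_, fun y hy => by omega⟩
    simp [h27] at h'
  · rintro x s₁ hx hs₁ hc₁ ⟨hV₁, hR₁⟩
    have h₁ : Ctx n k N (Q + A) ε w C s₁ := h.of_same hs₁ (by simp [hU]) (by simp [hV])
    refine wp_seq (wp_setReal ?_)
    have e2 : s₁.real 2 = s.real 2 := by simp [hs₁.real, hV]
    simp only [NatExp.eval, RealExp.eval, hc₁, e2]
    set M := s.real 2 x with hM
    have hM0 : 0 ≤ M := by rw [hM, hrow x hx]; exact hs.nonneg _ _
    have hs₂ : Same [] [10] s₁ (s₁.writeReal 10 0 M) :=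
      ⟨fun _ _ => rfl, fun b hb => by simp at hb; simp [hb]⟩
    have h₂ := h₁.of_same hs₂ (by simp) (by simp)
    have hV₂ := hV₁.of_same hs₂ (by simp) (by simp)
    have hR₂ : ∀ v, Recorded v s₁ → Recorded v (s₁.writeReal 10 0 M) := fun v hv =>
      hv.of_same hs₂ (by simp) (by simp)
    set s₂ := s₁.writeReal 10 0 M with hs₂def
    have hM₂ : s₂.real 10 0 = M := by simp [hs₂def]
    refine wp_forTo [1, 2, 5, 6, 7, 8, 9, 10, 11, 12, 13, 22, 23, 24, 25, 26, 27, 28, 29, 30, 40,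
      41, 42, 43, 44, 45, 46, 47, 49] [3, 4, 5, 6, 7, 11, 12, 13, 14, 15, 16] (2 ^ (Q + A))
      (fun c s' => ValidRecord n k w C s' ∧ (∀ v, Recorded v s₂ → Recorded v s') ∧
        ∀ d < c, ∀ O o u, IsCenterSet n k C O o u → u 0 = M →
        GoodThresholds n ε (u 0) u (fun l => decodeAt ε l (Q + A) d M 0 M) →
        Recorded ((18 + 28 * ε) * ∑ i ∈ range n, w i * u i) s') (by decide) (by decide) hBP
        ?_ ?_ ?_ ?_
    · intro s' hs'
      simp [NatExp.eval, hs'.nat, h₂.bits, h₂.pow]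
    · refine ⟨hV₂.of_same ((Same.refl [49] [] s₂).writeNat (by simp) _ _) (by simp) (by simp),
        fun v hv => hv.of_same ((Same.refl [49] [] s₂).writeNat (by simp) _ _) (by simp) (by simp),
        fun d hd => by omega⟩
    · rintro c s₃ hc hs₃ hc₃ ⟨hV₃, hR₃, hgood⟩
      have h₃ : Ctx n k N (Q + A) ε w C s₃ := h₂.of_same hs₃ (by simp) (by simp)
      refine wp_seq (wp_setNat ?_)
      have hs₄ : Same [28] [] s₃ (s₃.writeNat 28 0 c) :=
        (Same.refl [28] [] s₃).writeNat (by simp) _ _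
      simp only [NatExp.eval, hc₃]
      refine wp_mono (wp_guessProg (h₃.of_same hs₄ (by simp) (by simp)) hs (M := M) (c := c)
        (by simp [hs₃.real, hM₂]) hM0 (by simp) (hV₃.of_same hs₄ (by simp) (by simp)) hB hBN hBL) ?_
      rintro s₅ ⟨hV₅, hR₅, hgood₅⟩
      have hs₆ : Same [49] [] s₅ (s₅.writeNat 49 0 (c + 1)) :=
        (Same.refl [49] [] s₅).writeNat (by simp) _ _
      refine ⟨hV₅.of_same hs₆ (by simp) (by simp), fun v hv => ?_, fun d hd O o u hO hu0 hT => ?_⟩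
      · exact (hR₅ v ((hR₃ v hv).of_same hs₄ (by simp) (by simp))).of_same hs₆ (by simp) (by simp)
      · rcases Nat.lt_succ_iff_lt_or_eq.mp hd with hd | rfl
        · exact (hR₅ _ ((hgood d hd O o u hO hu0 hT).of_same hs₄ (by simp) (by simp))).of_same hs₆
            (by simp) (by simp)
        · exact (hgood₅ O o u hO hu0 hT).of_same hs₆ (by simp) (by simp)
    · rintro s₃ hs₃ hc₃ ⟨hV₃, hR₃, hgood⟩
      have hs₄ : Same [48] [] s₃ (s₃.writeNat 48 0 (x + 1)) :=
        (Same.refl [48] [] s₃).writeNat (by simp) _ _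
      refine ⟨hV₃.of_same hs₄ (by simp) (by simp), fun y hy O o u hO hu0 => ?_⟩
      refine Recorded.of_same ?_ hs₄ (by simp) (by simp)
      rcases Nat.lt_succ_iff_lt_or_eq.mp hy with hy | rfl
      · exact hR₃ _ (hR₂ _ (hR₁ y hy O o u hO hu0))
      · have hn' : (0 : ℝ) < n := by exact_mod_cast hn
        have hu0' : 0 ≤ u 0 := hO.sorting.nonneg 0 hn
        have hε := hs.pos
        -- The choice `θ = ε * u 0 / n` is the tolerance in `GoodThresholds`. Starting from `x = u
        -- 0`, the condition on `Q` follows from `n ≤ ε * (1 + ε) ^ Q`.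
        obtain ⟨c, hc, hT⟩ := exists_code (n := n) (ε := ε) (θ := ε * u 0 / n) (u := u) hs.pos
          (by positivity) hO.sorting.anti hO.sorting.nonneg (Q + A) A Q 0 (u 0) (by omega)
          (by simpa using hA) (by
            rw [div_mul_eq_mul_div, le_div_iff₀ hn']
            nlinarith) (fun _ => le_rfl)
        refine hgood c hc O o u hO hu0 fun l hl => ?_
        rw [show M = u 0 from hu0.symm]
        exact hT (u 0) l hl (Nat.zero_le l)
  · rintro s' hs' hc' ⟨hV', hR'⟩
    refine ⟨hV', fun O o u hO ⟨i, hi, j, hj, hij⟩ => hR' (i * n + j) (by nlinarith) O o u hO ?_⟩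
    rw [hij, h.dist i hi j hj]

theorem wp_mainProg (hn : s.nat 0 0 = n) (hk : s.nat 0 1 = k) (h0 : ∀ a ≠ 0, s.nat a 0 = 0)
    (hε : s.real 0 0 = ε) (hw : s.real 1 = w)
    (hC : ∀ i < n, ∀ j < n, s.real 2 (i * n + j) = C i j) (hs : Setting n k N ε w C)
    (hN' : ∀ m < N, m * ε < 24 * (n : ℝ) ^ 3) (hQ : (n : ℝ) ≤ ε * (1 + ε) ^ Q)
    (hQ' : ∀ q < Q, ε * (1 + ε) ^ q < n) (hA : n + 1 ≤ 2 ^ A) (hA' : ∀ a < A, 2 ^ a < n + 1)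
    (hB : n * n ≤ B) (hBN : N + 1 ≤ B) (hBL : Q + A ≤ B) (hBP : 2 ^ (Q + A) ≤ B) :
    wp B mainProg (fun s' => ValidRecord n k w C s' ∧
      ∀ O o u, IsCenterSet n k C O o u → (∃ i < n, ∃ j < n, u 0 = C i j) →
        Recorded ((18 + 28 * ε) * ∑ i ∈ range n, w i * u i) s') s := by
  have hn0 : 0 < n := hs.one_le.trans hs.le
  have hBn : n ≤ B := (Nat.le_mul_of_pos_left n hn0).trans hB
  refine wp_seq (wp_call (N := [3, 40]) (R := []) (wp_offsetProg hn (h0 3 (by simp)) hBn)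
    (by decide) (by decide) ?_)
  intro s₁ hs₁ hoff
  refine wp_seq (wp_call (N := [20]) (R := []) (wp_roundsProg (n := n) (ε := ε) (N := N)
    (by simp [hs₁.nat, hn]) (by simp [hs₁.nat, h0]) (by simp [hs₁.real, hε]) hs.large hN'
    (by omega)) (by decide) (by decide) ?_)
  intro s₂ hs₂ hN₂
  refine wp_seq (wp_call (N := [21, 22]) (R := [17]) (wp_bitsProg (n := n) (ε := ε) (Q := Q)
    (A := A) (by simp [hs₂.nat, hs₁.nat, hn]) (by simp [hs₂.nat, hs₁.nat, h0])
    (by simp [hs₂.nat, hs₁.nat, h0]) (by simp [hs₂.real, hs₁.real, hε]) hQ hQ' hA hA'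
    (by omega) (by omega)) (by decide) (by decide) ?_)
  intro s₃ hs₃ hL₃
  refine wp_seq (wp_call (N := [4, 40]) (R := []) (wp_powersProg hL₃ hBL)
    (by decide) (by decide) ?_)
  intro s₄ hs₄ hpow
  refine wp_loopProg (N := N) (Q := Q) (A := A) ⟨?_, ?_, ?_, ?_, ?_, hpow, ?_, ?_, ?_⟩
    hs hQ hA ?_ hB hBN hBL hBP
  · simp [hs₄.nat, hs₃.nat, hs₂.nat, hs₁.nat, hn]
  · simp [hs₄.nat, hs₃.nat, hs₂.nat, hs₁.nat, hk]
  · simp [hs₄.nat, hs₃.nat, hN₂]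
  · simp [hs₄.nat, hL₃]
  · simpa [hs₄.nat, hs₃.nat, hs₂.nat] using hoff
  · simp [hs₄.real, hs₃.real, hs₂.real, hs₁.real, hε]
  · simp [hs₄.real, hs₃.real, hs₂.real, hs₁.real, hw]
  · simpa [hs₄.real, hs₃.real, hs₂.real, hs₁.real] using hC
  · simp [hs₄.nat, hs₃.nat, hs₂.nat, hs₁.nat, h0]

end

/-! ### Transfer to instances and solutions -/

/-- A vector extended by zero. -/
noncomputable def extend {n : ℕ} (v : Fin n → ℝ) (i : ℕ) : ℝ := if h : i < n then v ⟨i, h⟩ else 0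

@[simp] theorem extend_coe {n : ℕ} (v : Fin n → ℝ) (i : Fin n) : extend v i = v i := by
  simp [extend]

theorem sortDesc_antitone {n : ℕ} (v : Fin n → ℝ) : Antitone (sortDesc v) := fun _ _ h =>
  Tuple.monotone_sort v (Fin.rev_le_rev.mpr h)

theorem sum_sortDesc {n : ℕ} (v : Fin n → ℝ) (φ : ℝ → ℝ) :
    ∑ i, φ (sortDesc v i) = ∑ i, φ (v i) :=
  Equiv.sum_comp (Fin.revPerm.trans (Tuple.sort v)) fun i => φ (v i)

theorem orderedCost_eq {n : ℕ} (w v : Fin n → ℝ) :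
    orderedCost w v = ∑ i ∈ range n, extend w i * extend (sortDesc v) i := by
  simp [orderedCost, Finset.sum_range]

theorem isSorting_sortDesc {n : ℕ} {v : Fin n → ℝ} (hv : ∀ i, 0 ≤ v i) {v' : ℕ → ℝ}
    (h : ∀ i : Fin n, v' i = v i) : IsSorting n v' (extend (sortDesc v)) where
  sum_eq φ := by simp [Finset.sum_range, h, sum_sortDesc]
  anti i j hij hj := by
    simp only [extend, hj, hij.trans_lt hj, dif_pos]
    exact sortDesc_antitone v hij
  nonneg i hi := by
    simp only [extend, hi, dif_pos]
    exact hv _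

section

variable (I : Instance)

theorem Instance.n_pos : 0 < I.n := I.one_le_k.trans I.k_le_n

/-- The point with a given number; large numbers stand for the first point. -/
def Instance.point (i : ℕ) : Fin I.n := if h : i < I.n then ⟨i, h⟩ else ⟨0, I.n_pos⟩

@[simp] theorem Instance.point_coe (i : Fin I.n) : I.point i = i := by
  simp [point]

/-- Distances between numbers of points. -/
def Instance.natDist (i j : ℕ) : ℝ := I.c (I.point i) (I.point j)

theorem Instance.c_nonneg (i j : Fin I.n) : 0 ≤ I.c i j :=
  @dist_nonneg _ I.metric i j

theorem Instance.setting {N : ℕ} {ε : ℝ} (h0 : 0 < ε) (h1 : ε < 1)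
    (hN : 24 * (I.n : ℝ) ^ 3 ≤ N * ε) : Setting I.n I.k N ε (extend I.w) I.natDist where
  anti l := by
    unfold extend
    split_ifs with h1 h2 h2
    · exact I.w_antitone (Fin.mk_le_mk.mpr (Nat.le_succ l))
    · omega
    · exact I.w_nonneg _
    · exact le_rfl
  last := by simp [extend]
  symm i j := @dist_comm _ I.metric _ _
  tri i j l := @dist_triangle _ I.metric _ _ _
  self i := @dist_self _ I.metric _
  nonneg i j := I.c_nonneg _ _
  one_le := I.one_le_k
  le := I.k_le_n
  pos := h0
  lt_one := h1
  large := hN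

variable {I}

theorem HoldsSolution.exists_solution {s : State}
    (h : HoldsSolution I.n I.k (extend I.w) I.natDist s) :
    ∃ S : Solution I, IsOutput s S ∧ S.cost ≤ s.real 15 0 := by
  obtain ⟨F, hFn, hFk, hc, ha, hcost⟩ := h
  have hlt : ∀ j : Fin I.n, s.nat 2 j < I.n := fun j => hFn _ (ha j j.2)
  have hcard : (univ.filter fun i : Fin I.n => (i : ℕ) ∈ F).card = I.k := by
    rw [← hFk, ← card_image_of_injective _ Fin.val_injective]
    congr 1
    ext i
    simp only [mem_image, mem_filter, mem_univ, true_and]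
    exact ⟨by rintro ⟨j, hj, rfl⟩; exact hj, fun hi => ⟨⟨i, hFn i hi⟩, hi, rfl⟩⟩
  refine ⟨⟨_, hcard, fun j => ⟨s.nat 2 j, hlt j⟩, fun j => by simpa using ha j j.2⟩,
    ⟨fun i => by simp [hc i i.2], fun j => rfl⟩, ?_⟩
  rw [Solution.cost, orderedCost_eq]
  refine hcost _ (isSorting_sortDesc (fun i => I.c_nonneg _ _) fun i => ?_)
  simp [Instance.natDist, Instance.point, hlt i]

theorem Solution.isCenterSet (S : Solution I) :
    IsCenterSet I.n I.k I.natDist (S.centers.image Fin.val) (fun j => S.assign (I.point j))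
      (extend (sortDesc fun j => I.c (S.assign j) j)) where
  lt i hi := by
    obtain ⟨j, -, rfl⟩ := mem_image.mp hi
    exact j.2
  card_le := card_image_le.trans S.card_centers.le
  mem j _ := mem_image_of_mem _ (S.assign_mem _)
  sorting := isSorting_sortDesc (fun i => I.c_nonneg _ _) fun i => by
    simp [Instance.natDist]

/-- The largest cost is a distance between two points, which justifies trying only the entries of
the matrix as `M`. -/
theorem Solution.exists_first (S : Solution I) :
    ∃ i < I.n, ∃ j < I.n, extend (sortDesc fun j => I.c (S.assign j) j) 0 = I.natDist i j := by
  set j := Tuple.sort (fun j => I.c (S.assign j) j) (Fin.rev ⟨0, I.n_pos⟩) with hj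
  refine ⟨S.assign j, (S.assign j).2, j, j.2, ?_⟩
  simp only [extend, I.n_pos, dif_pos, sortDesc, ← hj, Instance.natDist, Instance.point_coe]

theorem input_matrix {ε : ℝ} {i j : ℕ} (hi : i < I.n) (hj : j < I.n) :
    (input I ε).real 2 (i * I.n + j) = I.natDist i j := by
  have h1 : (i * I.n + j) / I.n = i := by
    rw [mul_comm, Nat.mul_add_div I.n_pos, Nat.div_eq_of_lt hj, add_zero]
  have h2 : (i * I.n + j) % I.n = j := by
    rw [mul_comm, Nat.mul_add_mod, Nat.mod_eq_of_lt hj]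
  simp [input, h1, h2, hi, hj, Instance.natDist, Instance.point]

end

/-! ### Size bounds and conclusion -/

/-- Bounds for the numbers of steps, in terms of `Y = (n / ε) ^ (1 / ε)`. -/
theorem exists_sizes {n : ℕ} {ε : ℝ} (hn : 1 ≤ n) (h0 : 0 < ε) (h1 : ε < 1) :
    ∃ N Q A : ℕ, 24 * (n : ℝ) ^ 3 ≤ N * ε ∧ (∀ m < N, m * ε < 24 * (n : ℝ) ^ 3) ∧
      (n : ℝ) ≤ ε * (1 + ε) ^ Q ∧ (∀ q < Q, ε * (1 + ε) ^ q < n) ∧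
      n + 1 ≤ 2 ^ A ∧ (∀ a < A, 2 ^ a < n + 1) ∧
      ((n * n + (N + 1) + 2 ^ (Q + A) + 1 : ℕ) : ℝ) ≤ 40 * (((n : ℝ) / ε) ^ (1 / ε)) ^ 3 := by
  classical
  have hn' : (1 : ℝ) ≤ n := by exact_mod_cast hn
  have eN : ∃ N : ℕ, 24 * (n : ℝ) ^ 3 ≤ N * ε := by
    obtain ⟨N, hN⟩ := exists_nat_ge (24 * (n : ℝ) ^ 3 / ε)
    exact ⟨N, (div_le_iff₀ h0).mp hN⟩
  have eQ : ∃ q : ℕ, (n : ℝ) ≤ ε * (1 + ε) ^ q := by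
    obtain ⟨q, hq⟩ := pow_unbounded_of_one_lt ((n : ℝ) / ε) (by linarith : 1 < 1 + ε)
    exact ⟨q, by rw [div_lt_iff₀ h0] at hq; linarith⟩
  have eA : ∃ a : ℕ, n + 1 ≤ 2 ^ a := ⟨n, Nat.lt_two_pow_self⟩
  set Y : ℝ := ((n : ℝ) / ε) ^ (1 / ε) with hY
  have hX : (1 : ℝ) ≤ n / ε := by
    rw [le_div_iff₀ h0]
    linarith
  have hinv : 1 ≤ 1 / ε := by
    rw [le_div_iff₀ h0]
    linarith
  have hXY : (n : ℝ) / ε ≤ Y := by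
    have := Real.rpow_le_rpow_of_exponent_le hX hinv
    rwa [Real.rpow_one] at this
  have hnX : (n : ℝ) ≤ n / ε := by
    rw [le_div_iff₀ h0]
    nlinarith
  have hnY : (n : ℝ) ≤ Y := hnX.trans hXY
  have hY1 : 1 ≤ Y := hn'.trans hnY
  have hN : (Nat.find eN : ℝ) ≤ 24 * Y ^ 3 + 1 := by
    rcases Nat.eq_zero_or_pos (Nat.find eN) with h | h
    · rw [h]
      push_cast
      positivity
    · have h2 := not_le.mp (Nat.find_min eN (m := Nat.find eN - 1) (by omega))
      rw [Nat.cast_sub (by omega), ← lt_div_iff₀ h0] at h2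
      have h3 : 24 * (n : ℝ) ^ 3 / ε = 24 * (n * n * (n / ε)) := by ring
      have h4 : (n : ℝ) * n * (n / ε) ≤ Y * Y * Y := by gcongr
      rw [h3] at h2
      push_cast at h2
      linarith [show Y * Y * Y = Y ^ 3 by ring]
  have hQ : (2 : ℝ) ^ Nat.find eQ ≤ 2 * Y := by
    rcases Nat.eq_zero_or_pos (Nat.find eQ) with h | h
    · rw [h]
      linarith
    · obtain ⟨q, hq⟩ := Nat.exists_eq_succ_of_ne_zero h.ne'
      have h2 := not_le.mp (Nat.find_min eQ (m := q) (by omega))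
      rw [hq, pow_succ, mul_comm]
      -- Bernoulli's inequality converts powers of `1 + ε` into powers of two, at the price of the
      -- exponent `1 / ε`.
      have h3 : (2 : ℝ) ≤ (1 + ε) ^ (1 / ε) := by
        have := one_add_mul_self_le_rpow_one_add (by linarith : -1 ≤ ε) hinv
        rw [one_div, inv_mul_cancel₀ h0.ne'] at this
        rw [one_div]
        linarith
      have h4 : (1 + ε) ^ q ≤ n / ε := by
        rw [le_div_iff₀ h0]
        linarith
      have h5 : (2 : ℝ) ^ q ≤ Y := by
        calc (2 : ℝ) ^ q ≤ ((1 + ε) ^ (1 / ε)) ^ q := by gcongr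
          _ = ((1 + ε) ^ q) ^ (1 / ε) := by
            rw [← Real.rpow_natCast, ← Real.rpow_mul (by linarith), mul_comm,
              Real.rpow_mul (by linarith), Real.rpow_natCast]
          _ ≤ Y := Real.rpow_le_rpow (by positivity) h4 (by positivity)
      linarith
  have hA : (2 : ℝ) ^ Nat.find eA ≤ 2 * Y := by
    rcases Nat.eq_zero_or_pos (Nat.find eA) with h | h
    · rw [h]
      linarith
    · obtain ⟨a, ha⟩ := Nat.exists_eq_succ_of_ne_zero h.ne'
      have h2 := not_le.mp (Nat.find_min eA (m := a) (by omega))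
      have h3 : (2 : ℝ) ^ a ≤ n := by exact_mod_cast Nat.lt_succ_iff.mp h2
      rw [ha, pow_succ]
      linarith
  refine ⟨Nat.find eN, Nat.find eQ, Nat.find eA, Nat.find_spec eN,
    fun m hm => not_le.mp (Nat.find_min eN hm), Nat.find_spec eQ,
    fun m hm => not_le.mp (Nat.find_min eQ hm), Nat.find_spec eA,
    fun m hm => not_le.mp (Nat.find_min eA hm), ?_⟩
  push_cast
  have h2 : (n : ℝ) * n ≤ Y * Y := by gcongr
  have h3 : (2 : ℝ) ^ (Nat.find eQ + Nat.find eA) ≤ 2 * Y * (2 * Y) := by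
    rw [pow_add]
    gcongr
  have h4 : Y ^ 2 ≤ Y ^ 3 := pow_le_pow_right₀ hY1 (by norm_num)
  have h5 : 1 ≤ Y ^ 3 := one_le_pow₀ hY1
  -- The summands are at most `Y ^ 2`, `24 * Y ^ 3 + 2`, `4 * Y ^ 2` and `1`, together at most `32 *
  -- Y ^ 3`.
  nlinarith

end OrderedKMedian

/-- One program, given an instance of ordered `k`-median and `ε`, computes within
`poly ((n / ε) ^ (1 / ε))` steps a solution whose cost is at most `18 + C * ε` times the cost of
every solution. -/
theorem theorem3 :
    ∃ (A : RealRAM.Program) (C : ℝ) (poly : Polynomial ℝ),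
      ∀ (I : OrderedKMedian.Instance) (ε : ℝ), 0 < ε → ε < 1 →
        ∃ (s : RealRAM.State) (t : ℕ) (S : OrderedKMedian.Solution I),
          RealRAM.Runs A (OrderedKMedian.input I ε) s t ∧
          (t : ℝ) ≤ poly.eval (((I.n : ℝ) / ε) ^ (1 / ε)) ∧
          OrderedKMedian.IsOutput s S ∧
          ∀ S' : OrderedKMedian.Solution I, S.cost ≤ (18 + C * ε) * S'.cost := by
  open OrderedKMedian in
  obtain ⟨c, d, hcd⟩ := mainProg.exists_bound_le
  refine ⟨mainProg, 28, Polynomial.C (c : ℝ) * (Polynomial.C 40 * Polynomial.X ^ 3) ^ d,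
    fun I ε h0 h1 => ?_⟩
  obtain ⟨N, Q, A, hN, hN', hQ, hQ', hA, hA', hsize⟩ :=
    exists_sizes (I.one_le_k.trans I.k_le_n) h0 h1
  have hQA : Q + A < 2 ^ (Q + A) := Nat.lt_two_pow_self
  -- The sum of the sizes serves as a common bound `B` for the iterations of all loops.
  obtain ⟨s, t, hrun, ht, hV, hR⟩ := wp_mainProg (B := I.n * I.n + (N + 1) + 2 ^ (Q + A))
    (s := input I ε) (n := I.n) (k := I.k) (w := extend I.w) (C := I.natDist) (ε := ε)
    (by simp [input]) (by simp [input]) (fun a ha => by simp [input, ha]) (by simp [input])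
    (by funext i; simp [input, extend]) (fun i hi j hj => input_matrix hi hj)
    (I.setting h0 h1 hN) hN' hQ hQ' hA hA' (by omega) (by omega) (by omega) (by omega)
  -- Every solution can play the role of the comparison solution, so no optimal one has to be
  -- chosen.
  have hrec := fun S' : Solution I => hR _ _ _ S'.isCenterSet S'.exists_first
  -- some solution exists, so that a solution has been recorded
  obtain ⟨F, -, hF⟩ := Finset.exists_subset_card_eq
    (show I.k ≤ (Finset.univ : Finset (Fin I.n)).card by simpa using I.k_le_n)
  obtain ⟨x, hx⟩ := Finset.card_pos.mp (hF ▸ I.one_le_k : 0 < F.card)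
  obtain ⟨S, hS, hcost⟩ := (hV (hrec ⟨F, hF, fun _ => x, fun _ => hx⟩).1).exists_solution
  refine ⟨s, t, S, hrun, ?_, hS, fun S' => ?_⟩
  · have h2 : (t : ℝ) ≤ c * ((I.n * I.n + (N + 1) + 2 ^ (Q + A) + 1 : ℕ) : ℝ) ^ d := by
      exact_mod_cast ht.trans (hcd _)
    refine h2.trans ?_
    simp only [Polynomial.eval_mul, Polynomial.eval_C, Polynomial.eval_pow, Polynomial.eval_X]
    gcongr
  · rw [show S'.cost = _ from orderedCost_eq _ _]
    exact hcost.trans (hrec S').2
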